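/- Let $G=(V,E)$ be a finite undirected graph (parallel edges allowed) with vertex weights $w:V\to\mathbb N=\{0,1,2,\dots\}$; write $|G|=|V|+|E|$ and $w(G)=\sum_{v\in V}w(v)$. The graph $G$ is *series-parallel* if, for some choice of two terminals (a source and a sink), it belongs to the smallest class of two-terminal graphs that contains $K_2$ and is closed under series composition (take disjoint graphs and identify the sink of the first with the source of the second) and parallel composition (identify the two sources and identify the two sinks). A *balanced connected 2-partition* of $(G,w)$ is an ordered pair $(A,B)$ of disjoint sets with $A\cup B=V$, such that $A$ and $B$ both induce (nonempty) connected subgraphs and $\sum_{v\in A}w(v)=\sum_{v\in B}w(v)$. Let $P_2^0(G,w)$ be the set of all of them. **Theorem.** There are a probabilistic algorithm (a program for a random access machine with fair coin tosses and logarithmic cost) and a polynomial $p$ in two variables such that, for every node-weighted series-parallel graph $(G,w)$, given by its list of edges and its vertex weights, the algorithm always halts within time $p(|G|,w(G))$ and samples uniformly from $P_2^0(G,w)$. That is: if $P_2^0(G,w)\neq\emptyset$, it accepts with probability at least $\tfrac12$ and, conditioned on acceptance, outputs each element of $P_2^0(G,w)$ with probability exactly $1/|P_2^0(G,w)|$;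 if $P_2^0(G,w)=\emptyset$, it always rejects. -/

import Mathlib

open scoped ENNReal

/-! ### Node-weighted graphs, series-parallel graphs, balanced connected 2-partitions -/

/-- A finite undirected graph on the vertices `0, …, n - 1`, given by the list of its edges
(parallel edges are allowed, the order of the two ends of an edge is irrelevant), together with a
natural number weight on every vertex. -/
structure NodeWeightedGraph where
  /-- the number of vertices -/
  n : ℕ
  /-- the edges -/
  edges : List (Fin n × Fin n)
  /-- the vertex weights -/
  w : Fin n → ℕ

/-- `IsTwoTerminalSP V E s t`: the two-terminal (multi)graph with vertex set `V`, edge multiset `E`,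
source `s` and sink `t` is series-parallel. This is the smallest class that contains `K₂` and is
closed under series and parallel composition. Identifying terminals in a disjoint union of two
graphs gives, up to isomorphism, the union of two graphs without common edges whose vertex sets
meet exactly in the identified terminals; this is how the compositions are written here. -/
inductive IsTwoTerminalSP {α : Type} [DecidableEq α] :
    Finset α → Multiset (Sym2 α) → α → α → Prop
  | edge (s t : α) (h : s ≠ t) : IsTwoTerminalSP {s, t} {s(s, t)} s t
  | series (V₁ V₂ : Finset α) (E₁ E₂ : Multiset (Sym2 α)) (s m t : α)
      (h₁ : IsTwoTerminalSP V₁ E₁ s m) (h₂ : IsTwoTerminalSP V₂ E₂ m t)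
      (h : V₁ ∩ V₂ = {m}) : IsTwoTerminalSP (V₁ ∪ V₂) (E₁ + E₂) s t
  | parallel (V₁ V₂ : Finset α) (E₁ E₂ : Multiset (Sym2 α)) (s t : α)
      (h₁ : IsTwoTerminalSP V₁ E₁ s t) (h₂ : IsTwoTerminalSP V₂ E₂ s t)
      (h : V₁ ∩ V₂ = {s, t}) : IsTwoTerminalSP (V₁ ∪ V₂) (E₁ + E₂) s t

namespace NodeWeightedGraph

/-- The graph is series-parallel for some choice of its two terminals. -/
def IsSeriesParallel (G : NodeWeightedGraph) : Prop :=
  ∃ s t : Fin G.n,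
    IsTwoTerminalSP Finset.univ
      ((G.edges.map fun e => s(e.1, e.2) : List (Sym2 (Fin G.n))) : Multiset (Sym2 (Fin G.n))) s t

/-- The adjacency relation. -/
def graph (G : NodeWeightedGraph) : SimpleGraph (Fin G.n) :=
  SimpleGraph.fromRel fun u v => (u, v) ∈ G.edges

/-- `|G|`: the number of vertices plus the number of edges. -/
def size (G : NodeWeightedGraph) : ℕ := G.n + G.edges.length

/-- `w(G)`: the sum of all vertex weights. -/
def totalWeight (G : NodeWeightedGraph) : ℕ := ∑ v, G.w v

/-- The (ordered) balanced connected 2-partitions `(A, B)`: both blocks induce connected (hence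
nonempty) subgraphs, and both have the same weight. -/
def balancedPartitions (G : NodeWeightedGraph) : Set (Finset (Fin G.n) × Finset (Fin G.n)) :=
  {P | Disjoint P.1 P.2 ∧ P.1 ∪ P.2 = Finset.univ ∧
    (G.graph.induce (P.1 : Set (Fin G.n))).Connected ∧
    (G.graph.induce (P.2 : Set (Fin G.n))).Connected ∧
    ∑ v ∈ P.1, G.w v = ∑ v ∈ P.2, G.w v}

/-- The input word of a node-weighted graph: the number of vertices, the number of edges, the two
ends of every edge, the vertex weights. -/
def encode (G : NodeWeightedGraph) : List ℕ :=
  G.n :: G.edges.length ::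
    (G.edges.flatMap (fun e => [(e.1 : ℕ), (e.2 : ℕ)]) ++ List.ofFn G.w)

/-- The output word of a 2-partition `(A, B)`: the indicator vector of `A`. -/
def encodePartition (G : NodeWeightedGraph) (P : Finset (Fin G.n) × Finset (Fin G.n)) : List ℕ :=
  List.ofFn fun v => if v ∈ P.1 then 1 else 0

/-- Distinct balanced partitions have distinct output words. -/
theorem encodePartition_injOn (G : NodeWeightedGraph) :
    Set.InjOn G.encodePartition G.balancedPartitions := by
  rintro ⟨A, B⟩ hP ⟨A', B'⟩ hQ h
  have hA : A = A' := by
    ext v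
    have := congrFun (List.ofFn_injective h) v
    by_cases h₁ : v ∈ A <;> by_cases h₂ : v ∈ A' <;> simp_all
  have key : ∀ C D : Finset (Fin G.n), Disjoint C D → C ∪ D = Finset.univ → D = Cᶜ :=
    fun C D hd hu => (IsCompl.compl_eq ⟨hd, codisjoint_iff.2 hu⟩).symm
  have hB := key A B hP.1 hP.2.1
  have hB' := key A' B' hQ.1 hQ.2.1
  subst hA
  rw [hB, hB']

end NodeWeightedGraph

/-! ### Probabilistic random access machines with logarithmic cost

The machine has a read-only input (a list of natural numbers), a memory of cells `0, 1, 2, …` each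
holding a natural number (all `0` at the start), and an append-only output. It can toss fair coins.
The cost of a step is one plus the bit lengths of all the numbers handled in it, including the
addresses that are used indirectly. -/

namespace RAM

/-- The arithmetic operations (`sub` truncates at `0`, `div` rounds down). -/
inductive ArithOp
  | add
  | sub
  | mul
  | div

/-- The value of an arithmetic operation. -/
def ArithOp.apply : ArithOp → ℕ → ℕ → ℕ
  | add, a, b => a + b
  | sub, a, b => a - b
  | mul, a, b => a * b
  | div, a, b => a / b

/-- The commands; `mem` is the memory and `x`, `y`, `z` are fixed addresses in it.
A program is a list of commands. -/
inductive Cmd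
  /-- `mem[x] := c` -/
  | const (x c : ℕ)
  /-- `mem[x] := mem[y] op mem[z]` -/
  | arith (op : ArithOp) (x y z : ℕ)
  /-- `mem[x] := mem[mem[y]]` -/
  | load (x y : ℕ)
  /-- `mem[mem[x]] := mem[y]` -/
  | store (x y : ℕ)
  /-- `mem[x] :=` entry number `mem[y]` of the input (`0` beyond its end) -/
  | read (x y : ℕ)
  /-- append `mem[x]` to the output -/
  | write (x : ℕ)
  /-- `mem[x] :=` a fair random bit -/
  | coin (x : ℕ)
  /-- if `mem[x] ≠ 0` do `p`, else do `q` -/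
  | ite (x : ℕ) (p q : List Cmd)
  /-- while `mem[x] ≠ 0` do `p` -/
  | loop (x : ℕ) (p : List Cmd)

/-- A state of a run: the commands that are still to be executed, the memory, the output written so
far, and the cost accumulated so far. -/
structure State where
  /-- what is still to be executed -/
  todo : List Cmd
  /-- the memory -/
  mem : ℕ → ℕ
  /-- the output -/
  out : List ℕ
  /-- the cost so far -/
  cost : ℕ

/-- The initial state of the program `M`. -/
def start (M : List Cmd) : State := ⟨M, fun _ => 0, [], 0⟩

/-- One step on the input `inp`, as a probability distribution on the next state. It is
deterministic except for `coin`, and nothing happens after the program has ended. -/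
noncomputable def step (inp : List ℕ) : State → PMF State
  | ⟨[], mem, out, cost⟩ => PMF.pure ⟨[], mem, out, cost⟩
  | ⟨.const x c :: k, mem, out, cost⟩ =>
      PMF.pure ⟨k, Function.update mem x c, out, cost + (1 + c.size)⟩
  | ⟨.arith op x y z :: k, mem, out, cost⟩ =>
      PMF.pure ⟨k, Function.update mem x (op.apply (mem y) (mem z)), out,
        cost + (1 + (mem y).size + (mem z).size)⟩
  | ⟨.load x y :: k, mem, out, cost⟩ =>
      PMF.pure ⟨k, Function.update mem x (mem (mem y)), out,
        cost + (1 + (mem y).size + (mem (mem y)).size)⟩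
  | ⟨.store x y :: k, mem, out, cost⟩ =>
      PMF.pure ⟨k, Function.update mem (mem x) (mem y), out,
        cost + (1 + (mem x).size + (mem y).size)⟩
  | ⟨.read x y :: k, mem, out, cost⟩ =>
      PMF.pure ⟨k, Function.update mem x (inp.getD (mem y) 0), out,
        cost + (1 + (mem y).size + (inp.getD (mem y) 0).size)⟩
  | ⟨.write x :: k, mem, out, cost⟩ =>
      PMF.pure ⟨k, mem, out ++ [mem x], cost + (1 + (mem x).size)⟩
  | ⟨.coin x :: k, mem, out, cost⟩ =>
      (PMF.uniformOfFintype Bool).map fun b =>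
        ⟨k, Function.update mem x b.toNat, out, cost + 1⟩
  | ⟨.ite x p q :: k, mem, out, cost⟩ =>
      PMF.pure ⟨(if mem x = 0 then q else p) ++ k, mem, out, cost + (1 + (mem x).size)⟩
  | ⟨.loop x p :: k, mem, out, cost⟩ =>
      PMF.pure ⟨if mem x = 0 then k else p ++ .loop x p :: k, mem, out,
        cost + (1 + (mem x).size)⟩

/-- The distribution of the state after `t` steps from the state `s`. -/
noncomputable def run (inp : List ℕ) : ℕ → State → PMF State
  | 0, s => PMF.pure s
  | t + 1, s => (step inp s).bind (run inp t)

/-- On the input `inp`, the program `M` always ends, whatever the coin tosses, and its cost is at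
most `T`. (Every step costs at least `1`, so that `T` steps are enough.) -/
def HaltsInTime (M : List Cmd) (inp : List ℕ) (T : ℕ) : Prop :=
  ∀ s ∈ (run inp T (start M)).support, s.todo = [] ∧ s.cost ≤ T

/-- The result of a run with final state `s`: the run accepts if cell `0` is nonzero, and then its
result is the output; otherwise it rejects. -/
def State.result (s : State) : Option (List ℕ) :=
  if s.mem 0 = 0 then none else some s.out

/-- The distribution of the result of `M` on the input `inp` after `T` steps. -/
noncomputable def resultDist (M : List Cmd) (inp : List ℕ) (T : ℕ) : PMF (Option (List ℕ)) :=
  (run inp T (start M)).map State.result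

end RAM

/-- `D` is the distribution of the result of an exact uniform sampler from the finite set `S`, whose
elements are represented through `enc`; `none` stands for rejection. If `S` is nonempty, the sampler
accepts with probability at least one half and, conditioned on acceptance, every element of `S` has
probability `1 / |S|`. If `S` is empty, it always rejects. -/
def SamplesUniformly {α β : Type} (D : PMF (Option β)) (enc : α → β) (S : Set α) : Prop :=
  (S.Nonempty → D none ≤ 1 / 2 ∧
    ∀ a ∈ S, D (some (enc a)) / (1 - D none) = 1 / (S.ncard : ℝ≥0∞)) ∧
  (S = ∅ → D none = 1)

/-!
The sampler counts, and then unranks. Let `N` be the number of balanced connected 2-partitions of the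
graph with `n` vertices, so that `N ≤ 2 ^ n`. From `n` coin tosses the machine forms a uniform random
number `r < 2 ^ n`; it rejects if `r` is not below the largest multiple of `N` that is at most
`2 ^ n`, and otherwise outputs the partition number `r % N` in the lexicographic order
(`samplesUniformly_map_coins`, `existsUnique_unrank`). The unranking decides for one vertex after the
other on which side it lies, and for this it has to know how many balanced partitions begin with a
given word (`den_nextLetter`). Everything thus rests on counting the balanced partitions that are
consistent with prescribed sides of some vertices.

A vertex `u` gets the weight `b ^ (2 * w u)` on the first side and `1` on the second side, with
`b = 2 ^ (n + 1)`, and the weight `0` on a side that is forbidden for it. The sum over all connected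
2-partitions of the product of these weights is a sum of at most `2 ^ n` powers of `b`, and its digit
to the base `b` at the position of the total weight is the number of balanced partitions
(`sum_pow_mod_div`, `prefixCount_balancedWords`). It suffices to compute the sum modulo
`b ^ (w G + 1)`; all numbers then have polynomially many bits.

The sum itself is determined by a dynamic program on series-parallel graphs. For a two-terminal graph
one keeps the sums over the colourings of its inner vertices with two colours, classified by what the
colour classes look like (`SPLabel`): one colour only, two connected classes that separate the
terminals, and so on. These labels can be composed in series and in parallel
(`SeriesData.graphLabel_eq`, `ParallelData.graphLabel_eq`). No decomposition of the graph has to be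
found: in a graph whose edges carry labels, parallel edges are merged, and a vertex with exactly two
neighbours is replaced by an edge with the series label. The graph remains series-parallel and the
sum over its connected 2-partitions does not change (`LabelledSP.merge_parallel`,
`LabelledSP.suppress`, `Represents.eliminate`), even when the eliminated vertex is a terminal of the
decomposition: the relevant identities are `contract_ser` and its companions. A series-parallel graph
without parallel edges and with more than two vertices has such a vertex, so in the end a single edge
is left, and its label gives the sum (`Represents.exists_degree_two`, `Represents.eq_total`).

The algorithm is written in a language whose only loops are repetitions with the number of rounds
given by an input entry, and whose products are reduced modulo a fixed number. Then every program
runs in polynomial time: an operation adds a bounded number of bits, and the number of operations is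
at most a polynomial in the largest input entry (`Stmt.exists_runsWithin`). As the input contains
only numbers that are at most `|G| + w G`, this is the required bound (`machine_spec`).
-/


/-! ### Runs of random access machines -/

namespace RAM

theorem run_add (w : List ℕ) (t u : ℕ) (s : State) :
    run w (t + u) s = (run w t s).bind (run w u) := by
  induction t generalizing s with
  | zero => simp [run]
  | succ t ih => rw [Nat.succ_add]; simp only [run, PMF.bind_bind]; congr; funext; exact ih _

theorem run_of_todo_nil (w : List ℕ) (t : ℕ) (s : State) (h : s.todo = []) :
    run w t s = PMF.pure s := by
  obtain ⟨k, mem, out, c⟩ := s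
  subst h
  induction t with
  | zero => rfl
  | succ t ih => simp [run, step, ih]

/-- On the input `w` the machine passes, without any coin toss, from the state `s` to the state
`s'`; the cost of this is at most `D` and at least the number of steps. -/
def Steps (w : List ℕ) (s s' : State) (D : ℕ) : Prop :=
  ∃ t, run w t s = PMF.pure s' ∧ s.cost + t ≤ s'.cost ∧ s'.cost ≤ s.cost + D

theorem Steps.refl (w : List ℕ) (s : State) : Steps w s s 0 := ⟨0, by simp [run]⟩

theorem Steps.trans {w : List ℕ} {s s' s'' : State} {D D' : ℕ} (h : Steps w s s' D)
    (h' : Steps w s' s'' D') : Steps w s s'' (D + D') := by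
  obtain ⟨t, h₁, h₂, h₃⟩ := h
  obtain ⟨t', h₁', h₂', h₃'⟩ := h'
  exact ⟨t + t', by rw [run_add, h₁, PMF.pure_bind, h₁'], by omega, by omega⟩

theorem Steps.mono {w : List ℕ} {s s' : State} {D D' : ℕ} (h : Steps w s s' D) (hD : D ≤ D') :
    Steps w s s' D' := by
  obtain ⟨t, h₁, h₂, h₃⟩ := h
  exact ⟨t, h₁, h₂, by omega⟩

theorem Steps.of_step {w : List ℕ} {s s' : State} (h : step w s = PMF.pure s')
    (h₁ : s.cost + 1 ≤ s'.cost) : Steps w s s' (s'.cost - s.cost) :=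
  ⟨1, by simp only [run, h, PMF.pure_bind], h₁, by omega⟩

/-- A transition of a single step of known cost, followed by further transitions. -/
theorem Steps.cons {w : List ℕ} {s s' s'' : State} {D : ℕ} (h : step w s = PMF.pure s')
    (h₁ : s.cost + 1 ≤ s'.cost) (h' : Steps w s' s'' D) :
    Steps w s s'' (s'.cost - s.cost + D) :=
  (Steps.of_step h h₁).trans h'

end RAM

/-! ### A language of bounded loops and its compiler -/

namespace BoundedLoop

open RAM

/-- Expressions with values in `ℕ`. The memory of the language consists of arrays `f = 0, 1, 2, …`
with two indices each; scalars are kept at the indices `0, 0`. -/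
inductive Expr
  /-- a numeral -/
  | lit (c : ℕ)
  /-- a sum -/
  | add (a b : Expr)
  /-- a difference, truncated at `0` -/
  | sub (a b : Expr)
  /-- a quotient, rounded down -/
  | div (a b : Expr)
  /-- a product modulo one plus the scalar `1` -/
  | mul (a b : Expr)
  /-- an entry of the array `f` -/
  | get (f : ℕ) (a b : Expr)
  /-- an entry of the input -/
  | inp (a : Expr)

/-- The contents of the arrays. -/
abbrev Store := ℕ → ℕ → ℕ → ℕ

/-- The value of an expression. Products are reduced modulo `h 1 0 0 + 1`, so that no operation
makes numbers longer by more than one bit. -/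
def Expr.eval (w : List ℕ) (h : Store) : Expr → ℕ
  | lit c => c
  | add a b => a.eval w h + b.eval w h
  | sub a b => a.eval w h - b.eval w h
  | div a b => a.eval w h / b.eval w h
  | mul a b => (a.eval w h * b.eval w h) % (h 1 0 0 + 1)
  | get f a b => h f (a.eval w h) (b.eval w h)
  | inp a => w.getD (a.eval w h) 0

/-- Programs. The only loops are repetitions whose number is an entry of the input; therefore
every program ends in polynomial time. -/
inductive Stmt
  /-- do nothing -/
  | skip
  /-- assign `e` to the entry `a, b` of the array `f` -/
  | put (f : ℕ) (a b e : Expr)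
  /-- append `e` to the output -/
  | write (e : Expr)
  /-- do `p`, then `q` -/
  | seq (p q : Stmt)
  /-- if `e ≠ 0` do `p`, else do `q` -/
  | ite (e : Expr) (p q : Stmt)
  /-- do `p` as many times as entry number `e` of the input says -/
  | rep (e : Expr) (p : Stmt)

/-- A state of the language: the arrays and the output. -/
structure Config where
  /-- the arrays -/
  h : Store
  /-- the output -/
  out : List ℕ

/-- Assignment to an entry of an array. -/
def Store.set (h : Store) (f a b x : ℕ) : Store :=
  fun f' a' b' => if f' = f ∧ a' = a ∧ b' = b then x else h f' a' b'

/-- The effect of a program. -/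
def Stmt.den (w : List ℕ) : Stmt → Config → Config
  | skip, σ => σ
  | put f a b e, σ => ⟨σ.h.set f (a.eval w σ.h) (b.eval w σ.h) (e.eval w σ.h), σ.out⟩
  | write e, σ => ⟨σ.h, σ.out ++ [e.eval w σ.h]⟩
  | seq p q, σ => q.den w (p.den w σ)
  | ite e p q, σ => if e.eval w σ.h = 0 then q.den w σ else p.den w σ
  | rep e p, σ => (p.den w)^[w.getD (e.eval w σ.h) 0] σ

/-- A polynomial injection of `ℕ × ℕ` into `ℕ`. -/
def pr (u v : ℕ) : ℕ := (u + v) * (u + v) + v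

theorem pr_inj {u v u' v' : ℕ} (h : pr u v = pr u' v') : u = u' ∧ v = v' := by
  unfold pr at h
  have : u + v = u' + v' := by
    rcases lt_trichotomy (u + v) (u' + v') with h' | h' | h'
    · nlinarith
    · exact h'
    · nlinarith
  rw [this] at h
  omega

/-- The RAM address of an array entry. The odd addresses are left for intermediate results. -/
def addr (f u v : ℕ) : ℕ := 2 * pr (pr u v) f

theorem addr_inj {f u v f' u' v' : ℕ} (h : addr f u v = addr f' u' v') :
    f = f' ∧ u = u' ∧ v = v' := by
  unfold addr at h
  obtain ⟨h₁, h₂⟩ := pr_inj (Nat.eq_of_mul_eq_mul_left two_pos h)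
  obtain ⟨h₃, h₄⟩ := pr_inj h₁
  exact ⟨h₂, h₃, h₄⟩

/-- The RAM memory holds the arrays `h` at the even addresses. -/
def Rel (mem : ℕ → ℕ) (h : Store) : Prop := ∀ f u v, mem (addr f u v) = h f u v

/-- The memories agree except at the odd addresses from `2 * d + 1` on. -/
def Agree (d : ℕ) (mem mem' : ℕ → ℕ) : Prop := ∀ a, (a % 2 = 1 → a < 2 * d + 1) → mem' a = mem a

theorem Agree.rel {d : ℕ} {mem mem' : ℕ → ℕ} {h : Store} (ha : Agree d mem mem')
    (hr : Rel mem h) : Rel mem' h := fun f u v => by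
  rw [ha _ (by unfold addr; omega), hr]

theorem Agree.trans {d : ℕ} {m m' m'' : ℕ → ℕ} (h : Agree d m m') (h' : Agree d m' m'') :
    Agree d m m'' := fun a ha => by rw [h' a ha, h a ha]

theorem Agree.mono {d d' : ℕ} {m m' : ℕ → ℕ} (h : Agree d' m m') (hd : d ≤ d') :
    Agree d m m' := fun a ha => h a fun h₁ => by have := ha h₁; omega

theorem Agree.update {d : ℕ} {m m' : ℕ → ℕ} (h : Agree d m m') {a x : ℕ} (ha : a % 2 = 1)
    (ha' : 2 * d + 1 ≤ a) : Agree d m (Function.update m' a x) := fun b hb => by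
  rw [Function.update_of_ne (by rintro rfl; have := hb ha; omega), h b hb]

/-- Code that turns the indices in the cells `2 * d + 1` and `2 * d + 3` into the address of an
entry of the array `f`. -/
def addrCode (f d : ℕ) : List Cmd :=
  [.arith .add (2 * d + 1) (2 * d + 1) (2 * d + 3),
   .arith .mul (2 * d + 1) (2 * d + 1) (2 * d + 1),
   .arith .add (2 * d + 1) (2 * d + 1) (2 * d + 3),
   .const (2 * d + 3) f,
   .arith .add (2 * d + 1) (2 * d + 1) (2 * d + 3),
   .arith .mul (2 * d + 1) (2 * d + 1) (2 * d + 1),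
   .arith .add (2 * d + 1) (2 * d + 1) (2 * d + 3),
   .arith .add (2 * d + 1) (2 * d + 1) (2 * d + 1)]

/-- Code that puts the value of an expression into the cell `2 * d + 1`, using only the odd cells
from there on. -/
def Expr.compile : Expr → ℕ → List Cmd
  | lit c, d => [.const (2 * d + 1) c]
  | add a b, d => a.compile d ++ (b.compile (d + 1) ++
      [.arith .add (2 * d + 1) (2 * d + 1) (2 * d + 3)])
  | sub a b, d => a.compile d ++ (b.compile (d + 1) ++
      [.arith .sub (2 * d + 1) (2 * d + 1) (2 * d + 3)])
  | div a b, d => a.compile d ++ (b.compile (d + 1) ++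
      [.arith .div (2 * d + 1) (2 * d + 1) (2 * d + 3)])
  | mul a b, d => a.compile d ++ (b.compile (d + 1) ++
      [.arith .mul (2 * d + 1) (2 * d + 1) (2 * d + 3),
       .const (2 * d + 3) 1,
       .arith .add (2 * d + 3) (addr 1 0 0) (2 * d + 3),
       .arith .div (2 * d + 5) (2 * d + 1) (2 * d + 3),
       .arith .mul (2 * d + 5) (2 * d + 5) (2 * d + 3),
       .arith .sub (2 * d + 1) (2 * d + 1) (2 * d + 5)])
  | get f a b, d => a.compile d ++ (b.compile (d + 1) ++
      (addrCode f d ++ [.load (2 * d + 1) (2 * d + 1)]))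
  | inp a, d => a.compile d ++ [.read (2 * d + 1) (2 * d + 1)]

/-- The code of a program; it uses the odd cells from `2 * d + 1` on for intermediate results. -/
def Stmt.compile : Stmt → ℕ → List Cmd
  | skip, _ => []
  | put f a b e, d => e.compile d ++ (a.compile (d + 1) ++ (b.compile (d + 2) ++
      (addrCode f (d + 1) ++ [.store (2 * (d + 1) + 1) (2 * d + 1)])))
  | write e, d => e.compile d ++ [.write (2 * d + 1)]
  | seq p q, d => p.compile d ++ q.compile d
  | ite e p q, d => e.compile d ++ [.ite (2 * d + 1) (p.compile d) (q.compile d)]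
  | rep e p, d => e.compile d ++ [.read (2 * d + 1) (2 * d + 1),
      .loop (2 * d + 1) (p.compile (d + 1) ++
        [.const (2 * d + 3) 1, .arith .sub (2 * d + 1) (2 * d + 1) (2 * d + 3)])]

theorem size_add_le (a b : ℕ) : (a + b).size ≤ max a.size b.size + 1 := by
  rw [Nat.size_le, pow_succ]
  have h₁ := (Nat.lt_size_self a).trans_le
    (Nat.pow_le_pow_right two_pos (le_max_left a.size b.size))
  have h₂ := (Nat.lt_size_self b).trans_le
    (Nat.pow_le_pow_right two_pos (le_max_right a.size b.size))
  omega

theorem size_mul_le (a b : ℕ) : (a * b).size ≤ a.size + b.size := by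
  rw [Nat.size_le, pow_add]
  exact Nat.mul_lt_mul'' (Nat.lt_size_self a) (Nat.lt_size_self b)

theorem size_le_self (a : ℕ) : a.size ≤ a := Nat.size_le.2 Nat.lt_two_pow_self

theorem size_getD_le {w : List ℕ} {B : ℕ} (hw : ∀ x ∈ w, x ≤ B) (i : ℕ) :
    (w.getD i 0).size ≤ B := by
  refine (size_le_self _).trans ?_
  rcases lt_or_ge i w.length with h | h
  · rw [List.getD_eq_getElem _ _ h]; exact hw _ (List.getElem_mem h)
  · rw [List.getD_eq_default _ _ h]; exact Nat.zero_le _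

/-- All numbers in the arrays have at most `B` bits. -/
def Bounded (B : ℕ) (h : Store) : Prop := ∀ f u v, (h f u v).size ≤ B

/-- An expression produces numbers with a bounded number of additional bits. -/
theorem Expr.exists_size_eval_le (e : Expr) : ∃ g, ∀ (w : List ℕ) (h : Store) (B : ℕ),
    (∀ x ∈ w, x ≤ B) → Bounded B h → (e.eval w h).size ≤ B + g := by
  induction e with
  | lit c => exact ⟨c.size, fun _ _ _ _ _ => Nat.le_add_left _ _⟩
  | add a b iha ihb =>
    obtain ⟨ga, iha⟩ := iha
    obtain ⟨gb, ihb⟩ := ihb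
    refine ⟨ga + gb + 1, fun w h B hw hB => ?_⟩
    have h₁ := iha w h B hw hB
    have h₂ := ihb w h B hw hB
    have h₃ := size_add_le (a.eval w h) (b.eval w h)
    simp only [eval]
    omega
  | sub a b iha ihb =>
    obtain ⟨ga, iha⟩ := iha
    exact ⟨ga, fun w h B hw hB => (Nat.size_le_size (Nat.sub_le _ _)).trans (iha w h B hw hB)⟩
  | div a b iha ihb =>
    obtain ⟨ga, iha⟩ := iha
    exact ⟨ga, fun w h B hw hB => (Nat.size_le_size (Nat.div_le_self _ _)).trans (iha w h B hw hB)⟩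
  | mul a b iha ihb =>
    refine ⟨0, fun w h B hw hB => (Nat.size_le_size ?_).trans (hB 1 0 0)⟩
    exact Nat.lt_succ_iff.1 (Nat.mod_lt _ (Nat.succ_pos _))
  | get f a b iha ihb => exact ⟨0, fun w h B hw hB => hB _ _ _⟩
  | inp a iha => exact ⟨0, fun w h B hw hB => size_getD_le hw _⟩

theorem addrCode_steps (w : List ℕ) (f d : ℕ) (k : List Cmd) (mem : ℕ → ℕ) (out : List ℕ)
    (c : ℕ) : ∃ mem' c', Steps w ⟨addrCode f d ++ k, mem, out, c⟩ ⟨k, mem', out, c'⟩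
      (60 * ((mem (2 * d + 1)).size + (mem (2 * d + 3)).size + f.size + 1)) ∧
      mem' (2 * d + 1) = addr f (mem (2 * d + 1)) (mem (2 * d + 3)) ∧ Agree d mem mem' ∧
      (addr f (mem (2 * d + 1)) (mem (2 * d + 3))).size ≤
        12 * ((mem (2 * d + 1)).size + (mem (2 * d + 3)).size + f.size + 1) := by
  set u := mem (2 * d + 1) with hu
  set v := mem (2 * d + 3) with hv
  have s₁ := size_add_le u v
  have s₂ := size_mul_le (u + v) (u + v)
  have s₃ := size_add_le ((u + v) * (u + v)) v
  have s₄ := size_add_le (pr u v) f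
  have s₅ := size_mul_le (pr u v + f) (pr u v + f)
  have s₆ := size_add_le ((pr u v + f) * (pr u v + f)) f
  have s₇ := size_add_le (pr (pr u v) f) (pr (pr u v) f)
  have e₁ : pr u v = (u + v) * (u + v) + v := rfl
  have e₂ : pr (pr u v) f = (pr u v + f) * (pr u v + f) + f := rfl
  have e₃ : addr f u v = pr (pr u v) f + pr (pr u v) f := two_mul _
  have n₁ : (2 * d + 3 : ℕ) ≠ 2 * d + 1 := by omega
  have n₂ : (2 * d + 1 : ℕ) ≠ 2 * d + 3 := by omega
  have H := Steps.cons (w := w) (s := ⟨addrCode f d ++ k, mem, out, c⟩) rfl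
    (by dsimp only; omega) <|
    Steps.cons rfl (by dsimp only; omega) <| Steps.cons rfl (by dsimp only; omega) <|
    Steps.cons rfl (by dsimp only; omega) <| Steps.cons rfl (by dsimp only; omega) <|
    Steps.cons rfl (by dsimp only; omega) <| Steps.cons rfl (by dsimp only; omega) <|
    Steps.cons rfl (by dsimp only; omega) <| Steps.refl _ _
  refine ⟨_, _, H.mono ?_, ?_, ?_, ?_⟩
  · simp only [Function.update_self, Function.update_of_ne n₁, Function.update_of_ne n₂,
      ← hu, ← hv, ArithOp.apply, ← e₁, ← e₂]
    rw [← e₁] at s₃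
    rw [← e₂] at s₆
    omega
  · simp only [Function.update_self, Function.update_of_ne n₁, Function.update_of_ne n₂,
      ← hu, ← hv, ArithOp.apply, ← e₁, ← e₂, e₃]
  · refine Agree.update (Agree.update (Agree.update (Agree.update (Agree.update (Agree.update
      (Agree.update (Agree.update (fun _ _ => rfl) ?_ ?_) ?_ ?_) ?_ ?_) ?_ ?_) ?_ ?_) ?_ ?_) ?_ ?_)
      ?_ ?_ <;> omega
  · rw [e₃]
    rw [← e₁] at s₃
    rw [← e₂] at s₆
    omega

/-- `Evaluates e C`: the code of `e` puts the value of `e` into the intended cell, at a cost of at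
most `C` times one more than the number of bits of the numbers involved. -/
def Expr.Evaluates (e : Expr) (C : ℕ) : Prop :=
  ∀ (w : List ℕ) (h : Store) (B : ℕ), (∀ x ∈ w, x ≤ B) → Bounded B h →
    ∀ (d : ℕ) (mem : ℕ → ℕ) (out : List ℕ) (k : List Cmd) (c : ℕ), Rel mem h →
      ∃ mem' c', Steps w ⟨e.compile d ++ k, mem, out, c⟩ ⟨k, mem', out, c'⟩ (C * (B + 1)) ∧
        mem' (2 * d + 1) = e.eval w h ∧ Agree d mem mem'

theorem le_mul_succ (g B : ℕ) : B + g ≤ (g + 1) * (B + 1) := by nlinarith [Nat.zero_le (g * B)]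

/-- The common part of the code of the binary operations. -/
theorem Expr.Evaluates.pair {a b : Expr} {Ca Cb : ℕ} (ha : a.Evaluates Ca) (hb : b.Evaluates Cb)
    {w : List ℕ} {h : Store} {B : ℕ} (hw : ∀ x ∈ w, x ≤ B) (hB : Bounded B h) (d : ℕ)
    (mem : ℕ → ℕ) (out : List ℕ) (k : List Cmd) (c : ℕ) (hr : Rel mem h) :
    ∃ mem' c', Steps w ⟨a.compile d ++ (b.compile (d + 1) ++ k), mem, out, c⟩
        ⟨k, mem', out, c'⟩ ((Ca + Cb) * (B + 1)) ∧
      mem' (2 * d + 1) = a.eval w h ∧ mem' (2 * d + 3) = b.eval w h ∧ Agree d mem mem' := by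
  obtain ⟨m₁, c₁, h₁, h₂, h₃⟩ := ha w h B hw hB d mem out (b.compile (d + 1) ++ k) c hr
  obtain ⟨m₂, c₂, h₄, h₅, h₆⟩ := hb w h B hw hB (d + 1) m₁ out k c₁ (h₃.rel hr)
  refine ⟨m₂, c₂, (h₁.trans h₄).mono (by rw [add_mul]), ?_, h₅, h₃.trans (h₆.mono (by omega))⟩
  rw [h₆ _ (by omega), h₂]

theorem Expr.exists_evaluates (e : Expr) : ∃ C, e.Evaluates C := by
  induction e with
  | lit c =>
    refine ⟨1 + c.size, fun w h B hw hB d mem out k c' hr =>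
      ⟨_, _, (Steps.cons rfl (by dsimp only; omega)
      (Steps.refl _ _)).mono ?_, Function.update_self _ _ _,
      Agree.update (fun _ _ => rfl) (by omega) (by omega)⟩⟩
    simp only [add_zero, Nat.add_sub_cancel_left]
    nlinarith [Nat.zero_le ((1 + c.size) * B)]
  | add a b iha ihb =>
    obtain ⟨ga, hga⟩ := a.exists_size_eval_le
    obtain ⟨gb, hgb⟩ := b.exists_size_eval_le
    obtain ⟨Ca, iha⟩ := iha
    obtain ⟨Cb, ihb⟩ := ihb
    refine ⟨Ca + Cb + (1 + (ga + 1) + (gb + 1)), fun w h B hw hB d mem out k c hr => ?_⟩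
    obtain ⟨m, c₁, h₁, h₂, h₃, h₄⟩ := iha.pair ihb hw hB d mem out
      (.arith .add (2 * d + 1) (2 * d + 1) (2 * d + 3) :: k) c hr
    have s₁ := (hga w h B hw hB).trans (le_mul_succ _ _)
    have s₂ := (hgb w h B hw hB).trans (le_mul_succ _ _)
    simp only [compile, List.append_assoc, List.cons_append, List.nil_append]
    refine ⟨_, _, (h₁.trans (Steps.cons rfl (by dsimp only; omega) (Steps.refl _ _))).mono ?_,
      (Function.update_self _ _ _).trans ?_, h₄.update (by omega) (by omega)⟩
    · simp only [add_zero, h₂, h₃, add_mul, Nat.add_assoc, Nat.add_sub_cancel_left] at s₁ s₂ ⊢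
      omega
    · simp only [h₂, h₃, ArithOp.apply, eval]
  | sub a b iha ihb =>
    obtain ⟨ga, hga⟩ := a.exists_size_eval_le
    obtain ⟨gb, hgb⟩ := b.exists_size_eval_le
    obtain ⟨Ca, iha⟩ := iha
    obtain ⟨Cb, ihb⟩ := ihb
    refine ⟨Ca + Cb + (1 + (ga + 1) + (gb + 1)), fun w h B hw hB d mem out k c hr => ?_⟩
    obtain ⟨m, c₁, h₁, h₂, h₃, h₄⟩ := iha.pair ihb hw hB d mem out
      (.arith .sub (2 * d + 1) (2 * d + 1) (2 * d + 3) :: k) c hr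
    have s₁ := (hga w h B hw hB).trans (le_mul_succ _ _)
    have s₂ := (hgb w h B hw hB).trans (le_mul_succ _ _)
    simp only [compile, List.append_assoc, List.cons_append, List.nil_append]
    refine ⟨_, _, (h₁.trans (Steps.cons rfl (by dsimp only; omega) (Steps.refl _ _))).mono ?_,
      (Function.update_self _ _ _).trans ?_, h₄.update (by omega) (by omega)⟩
    · simp only [add_zero, h₂, h₃, add_mul, Nat.add_assoc, Nat.add_sub_cancel_left] at s₁ s₂ ⊢
      omega
    · simp only [h₂, h₃, ArithOp.apply, eval]
  | div a b iha ihb =>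
    obtain ⟨ga, hga⟩ := a.exists_size_eval_le
    obtain ⟨gb, hgb⟩ := b.exists_size_eval_le
    obtain ⟨Ca, iha⟩ := iha
    obtain ⟨Cb, ihb⟩ := ihb
    refine ⟨Ca + Cb + (1 + (ga + 1) + (gb + 1)), fun w h B hw hB d mem out k c hr => ?_⟩
    obtain ⟨m, c₁, h₁, h₂, h₃, h₄⟩ := iha.pair ihb hw hB d mem out
      (.arith .div (2 * d + 1) (2 * d + 1) (2 * d + 3) :: k) c hr
    have s₁ := (hga w h B hw hB).trans (le_mul_succ _ _)
    have s₂ := (hgb w h B hw hB).trans (le_mul_succ _ _)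
    simp only [compile, List.append_assoc, List.cons_append, List.nil_append]
    refine ⟨_, _, (h₁.trans (Steps.cons rfl (by dsimp only; omega) (Steps.refl _ _))).mono ?_,
      (Function.update_self _ _ _).trans ?_, h₄.update (by omega) (by omega)⟩
    · simp only [add_zero, h₂, h₃, add_mul, Nat.add_assoc, Nat.add_sub_cancel_left] at s₁ s₂ ⊢
      omega
    · simp only [h₂, h₃, ArithOp.apply, eval]
  | mul a b iha ihb =>
    obtain ⟨ga, hga⟩ := a.exists_size_eval_le
    obtain ⟨gb, hgb⟩ := b.exists_size_eval_le
    obtain ⟨Ca, iha⟩ := iha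
    obtain ⟨Cb, ihb⟩ := ihb
    refine ⟨Ca + Cb + (20 + 10 * (ga + 1) + 10 * (gb + 1)), fun w h B hw hB d mem out k c hr => ?_⟩
    obtain ⟨m, c₁, h₁, h₂, h₃, h₄⟩ := iha.pair ihb hw hB d mem out
      ([.arith .mul (2 * d + 1) (2 * d + 1) (2 * d + 3),
       .const (2 * d + 3) 1,
       .arith .add (2 * d + 3) (addr 1 0 0) (2 * d + 3),
       .arith .div (2 * d + 5) (2 * d + 1) (2 * d + 3),
       .arith .mul (2 * d + 5) (2 * d + 5) (2 * d + 3),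
       .arith .sub (2 * d + 1) (2 * d + 1) (2 * d + 5)] ++ k) c hr
    have s₁ := (hga w h B hw hB).trans (le_mul_succ _ _)
    have s₂ := (hgb w h B hw hB).trans (le_mul_succ _ _)
    set x := a.eval w h with hx
    set y := b.eval w h with hy
    set q := h 1 0 0 with hq
    have hq' := hB 1 0 0
    rw [← hq] at hq'
    have hm : m (addr 1 0 0) = q := h₄.rel hr 1 0 0
    have s₃ := size_mul_le x y
    have s₄ := size_add_le q 1
    have s₅ : (x * y / (q + 1)).size ≤ (x * y).size := Nat.size_le_size (Nat.div_le_self _ _)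
    have s₆ : (x * y / (q + 1) * (q + 1)).size ≤ (x * y).size :=
      Nat.size_le_size (Nat.div_mul_le_self _ _)
    have o : Nat.size 1 = 1 := by simp
    have n₂ : (2 * d + 1 : ℕ) ≠ 2 * d + 3 := by omega
    have n₃ : (addr 1 0 0 : ℕ) ≠ 2 * d + 1 := by unfold addr; omega
    have n₄ : (addr 1 0 0 : ℕ) ≠ 2 * d + 3 := by unfold addr; omega
    have n₅ : (2 * d + 1 : ℕ) ≠ 2 * d + 5 := by omega
    have n₆ : (2 * d + 3 : ℕ) ≠ 2 * d + 5 := by omega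
    simp only [compile, List.append_assoc]
    refine ⟨_, _, (h₁.trans <|
      Steps.cons rfl (by dsimp only; omega) <| Steps.cons rfl (by dsimp only; omega) <|
      Steps.cons rfl (by dsimp only; omega) <| Steps.cons rfl (by dsimp only; omega) <|
      Steps.cons rfl (by dsimp only; omega) <| Steps.cons rfl (by dsimp only; omega) <|
      Steps.refl _ _).mono ?_, (Function.update_self _ _ _).trans ?_, ?_⟩
    · simp only [Function.update_self, Function.update_of_ne n₂,
        Function.update_of_ne n₃, Function.update_of_ne n₄, Function.update_of_ne n₅,
        Function.update_of_ne n₆, h₂, h₃, hm, ArithOp.apply, add_mul, mul_assoc] at s₁ s₂ ⊢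
      omega
    · simp only [Function.update_self, Function.update_of_ne n₂,
        Function.update_of_ne n₃, Function.update_of_ne n₄, Function.update_of_ne n₅,
        Function.update_of_ne n₆, h₂, h₃, hm, ArithOp.apply, eval]
      exact Nat.mod_eq_sub_div_mul.symm
    · refine Agree.update (Agree.update (Agree.update (Agree.update (Agree.update (Agree.update
        h₄ ?_ ?_) ?_ ?_) ?_ ?_) ?_ ?_) ?_ ?_) ?_ ?_ <;> omega
  | get f a b iha ihb =>
    obtain ⟨ga, hga⟩ := a.exists_size_eval_le
    obtain ⟨gb, hgb⟩ := b.exists_size_eval_le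
    obtain ⟨Ca, iha⟩ := iha
    obtain ⟨Cb, ihb⟩ := ihb
    refine ⟨Ca + Cb + (100 + 80 * f.size + 80 * (ga + 1) + 80 * (gb + 1)),
      fun w h B hw hB d mem out k c hr => ?_⟩
    obtain ⟨m, c₁, h₁, h₂, h₃, h₄⟩ := iha.pair ihb hw hB d mem out
      (addrCode f d ++ (.load (2 * d + 1) (2 * d + 1) :: k)) c hr
    have s₁ := (hga w h B hw hB).trans (le_mul_succ _ _)
    have s₂ := (hgb w h B hw hB).trans (le_mul_succ _ _)
    obtain ⟨m', c₂, h₅, h₆, h₇, h₈⟩ := addrCode_steps w f d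
      (.load (2 * d + 1) (2 * d + 1) :: k) m out c₁
    rw [h₂, h₃] at h₅ h₆ h₈
    have hm : m' (addr f (a.eval w h) (b.eval w h)) = h f (a.eval w h) (b.eval w h) :=
      (h₄.trans h₇).rel hr _ _ _
    have s₃ := hB f (a.eval w h) (b.eval w h)
    simp only [compile, List.append_assoc]
    refine ⟨_, _, (h₁.trans (h₅.trans
      (Steps.cons rfl (by dsimp only; omega) (Steps.refl _ _)))).mono ?_,
      (Function.update_self _ _ _).trans ?_, (h₄.trans h₇).update (by omega) (by omega)⟩
    · have s₄ : f.size ≤ f.size * (B + 1) := Nat.le_mul_of_pos_right _ (Nat.succ_pos _)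
      simp only [h₆, hm, add_mul, mul_assoc] at s₁ s₂ ⊢
      omega
    · rw [h₆, hm]; rfl
  | inp a iha =>
    obtain ⟨ga, hga⟩ := a.exists_size_eval_le
    obtain ⟨Ca, iha⟩ := iha
    refine ⟨Ca + (2 + (ga + 1)), fun w h B hw hB d mem out k c hr => ?_⟩
    obtain ⟨m, c₁, h₁, h₂, h₃⟩ :=
      iha w h B hw hB d mem out (.read (2 * d + 1) (2 * d + 1) :: k) c hr
    have s₁ := (hga w h B hw hB).trans (le_mul_succ _ _)
    have s₂ := size_getD_le hw (a.eval w h)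
    simp only [compile, List.append_assoc]
    refine ⟨_, _, (h₁.trans (Steps.cons rfl (by dsimp only; omega) (Steps.refl _ _))).mono ?_,
      (Function.update_self _ _ _).trans ?_, h₃.update (by omega) (by omega)⟩
    · simp only [h₂, add_mul] at s₁ ⊢
      omega
    · rw [h₂]; rfl

end BoundedLoop

/-! ### Programs of bounded loops run in polynomial time -/

namespace BoundedLoop

open RAM

/-- `p.RunsWithin L g C`: for inputs with entries at most `L`, the program `p` makes numbers longer
by at most `g` bits, and its code has the same effect as `p` at a cost of at most `C` times one more
than the number of bits of the numbers involved. -/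
def Stmt.RunsWithin (p : Stmt) (L g C : ℕ) : Prop :=
  ∀ (w : List ℕ) (σ : Config) (B : ℕ), (∀ x ∈ w, x ≤ L) → L ≤ B → Bounded B σ.h →
    Bounded (B + g) (p.den w σ).h ∧
    ∀ (d : ℕ) (mem : ℕ → ℕ) (k : List Cmd) (c : ℕ), Rel mem σ.h →
      ∃ mem' c', Steps w ⟨p.compile d ++ k, mem, σ.out, c⟩ ⟨k, mem', (p.den w σ).out, c'⟩
          (C * (B + 1)) ∧
        Rel mem' (p.den w σ).h ∧ ∀ i < d, mem' (2 * i + 1) = mem (2 * i + 1)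

theorem Bounded.mono {B B' : ℕ} {h : Store} (hb : Bounded B h) (hB : B ≤ B') : Bounded B' h :=
  fun f u v => (hb f u v).trans hB

theorem Agree.odd {d : ℕ} {m m' : ℕ → ℕ} (h : Agree d m m') {i : ℕ} (hi : i < d) :
    m' (2 * i + 1) = m (2 * i + 1) := h _ (by omega)

theorem Rel.update {mem : ℕ → ℕ} {h : Store} (hr : Rel mem h) (f a b x : ℕ) :
    Rel (Function.update mem (addr f a b) x) (h.set f a b x) := by
  intro f' a' b'
  unfold Store.set
  split_ifs with hf
  · rw [hf.1, hf.2.1, hf.2.2, Function.update_self]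
  · rw [Function.update_of_ne (fun e => hf (addr_inj e)), hr]

/-- The bounds for the loop that a repetition is compiled to. Every round adds at most `g` bits, so
that `B'` bounds the lengths of the numbers in all `j` rounds. -/
theorem Stmt.RunsWithin.loop {p : Stmt} {L g C : ℕ} (hp : p.RunsWithin L g C) (w : List ℕ)
    (hw : ∀ x ∈ w, x ≤ L) (B' : ℕ) (d : ℕ) (k : List Cmd) (j : ℕ) (hj : j ≤ L) :
    ∀ (σ : Config) (B : ℕ), L ≤ B → Bounded B σ.h → B + j * g ≤ B' →
    Bounded (B + j * g) ((p.den w)^[j] σ).h ∧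
    ∀ (mem : ℕ → ℕ) (c : ℕ), Rel mem σ.h → mem (2 * d + 1) = j →
      ∃ mem' c', Steps w ⟨.loop (2 * d + 1) (p.compile (d + 1) ++
          [.const (2 * d + 3) 1, .arith .sub (2 * d + 1) (2 * d + 1) (2 * d + 3)]) :: k,
          mem, σ.out, c⟩ ⟨k, mem', ((p.den w)^[j] σ).out, c'⟩ ((j + 1) * ((C + 6) * (B' + 1))) ∧
        Rel mem' ((p.den w)^[j] σ).h ∧ ∀ i < d, mem' (2 * i + 1) = mem (2 * i + 1) := by
  induction j with
  | zero =>
    intro σ B hL hB hB'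
    refine ⟨by simpa using hB, fun mem c hr hj => ⟨mem, c + 1, ?_, hr, fun _ _ => rfl⟩⟩
    refine (Steps.cons (s' := ⟨k, mem, σ.out, c + 1⟩) ?_ (by simp) (Steps.refl _ _)).mono ?_
    · simp [step, hj]
    · simp only [Nat.add_sub_cancel_left]
      nlinarith [Nat.zero_le (C * (B' + 1))]
  | succ j ih =>
    intro σ B hL hB hB'
    have hB'' : B + g + j * g ≤ B' := by rw [add_mul] at hB'; omega
    obtain ⟨h₁, h₂⟩ := hp w σ B hw hL hB
    obtain ⟨h₃, h₄⟩ := ih (by omega) (p.den w σ) (B + g) (by omega) h₁ hB''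
    refine ⟨?_, fun mem c hr hm => ?_⟩
    · rw [Function.iterate_succ_apply]
      exact h₃.mono (by rw [add_mul]; omega)
    set body := p.compile (d + 1) ++
      [.const (2 * d + 3) 1, .arith .sub (2 * d + 1) (2 * d + 1) (2 * d + 3)] with hbody
    obtain ⟨m₁, c₁, s₁, r₁, o₁⟩ := h₂ (d + 1) mem (.const (2 * d + 3) 1 ::
      .arith .sub (2 * d + 1) (2 * d + 1) (2 * d + 3) :: .loop (2 * d + 1) body :: k)
      (c + (1 + (j + 1).size)) hr
    have hm₁ : m₁ (2 * d + 1) = j + 1 := by rw [o₁ d (by omega), hm]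
    set m₂ := Function.update (Function.update m₁ (2 * d + 3) 1) (2 * d + 1) j with hm₂
    have a₂ : Agree d m₁ m₂ := Agree.update (Agree.update (fun _ _ => rfl) (by omega) (by omega))
      (by omega) (by omega)
    obtain ⟨m₃, c₃, s₃, r₃, o₃⟩ := h₄ m₂ (c₁ + (1 + 1) + (1 + (j + 1).size + 1)) (a₂.rel r₁)
      (Function.update_self _ _ _)
    refine ⟨m₃, c₃, ?_, r₃, fun i hi => by rw [o₃ i hi, a₂.odd hi, o₁ i (by omega)]⟩
    have hs : (j + 1).size ≤ B' := (size_le_self _).trans (by omega)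
    have s₂ : Steps w ⟨.const (2 * d + 3) 1 ::
        .arith .sub (2 * d + 1) (2 * d + 1) (2 * d + 3) :: .loop (2 * d + 1) body :: k,
        m₁, (p.den w σ).out, c₁⟩ ⟨.loop (2 * d + 1) body :: k, m₂, (p.den w σ).out,
        c₁ + (1 + 1) + (1 + (j + 1).size + 1)⟩ (B' + 4) := by
      refine (Steps.cons (s' := ⟨.arith .sub (2 * d + 1) (2 * d + 1) (2 * d + 3) ::
        .loop (2 * d + 1) body :: k, Function.update m₁ (2 * d + 3) 1, (p.den w σ).out,
        c₁ + (1 + 1)⟩) ?_ (by simp) <|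
        Steps.cons ?_ (by dsimp only; omega) <| Steps.refl _ _).mono ?_
      · simp [step]
      · simp [step, hm₁, hm₂, ArithOp.apply]
      · simp only
        omega
    have s₀ : Steps w ⟨.loop (2 * d + 1) body :: k, mem, σ.out, c⟩
        ⟨p.compile (d + 1) ++ .const (2 * d + 3) 1 ::
          .arith .sub (2 * d + 1) (2 * d + 1) (2 * d + 3) :: .loop (2 * d + 1) body :: k,
          mem, σ.out, c + (1 + (j + 1).size)⟩ (B' + 1) := by
      refine (Steps.cons ?_ (by dsimp only; omega) (Steps.refl _ _)).mono ?_
      · simp [step, hm, hbody]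
      · simp only
        omega
    refine (s₀.trans (s₁.trans (s₂.trans s₃))).mono ?_
    have : C * (B + 1) ≤ C * (B' + 1) := Nat.mul_le_mul_left _ (by
      have := Nat.zero_le ((j + 1) * g); omega)
    simp only [add_mul] at this ⊢
    omega

/-- The time that a program needs, and the number of bits by which it makes numbers longer, are
polynomials in the largest entry of the input. -/
theorem Stmt.exists_runsWithin (p : Stmt) : ∃ G C : Polynomial ℕ, ∀ L,
    p.RunsWithin L (G.eval L) (C.eval L) := by
  induction p with
  | skip =>
    exact ⟨0, 0, fun L w σ B hw hL hB => ⟨by simpa [den] using hB, fun d mem k c hr =>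
      ⟨mem, c, (Steps.refl _ _).mono (Nat.zero_le _), hr, fun _ _ => rfl⟩⟩⟩
  | put f a b e =>
    obtain ⟨ge, hge⟩ := e.exists_size_eval_le
    obtain ⟨Ce, hCe⟩ := e.exists_evaluates
    obtain ⟨ga, hga⟩ := a.exists_size_eval_le
    obtain ⟨Ca, hCa⟩ := a.exists_evaluates
    obtain ⟨gb, hgb⟩ := b.exists_size_eval_le
    obtain ⟨Cb, hCb⟩ := b.exists_evaluates
    refine ⟨Polynomial.C ge, Polynomial.C (Ce + (Ca + Cb) +
      (100 + 80 * f.size + 80 * (ga + 1) + 80 * (gb + 1) + (ge + 1))),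
      fun L w σ B hw hL hB => ⟨?_, ?_⟩⟩
    · intro f' a' b'
      simp only [den, Store.set, Polynomial.eval_C]
      split_ifs
      · exact hge w σ.h B (fun x hx => (hw x hx).trans hL) hB
      · exact (hB _ _ _).trans (Nat.le_add_right _ _)
    · intro d mem k c hr
      have hw' : ∀ x ∈ w, x ≤ B := fun x hx => (hw x hx).trans hL
      simp only [compile, List.append_assoc, Polynomial.eval_C]
      obtain ⟨m₁, c₁, h₁, h₂, h₃⟩ := hCe w σ.h B hw' hB d mem σ.out (a.compile (d + 1) ++
        (b.compile (d + 2) ++ (addrCode f (d + 1) ++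
          ([.store (2 * (d + 1) + 1) (2 * d + 1)] ++ k)))) c hr
      obtain ⟨m₂, c₂, h₄, h₅, h₆, h₇⟩ := hCa.pair hCb hw' hB (d + 1) m₁ σ.out
        (addrCode f (d + 1) ++ ([.store (2 * (d + 1) + 1) (2 * d + 1)] ++ k)) c₁ (h₃.rel hr)
      obtain ⟨m₃, c₃, h₈, h₉, h₁₀, h₁₁⟩ := addrCode_steps w f (d + 1)
        ([.store (2 * (d + 1) + 1) (2 * d + 1)] ++ k) m₂ σ.out c₂
      rw [h₅, h₆] at h₈ h₉ h₁₁
      have hv : m₃ (2 * d + 1) = e.eval w σ.h := by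
        rw [h₁₀ _ (by omega), h₇ _ (by omega), h₂]
      have s₀ := (hge w σ.h B hw' hB).trans (le_mul_succ _ _)
      have s₁ := (hga w σ.h B hw' hB).trans (le_mul_succ _ _)
      have s₂ := (hgb w σ.h B hw' hB).trans (le_mul_succ _ _)
      have s₄ : f.size ≤ f.size * (B + 1) := Nat.le_mul_of_pos_right _ (Nat.succ_pos _)
      have ag : Agree d mem m₃ := h₃.trans ((h₇.trans h₁₀).mono (by omega))
      refine ⟨_, _, (h₁.trans (h₄.trans (h₈.trans (Steps.cons rfl (by dsimp only; omega)
        (Steps.refl _ _))))).mono ?_, ?_, fun i hi => ?_⟩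
      · simp only [h₉, hv, add_mul, mul_assoc] at s₀ s₁ s₂ ⊢
        omega
      · rw [h₉, hv]
        exact (ag.rel hr).update _ _ _ _
      · rw [Function.update_of_ne, ag.odd hi]
        rw [h₉]; unfold addr; omega
  | write e =>
    obtain ⟨ge, hge⟩ := e.exists_size_eval_le
    obtain ⟨Ce, hCe⟩ := e.exists_evaluates
    refine ⟨0, Polynomial.C (Ce + (1 + (ge + 1))), fun L w σ B hw hL hB =>
      ⟨by simpa [den] using hB, fun d mem k c hr => ?_⟩⟩
    have hw' : ∀ x ∈ w, x ≤ B := fun x hx => (hw x hx).trans hL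
    simp only [compile, List.append_assoc, Polynomial.eval_C]
    obtain ⟨m₁, c₁, h₁, h₂, h₃⟩ := hCe w σ.h B hw' hB d mem σ.out ([.write (2 * d + 1)] ++ k) c hr
    have s₀ := (hge w σ.h B hw' hB).trans (le_mul_succ _ _)
    refine ⟨m₁, _, (h₁.trans (Steps.cons (s' := ⟨k, m₁, _, c₁ + (1 + (m₁ (2 * d + 1)).size)⟩)
      ?_ (by dsimp only; omega) (Steps.refl _ _))).mono ?_, h₃.rel hr, fun i hi => h₃.odd hi⟩
    · simp [step, den, h₂]
    · simp only [h₂, add_mul] at s₀ ⊢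
      omega
  | seq p q ihp ihq =>
    obtain ⟨Gp, Cp, hp⟩ := ihp
    obtain ⟨Gq, Cq, hq⟩ := ihq
    refine ⟨Gp + Gq, Cp + Cq * (Gp + 1), fun L w σ B hw hL hB => ?_⟩
    obtain ⟨h₁, h₂⟩ := hp L w σ B hw hL hB
    obtain ⟨h₃, h₄⟩ := hq L w _ _ hw (by omega) h₁
    refine ⟨h₃.mono (by simp; omega), fun d mem k c hr => ?_⟩
    simp only [compile, List.append_assoc]
    obtain ⟨m₁, c₁, s₁, r₁, o₁⟩ := h₂ d mem (q.compile d ++ k) c hr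
    obtain ⟨m₂, c₂, s₂, r₂, o₂⟩ := h₄ d m₁ k c₁ r₁
    refine ⟨m₂, c₂, (s₁.trans s₂).mono ?_, r₂, fun i hi => by rw [o₂ i hi, o₁ i hi]⟩
    simp only [Polynomial.eval_add, Polynomial.eval_mul, Polynomial.eval_one]
    nlinarith [Nat.zero_le (Cq.eval L * (Gp.eval L * B))]
  | ite e p q ihp ihq =>
    obtain ⟨ge, hge⟩ := e.exists_size_eval_le
    obtain ⟨Ce, hCe⟩ := e.exists_evaluates
    obtain ⟨Gp, Cp, hp⟩ := ihp
    obtain ⟨Gq, Cq, hq⟩ := ihq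
    refine ⟨Gp + Gq, Polynomial.C (Ce + (1 + (ge + 1))) + (Cp + Cq), fun L w σ B hw hL hB => ?_⟩
    obtain ⟨h₁, h₂⟩ := hp L w σ B hw hL hB
    obtain ⟨h₃, h₄⟩ := hq L w σ B hw hL hB
    have hw' : ∀ x ∈ w, x ≤ B := fun x hx => (hw x hx).trans hL
    have s₀ := (hge w σ.h B hw' hB).trans (le_mul_succ _ _)
    simp only [den, compile, List.append_assoc, Polynomial.eval_add, Polynomial.eval_C]
    split_ifs with he
    · refine ⟨h₃.mono (by omega), fun d mem k c hr => ?_⟩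
      obtain ⟨m₁, c₁, h₅, h₆, h₇⟩ := hCe w σ.h B hw' hB d mem σ.out
        ([.ite (2 * d + 1) (p.compile d) (q.compile d)] ++ k) c hr
      obtain ⟨m₂, c₂, s₂, r₂, o₂⟩ := h₄ d m₁ k (c₁ + (1 + (m₁ (2 * d + 1)).size)) (h₇.rel hr)
      refine ⟨m₂, c₂, (h₅.trans (Steps.cons ?_ ?_ s₂)).mono ?_, r₂,
        fun i hi => by rw [o₂ i hi, h₇.odd hi]⟩
      · simp [step, h₆, he]
      · dsimp only; omega
      · simp only [h₆, add_mul] at s₀ ⊢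
        omega
    · refine ⟨h₁.mono (by omega), fun d mem k c hr => ?_⟩
      obtain ⟨m₁, c₁, h₅, h₆, h₇⟩ := hCe w σ.h B hw' hB d mem σ.out
        ([.ite (2 * d + 1) (p.compile d) (q.compile d)] ++ k) c hr
      obtain ⟨m₂, c₂, s₂, r₂, o₂⟩ := h₂ d m₁ k (c₁ + (1 + (m₁ (2 * d + 1)).size)) (h₇.rel hr)
      refine ⟨m₂, c₂, (h₅.trans (Steps.cons ?_ ?_ s₂)).mono ?_, r₂,
        fun i hi => by rw [o₂ i hi, h₇.odd hi]⟩
      · simp [step, h₆, he]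
      · dsimp only; omega
      · simp only [h₆, add_mul] at s₀ ⊢
        omega
  | rep e p ihp =>
    obtain ⟨ge, hge⟩ := e.exists_size_eval_le
    obtain ⟨Ce, hCe⟩ := e.exists_evaluates
    obtain ⟨G, C, hp⟩ := ihp
    refine ⟨Polynomial.X * G, Polynomial.C (Ce + (2 + (ge + 1))) +
      (Polynomial.X + 1) * ((C + 6) * (Polynomial.X * G + 1)), fun L w σ B hw hL hB => ?_⟩
    have hw' : ∀ x ∈ w, x ≤ B := fun x hx => (hw x hx).trans hL
    have s₀ := (hge w σ.h B hw' hB).trans (le_mul_succ _ _)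
    set i := e.eval w σ.h with hi
    have hj : w.getD i 0 ≤ L := by
      rcases lt_or_ge i w.length with h | h
      · rw [List.getD_eq_getElem _ _ h]; exact hw _ (List.getElem_mem h)
      · rw [List.getD_eq_default _ _ h]; exact Nat.zero_le _
    set j := w.getD i 0 with hjd
    have hjG : B + j * G.eval L ≤ B + L * G.eval L :=
      Nat.add_le_add_left (Nat.mul_le_mul_right _ hj) _
    simp only [den, compile, List.append_assoc, Polynomial.eval_add, Polynomial.eval_C,
      Polynomial.eval_mul, Polynomial.eval_X, Polynomial.eval_one, Polynomial.eval_ofNat]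
    rw [← hi, ← hjd]
    refine ⟨(Stmt.RunsWithin.loop (hp L) w hw _ 0 [] j hj σ B hL hB le_rfl).1.mono hjG,
      fun d mem k c hr => ?_⟩
    obtain ⟨m₁, c₁, h₅, h₆, h₇⟩ := hCe w σ.h B hw' hB d mem σ.out
      (.read (2 * d + 1) (2 * d + 1) :: .loop (2 * d + 1) (p.compile (d + 1) ++
        [.const (2 * d + 3) 1, .arith .sub (2 * d + 1) (2 * d + 1) (2 * d + 3)]) :: k) c hr
    have ag := h₇.update (a := 2 * d + 1) (x := j) (by omega) (by omega)
    obtain ⟨m₂, c₂, s₂, r₂, o₂⟩ := (Stmt.RunsWithin.loop (hp L) w hw _ d k j hj σ B hL hB hjG).2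
      (Function.update m₁ (2 * d + 1) j) (c₁ + (1 + i.size + j.size)) (ag.rel hr)
      (Function.update_self _ _ _)
    refine ⟨m₂, c₂, (h₅.trans (Steps.cons ?_ ?_ s₂)).mono ?_, r₂,
      fun i hi => by rw [o₂ i hi, ag.odd hi]⟩
    · simp only [step, h₆, ← hi, ← hjd]
    · dsimp only; omega
    · have s₁ : j.size ≤ B := (size_le_self _).trans (hj.trans hL)
      have s₃ : B + L * G.eval L + 1 ≤ (L * G.eval L + 1) * (B + 1) := by
        nlinarith [Nat.zero_le (L * G.eval L * B)]
      have s₄ : (j + 1) * ((C.eval L + 6) * (B + L * G.eval L + 1)) ≤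
          (L + 1) * ((C.eval L + 6) * ((L * G.eval L + 1) * (B + 1))) :=
        Nat.mul_le_mul (by omega) (Nat.mul_le_mul_left _ s₃)
      have s₅ : (L + 1) * ((C.eval L + 6) * ((L * G.eval L + 1) * (B + 1))) =
          (L + 1) * ((C.eval L + 6) * (L * G.eval L + 1)) * (B + 1) := by ring
      rw [s₅] at s₄
      rw [add_mul (Ce + (2 + (ge + 1)))]
      have s₆ : (Ce + (2 + (ge + 1))) * (B + 1) =
          Ce * (B + 1) + 2 * (B + 1) + (ge + 1) * (B + 1) := by
        ring
      simp only
      omega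

end BoundedLoop

/-! ### A prologue of coin tosses -/

namespace BoundedLoop

open RAM

/-- The distribution of the number whose `j` binary digits are fair coin tosses. -/
noncomputable def coins : ℕ → PMF ℕ
  | 0 => PMF.pure 0
  | j + 1 => (coins j).bind fun r =>
      (PMF.uniformOfFintype Bool).map fun b => 2 * r + b.toNat

theorem coins_apply (j r : ℕ) : coins j r = if r < 2 ^ j then ((2 : ℝ≥0∞) ^ j)⁻¹ else 0 := by
  induction j generalizing r with
  | zero => simp [coins, PMF.pure_apply]
  | succ j ih =>
    have key : ∀ x, ((PMF.uniformOfFintype Bool).map fun b => 2 * x + b.toNat) r =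
        if x = r / 2 then 2⁻¹ else 0 := by
      intro x
      rw [PMF.map_apply, tsum_bool]
      simp only [PMF.uniformOfFintype_apply, Fintype.card_bool, Bool.toNat_false, Bool.toNat_true]
      by_cases h : x = r / 2
      · rw [if_pos h]
        rcases Nat.mod_two_eq_zero_or_one r with h' | h'
        · rw [if_pos (by omega), if_neg (by omega)]; simp
        · rw [if_neg (by omega), if_pos (by omega)]; simp
      · rw [if_neg h, if_neg (by omega), if_neg (by omega), add_zero]
    rw [coins, PMF.bind_apply]
    simp only [key]
    rw [tsum_eq_single (r / 2) (fun b hb => by simp [hb]), ih, if_pos rfl]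
    by_cases h : r < 2 ^ (j + 1)
    · rw [if_pos h, if_pos (by rw [pow_succ] at h; omega), pow_succ,
        ENNReal.mul_inv (by simp) (by simp)]
    · rw [if_neg h, if_neg (by rw [pow_succ] at h; omega), zero_mul]

theorem mem_support_coins {j r : ℕ} : r ∈ (coins j).support ↔ r < 2 ^ j := by
  rw [PMF.mem_support_iff, coins_apply]
  split_ifs with h <;> simp [h]

/-- The arrays after the coin tosses: the random number is the scalar `2`. -/
def randomStore (r : ℕ) : Store := Store.set (fun _ _ _ => 0) 2 0 0 r

/-- One coin toss: the random number is doubled and a random bit is added to it. -/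
def tossCode : List Cmd :=
  [.coin 7, .arith .add (addr 2 0 0) (addr 2 0 0) (addr 2 0 0),
    .arith .add (addr 2 0 0) (addr 2 0 0) 7, .arith .sub 3 3 5]

/-- As many coin tosses as the first entry of the input says. -/
def coinCode : List Cmd := [.read 3 1, .const 5 1, .loop 3 tossCode]

/-- The state of the machine in front of the next toss, when `j` tosses out of `n` have given the
number `r`. -/
def Tossed (k : List Cmd) (n j r : ℕ) (s : State) : Prop :=
  ∃ mem c, s = ⟨.loop 3 tossCode :: k, mem, [], c⟩ ∧ mem 3 = n - j ∧ mem 5 = 1 ∧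
    Rel mem (randomStore r) ∧ 2 + 5 * j ≤ c ∧ c ≤ (j + 1) * (30 + 10 * n + 10 * r.size)

theorem Tossed.step_five {k : List Cmd} {n j r : ℕ} {s : State} (hj : j < n)
    (h : Tossed k n j r s) (w : List ℕ) : ∃ f : Bool → State,
      run w 5 s = (PMF.uniformOfFintype Bool).map f ∧
      ∀ b, Tossed k n (j + 1) (2 * r + b.toNat) (f b) := by
  obtain ⟨mem, c, rfl, h₃, h₅, hr, hc, hc'⟩ := h
  have hR : mem (addr 2 0 0) = r := by rw [hr]; simp [randomStore, Store.set]
  have ha : addr 2 0 0 = 12 := rfl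
  rw [ha] at hR
  refine ⟨fun b => ⟨.loop 3 tossCode :: k, Function.update (Function.update (Function.update
    (Function.update mem 7 b.toNat) 12 (r + r)) 12 (r + r + b.toNat)) 3 (n - j - 1), [],
    c + (1 + (n - j).size) + 1 + (1 + r.size + r.size) + (1 + (r + r).size + b.toNat.size) +
      (1 + (n - j).size + Nat.size 1)⟩, ?_, fun b => ⟨_, _, rfl, ?_, ?_, ?_, ?_, ?_⟩⟩
  · have hne : ¬ n - j = 0 := by omega
    simp [run, step, tossCode, h₃, hne, PMF.map, PMF.bind_bind, Function.comp_def, ArithOp.apply,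
      ha, hR, h₅, Function.update_of_ne]
  · rw [Function.update_self]; omega
  · simp [Function.update_of_ne, h₅]
  · intro f u v
    have hodd : ∀ i, addr f u v ≠ 2 * i + 1 := fun i => by unfold addr; omega
    rw [Function.update_of_ne (hodd 1)]
    by_cases h : addr f u v = 12
    · rw [h, Function.update_self]
      obtain ⟨rfl, rfl, rfl⟩ := addr_inj (h.trans ha.symm)
      simp [randomStore, Store.set]; ring
    · rw [Function.update_of_ne h, Function.update_of_ne h, Function.update_of_ne (hodd 3), hr]
      have : ¬ (f = 2 ∧ u = 0 ∧ v = 0) := by rintro ⟨rfl, rfl, rfl⟩; exact h ha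
      simp [randomStore, Store.set, this]
  · omega
  · have s₁ : (n - j).size ≤ n := (size_le_self _).trans (by omega)
    have s₂ : r.size ≤ (2 * r + b.toNat).size := Nat.size_le_size (by omega)
    have s₃ : (r + r).size ≤ (2 * r + b.toNat).size := Nat.size_le_size (by omega)
    have s₄ : b.toNat.size ≤ 1 := by cases b <;> simp
    have s₅ : Nat.size 1 = 1 := by simp
    have s₆ : (j + 1) * (30 + 10 * n + 10 * r.size) ≤
        (j + 1) * (30 + 10 * n + 10 * (2 * r + b.toNat).size) := Nat.mul_le_mul_left _ (by omega)
    rw [add_mul (j + 1) 1]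
    omega

theorem run_coinCode (w : List ℕ) (k : List Cmd) (j : ℕ) (hj : j ≤ w.getD 0 0) :
    ∃ s : ℕ → State, run w (2 + 5 * j) (start (coinCode ++ k)) = (coins j).map s ∧
      ∀ r, Tossed k (w.getD 0 0) j r (s r) := by
  set n := w.getD 0 0 with hn
  induction j with
  | zero =>
    have hz : ∀ r, Rel (Function.update (Function.update (Function.update (fun _ => 0) 3 n) 5 1)
        (addr 2 0 0) r) (randomStore r) := by
      intro r
      refine Rel.update (fun f u v => ?_) _ _ _ _
      have hodd : ∀ i, addr f u v ≠ 2 * i + 1 := fun i => by unfold addr; omega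
      rw [Function.update_of_ne (hodd 2), Function.update_of_ne (hodd 1)]
    have s₁ : n.size ≤ n := size_le_self _
    refine ⟨fun r => ⟨.loop 3 tossCode :: k, Function.update (Function.update
      (Function.update (fun _ => 0) 3 n) 5 1) (addr 2 0 0) r, [],
      0 + (1 + Nat.size 0 + n.size) + (1 + Nat.size 1)⟩, ?_, fun r => ⟨_, _, rfl, ?_, ?_,
      hz r, ?_, ?_⟩⟩
    · have h0 : Function.update (Function.update (Function.update (fun _ => 0) 3 n) 5 1)
          (addr 2 0 0) 0 = Function.update (Function.update (fun _ => 0) 3 n) 5 1 :=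
        Function.update_eq_self_iff.2 rfl
      rw [coins, PMF.pure_map, h0]
      simp [run, step, start, coinCode, hn]
    · simp [addr, pr]
    · simp [addr, pr]
    · simp
    · simp; omega
  | succ j ih =>
    obtain ⟨s, h₁, h₂⟩ := ih (by omega)
    choose f hf hf' using fun r => (h₂ r).step_five (by omega) w
    refine ⟨fun r => f (r / 2) (r % 2 = 1), ?_, fun r => ?_⟩
    · rw [show 2 + 5 * (j + 1) = 2 + 5 * j + 5 from by ring, run_add, h₁, PMF.bind_map, coins,
        PMF.map_bind]
      congr 1
      funext r
      rw [Function.comp_apply, hf, PMF.map_comp]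
      congr 1
      funext b
      have e₁ : (2 * r + b.toNat) / 2 = r := by have := b.toNat_lt; omega
      have e₂ : (decide ((2 * r + b.toNat) % 2 = 1)) = b := by cases b <;> simp
      simp only [Function.comp_apply, e₁, e₂]
    · have := hf' (r / 2) (r % 2 = 1)
      have e : 2 * (r / 2) + (decide (r % 2 = 1)).toNat = r := by
        rcases Nat.mod_two_eq_zero_or_one r with h | h <;> simp [h] <;> omega
      rwa [e] at this

/-- The machine that tosses as many coins as the first entry of the input says and then runs the
program `p`. -/
def machine (p : Stmt) : List Cmd := coinCode ++ p.compile 0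

/-- The final state of the language when the program `p` is run with the random number `r`. -/
def Stmt.final (p : Stmt) (w : List ℕ) (r : ℕ) : Config := p.den w ⟨randomStore r, []⟩

theorem bind_congr_support {α β : Type*} {q : PMF α} {f g : α → PMF β}
    (h : ∀ a ∈ q.support, f a = g a) : q.bind f = q.bind g := by
  ext b
  rw [PMF.bind_apply, PMF.bind_apply]
  refine tsum_congr fun a => ?_
  by_cases ha : a ∈ q.support
  · rw [h a ha]
  · rw [(PMF.apply_eq_zero_iff q a).2 ha, zero_mul, zero_mul]

/-- The machine of a program `p` halts in polynomial time, and its result is the result of `p` on a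
uniformly distributed random number. -/
theorem machine_spec (p : Stmt) : ∃ T : Polynomial ℕ, ∀ (w : List ℕ) (L : ℕ),
    (∀ x ∈ w, x ≤ L) → HaltsInTime (machine p) w (T.eval L) ∧
      resultDist (machine p) w (T.eval L) = (coins (w.getD 0 0)).map fun r =>
        if (p.final w r).h 0 0 0 = 0 then none else some (p.final w r).out := by
  obtain ⟨G, C, hp⟩ := p.exists_runsWithin
  refine ⟨(Polynomial.X + 1) * (30 + 20 * Polynomial.X) + 1 + C * (Polynomial.X + 1),
    fun w L hw => ?_⟩
  set n := w.getD 0 0 with hn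
  have hnL : n ≤ L := by
    rcases lt_or_ge 0 w.length with h | h
    · rw [hn, List.getD_eq_getElem _ _ h]; exact hw _ (List.getElem_mem h)
    · rw [hn, List.getD_eq_default _ _ h]; exact Nat.zero_le _
  simp only [Polynomial.eval_add, Polynomial.eval_mul, Polynomial.eval_X, Polynomial.eval_one,
    Polynomial.eval_ofNat]
  set T := (L + 1) * (30 + 20 * L) + 1 + C.eval L * (L + 1) with hT
  obtain ⟨s, h₁, h₂⟩ := run_coinCode w (p.compile 0) n le_rfl
  have htT : 2 + 5 * n ≤ T := by
    have := Nat.zero_le (C.eval L * (L + 1))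
    nlinarith
  have key : ∀ r, ∃ s' : State, r < 2 ^ n → run w (T - (2 + 5 * n)) (s r) = PMF.pure s' ∧
      s'.todo = [] ∧ s'.cost ≤ T ∧
      s'.result = if (p.final w r).h 0 0 0 = 0 then none else some (p.final w r).out := by
    intro r
    by_cases hr : r < 2 ^ n
    swap
    · exact ⟨start [], fun h => absurd h hr⟩
    obtain ⟨mem, c, hs, h₃, h₅, hrel, hc, hc'⟩ := h₂ r
    have hrn : r.size ≤ n := Nat.size_le.2 hr
    have hB : Bounded L (randomStore r) := by
      intro f u v
      simp only [randomStore, Store.set]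
      split_ifs
      · exact hrn.trans hnL
      · simp
    obtain ⟨m', c', ⟨t, h₆, h₇, h₈⟩, h₉, -⟩ := ((hp L) w ⟨randomStore r, []⟩ L hw le_rfl hB).2 0 mem
      [] (c + 1) hrel
    rw [List.append_nil] at h₆
    have hexit : run w 1 (s r) = PMF.pure ⟨p.compile 0, mem, [], c + 1⟩ := by
      have h₃' : mem 3 = 0 := by rw [h₃, ← hn, Nat.sub_self]
      simp [hs, run, step, h₃']
    have hcost : c ≤ (L + 1) * (30 + 20 * L) := by
      refine hc'.trans (Nat.mul_le_mul (by omega) (by omega))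
    dsimp only at h₇ h₈
    refine ⟨⟨[], m', (p.final w r).out, c'⟩, fun _ => ⟨?_, ?_, ?_, ?_⟩⟩
    · obtain ⟨u, hu⟩ : ∃ u, T - (2 + 5 * n) = 1 + (t + u) :=
        ⟨T - (2 + 5 * n) - 1 - t, by omega⟩
      rw [hu, run_add, hexit, PMF.pure_bind, run_add, h₆, PMF.pure_bind,
        run_of_todo_nil _ _ _ rfl]
      rfl
    · rfl
    · dsimp only
      omega
    · have : m' 0 = (p.final w r).h 0 0 0 := h₉ 0 0 0
      simp only [State.result, this]
  choose fin hfin using key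
  have hrun : run w T (start (machine p)) = (coins n).map fin := by
    obtain ⟨u, hu⟩ : ∃ u, T = 2 + 5 * n + u := ⟨_, (Nat.add_sub_of_le htT).symm⟩
    have hu' : u = T - (2 + 5 * n) := by omega
    nth_rw 1 [hu]
    rw [run_add, machine, h₁, PMF.bind_map, hu']
    exact bind_congr_support fun r hr => (hfin r (mem_support_coins.1 hr)).1
  refine ⟨fun s' hs' => ?_, ?_⟩
  · rw [hrun, PMF.support_map] at hs'
    obtain ⟨r, hr, rfl⟩ := hs'
    have := hfin r (mem_support_coins.1 hr)
    exact ⟨this.2.1, this.2.2.1⟩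
  · rw [resultDist, hrun, PMF.map_comp]
    exact bind_congr_support fun r hr =>
      congrArg PMF.pure (hfin r (mem_support_coins.1 hr)).2.2.2

end BoundedLoop

/-! ### Labels of two-terminal graphs -/

/-- The data that are kept of a two-terminal graph, all of whose vertices are coloured with two
colours. Each entry stands for a sum, over certain colourings, of the product of the weights of the
coloured inner vertices. A colour `c` has the complement `!c`. -/
@[ext]
structure SPLabel (R : Type) where
  /-- everything has colour `c` -/
  mono : Bool → R
  /-- the source has colour `c`, the sink has colour `!c`, both colour classes are connected -/
  cut : Bool → R
  /-- the terminals have colour `c`, both colour classes are connected and nonempty -/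
  conn : Bool → R
  /-- the terminals have colour `c`, the class of `!c` is connected and nonempty, the class of `c`
  has exactly two components, one for each terminal -/
  split : Bool → R

namespace SPLabel

variable {R : Type}

/-- The label after the exchange of the terminals. -/
def rev (a : SPLabel R) : SPLabel R := ⟨a.mono, fun c => a.cut (!c), a.conn, a.split⟩

@[simp] theorem rev_rev (a : SPLabel R) : a.rev.rev = a := by
  ext c <;> simp [rev]

variable [CommSemiring R]

/-- The label of a series composition; `m` is the weight of the vertex in the middle. -/
def ser (m : Bool → R) (a b : SPLabel R) : SPLabel R where
  mono c := a.mono c * m c * b.mono c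
  cut c := a.cut c * m (!c) * b.mono (!c) + a.mono c * m c * b.cut c
  conn c := m c * (a.conn c * b.mono c + a.mono c * b.conn c)
  split c := m c * (a.split c * b.mono c + a.mono c * b.split c) + m (!c) * (a.cut c * b.cut (!c))

/-- The label of a parallel composition. -/
def par (a b : SPLabel R) : SPLabel R where
  mono c := a.mono c * b.mono c
  cut c := a.cut c * b.cut c
  conn c := (a.conn c + a.split c) * b.mono c + a.mono c * (b.conn c + b.split c)
  split _ := 0

/-- The label of a single edge. -/
def unit : SPLabel R := ⟨fun _ => 1, fun _ => 1, fun _ => 0, fun _ => 0⟩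

@[simp] theorem rev_unit : (unit : SPLabel R).rev = unit := rfl

theorem rev_par (a b : SPLabel R) : (a.par b).rev = a.rev.par b.rev := rfl

theorem rev_ser (m : Bool → R) (a b : SPLabel R) : (ser m a b).rev = ser m b.rev a.rev := by
  ext c <;> simp only [rev, ser, Bool.not_not] <;> ring

theorem par_comm (a b : SPLabel R) : a.par b = b.par a := by
  ext c <;> simp only [par] <;> ring

theorem par_assoc (a b d : SPLabel R) : (a.par b).par d = a.par (b.par d) := by
  ext c <;> simp only [par] <;> ring

theorem ser_assoc (m k : Bool → R) (a b d : SPLabel R) :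
    ser k (ser m a b) d = ser m a (ser k b d) := by
  ext c <;> simp only [ser, Bool.not_not] <;> ring

theorem par_unit_unit : (unit : SPLabel R).par unit = unit := by
  ext c <;> simp [par, unit]

/-- What is left of a label when the source, of weight `v`, becomes an inner vertex: the sums over
the colourings of one colour only and over the other ones, by the colour of the sink. -/
def contract (v : Bool → R) (a : SPLabel R) : (Bool → R) × (Bool → R) :=
  (fun c => v c * a.mono c, fun c => v c * a.conn c + v (!c) * a.cut (!c))

/-- The sum over all colourings with two nonempty connected colour classes, where the terminals
have the weights `v` and `u`. -/
def total (v u : Bool → R) (a : SPLabel R) : R :=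
  u true * (contract v a).2 true + u false * (contract v a).2 false

theorem total_rev (v u : Bool → R) (a : SPLabel R) : total u v a.rev = total v u a := by
  simp only [total, contract, rev, Bool.not_not, Bool.not_true, Bool.not_false]
  ring

theorem contract_ser {v v' m : Bool → R} {a a' b : SPLabel R}
    (h : contract v' a' = contract v a) : contract v' (ser m a' b) = contract v (ser m a b) := by
  have h₁ : ∀ c, v' c * a'.mono c = v c * a.mono c := fun c => congrFun (congrArg Prod.fst h) c
  have h₂ : ∀ c, v' c * a'.conn c + v' (!c) * a'.cut (!c) =
    v c * a.conn c + v (!c) * a.cut (!c) := fun c => congrFun (congrArg Prod.snd h) c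
  have e₂ : ∀ (v : Bool → R) (a : SPLabel R) (c : Bool), v c * (ser m a b).conn c +
      v (!c) * (ser m a b).cut (!c) = m c * b.mono c * (v c * a.conn c + v (!c) * a.cut (!c)) +
      m c * b.conn c * (v c * a.mono c) + m (!c) * b.cut (!c) * (v (!c) * a.mono (!c)) := by
    intro v a c
    simp only [ser, Bool.not_not]
    ring
  refine Prod.ext (funext fun c => ?_) (funext fun c => ?_)
  · have e₁ : ∀ (v : Bool → R) (a : SPLabel R), v c * (ser m a b).mono c =
        m c * b.mono c * (v c * a.mono c) := fun v a => by simp only [ser]; ring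
    simp only [contract]
    rw [e₁, e₁, h₁]
  · simp only [contract]
    rw [e₂, e₂, h₁, h₁, h₂]

/-- If the eliminated vertex is a terminal, the source is first moved along the edge labelled `a` to
its neighbour; this leaves the contracted label unchanged. -/
theorem contract_par_ser_ser (s x y : Bool → R) (a b d e : SPLabel R) :
    contract x (par d (ser y (ser s a.rev b) e)) = contract s (par (ser x a d) (ser y b e)) := by
  refine Prod.ext (funext fun c => ?_) (funext fun c => ?_) <;>
  · simp only [contract, par, ser, rev, Bool.not_not]
    ring

theorem contract_par_ser (s y : Bool → R) (a b e : SPLabel R) :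
    contract y (par (ser s a.rev b).rev e) = contract s (par a (ser y b e)) := by
  refine Prod.ext (funext fun c => ?_) (funext fun c => ?_) <;>
  · simp only [contract, par, ser, rev, Bool.not_not]
    ring

end SPLabel

/-! ### Labelled series-parallel graphs -/

open SPLabel

/-- `LabelledSP v V E s t a`: the graph on `V` with the labelled edges `E` and the terminals `s`
and `t` is series-parallel, and its label is `a` when every edge stands for a two-terminal graph
with the given label. The vertex weights are `v`. -/
inductive LabelledSP {α R : Type} [DecidableEq α] [CommSemiring R] (v : α → Bool → R) :
    Finset α → Multiset (α × α × SPLabel R) → α → α → SPLabel R → Prop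
  | edge (s t : α) (a : SPLabel R) (h : s ≠ t) : LabelledSP v {s, t} {(s, t, a)} s t a
  | flip (s t : α) (a : SPLabel R) (h : s ≠ t) : LabelledSP v {s, t} {(t, s, a)} s t a.rev
  | series (V₁ V₂ : Finset α) (E₁ E₂ : Multiset (α × α × SPLabel R)) (s m t : α)
      (a b : SPLabel R) (h₁ : LabelledSP v V₁ E₁ s m a) (h₂ : LabelledSP v V₂ E₂ m t b)
      (h : V₁ ∩ V₂ = {m}) : LabelledSP v (V₁ ∪ V₂) (E₁ + E₂) s t (ser (v m) a b)
  | parallel (V₁ V₂ : Finset α) (E₁ E₂ : Multiset (α × α × SPLabel R)) (s t : α)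
      (a b : SPLabel R) (h₁ : LabelledSP v V₁ E₁ s t a) (h₂ : LabelledSP v V₂ E₂ s t b)
      (h : V₁ ∩ V₂ = {s, t}) : LabelledSP v (V₁ ∪ V₂) (E₁ + E₂) s t (par a b)

theorem Multiset.add_eq_cons {β : Type*} {A B F : Multiset β} {e : β} (h : A + B = e ::ₘ F) :
    (∃ A', A = e ::ₘ A' ∧ F = A' + B) ∨ ∃ B', B = e ::ₘ B' ∧ F = A + B' := by
  have : e ∈ A + B := h ▸ Multiset.mem_cons_self e F
  rcases Multiset.mem_add.1 this with he | he
  · obtain ⟨A', rfl⟩ := Multiset.exists_cons_of_mem he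
    exact Or.inl ⟨A', rfl, by simpa using h.symm⟩
  · obtain ⟨B', rfl⟩ := Multiset.exists_cons_of_mem he
    exact Or.inr ⟨B', rfl, by simpa using h.symm⟩

theorem Multiset.add_eq_cons_cons {β : Type*} {A B F : Multiset β} {e f : β}
    (h : A + B = e ::ₘ f ::ₘ F) :
    (∃ A', A = e ::ₘ f ::ₘ A' ∧ F = A' + B) ∨
    (∃ A' B', A = e ::ₘ A' ∧ B = f ::ₘ B' ∧ F = A' + B') ∨
    (∃ A' B', A = f ::ₘ A' ∧ B = e ::ₘ B' ∧ F = A' + B') ∨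
    ∃ B', B = e ::ₘ f ::ₘ B' ∧ F = A + B' := by
  rcases Multiset.add_eq_cons h with ⟨A', rfl, h'⟩ | ⟨B', rfl, h'⟩
  · rcases Multiset.add_eq_cons h'.symm with ⟨A'', rfl, h''⟩ | ⟨B'', rfl, h''⟩
    · exact Or.inl ⟨A'', rfl, h''⟩
    · exact Or.inr (Or.inl ⟨A', B'', rfl, rfl, h''⟩)
  · rcases Multiset.add_eq_cons h'.symm with ⟨A'', rfl, h''⟩ | ⟨B'', rfl, h''⟩
    · exact Or.inr (Or.inr (Or.inl ⟨A'', B', rfl, rfl, h''⟩))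
    · exact Or.inr (Or.inr (Or.inr ⟨B'', rfl, h''⟩))

/-- The labelled edge `e` has the end `z`. -/
def Touches {α β : Type} (e : α × α × β) (z : α) : Prop := e.1 = z ∨ e.2.1 = z

namespace LabelledSP

variable {α R : Type} [DecidableEq α] [CommSemiring R] {v : α → Bool → R} {V V₁ V₂ : Finset α}
  {E F F₁ F₂ : Multiset (α × α × SPLabel R)} {s t x y z m : α} {a b l l₁ l₂ : SPLabel R}

theorem ne_and_mem (h : LabelledSP v V E s t l) : s ≠ t ∧ s ∈ V ∧ t ∈ V := by
  induction h with
  | edge s t a h => simp [h]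
  | flip s t a h => simp [h]
  | series V₁ V₂ E₁ E₂ s m t a b h₁ h₂ h ih₁ ih₂ =>
    refine ⟨?_, Finset.mem_union_left _ ih₁.2.1, Finset.mem_union_right _ ih₂.2.2⟩
    rintro rfl
    have : s ∈ V₁ ∩ V₂ := Finset.mem_inter.2 ⟨ih₁.2.1, ih₂.2.2⟩
    rw [h, Finset.mem_singleton] at this
    exact ih₁.1 this
  | parallel V₁ V₂ E₁ E₂ s t a b h₁ h₂ h ih₁ ih₂ =>
    exact ⟨ih₁.1, Finset.mem_union_left _ ih₁.2.1, Finset.mem_union_left _ ih₁.2.2⟩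

theorem mem_of_mem (h : LabelledSP v V E s t l) :
    ∀ e ∈ E, e.1 ∈ V ∧ e.2.1 ∈ V ∧ e.1 ≠ e.2.1 := by
  induction h with
  | edge s t a h => simp [h]
  | flip s t a h => simp [h.symm]
  | series V₁ V₂ E₁ E₂ s m t a b h₁ h₂ h ih₁ ih₂ =>
    intro e he
    rcases Multiset.mem_add.1 he with he | he
    · have := ih₁ e he; simp [this]
    · have := ih₂ e he; simp [this]
  | parallel V₁ V₂ E₁ E₂ s t a b h₁ h₂ h ih₁ ih₂ =>
    intro e he
    rcases Multiset.mem_add.1 he with he | he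
    · have := ih₁ e he; simp [this]
    · have := ih₂ e he; simp [this]

theorem mem_of_touches (h : LabelledSP v V E s t l) {e : α × α × SPLabel R} (he : e ∈ E)
    (hz : Touches e z) : z ∈ V := by
  obtain ⟨h₁, h₂, -⟩ := h.mem_of_mem e he
  rcases hz with rfl | rfl <;> assumption

theorem reverse (h : LabelledSP v V E s t l) : LabelledSP v V E t s l.rev := by
  induction h with
  | edge s t a h => rw [Finset.pair_comm]; exact .flip _ _ _ h.symm
  | flip s t a h => rw [Finset.pair_comm, rev_rev]; exact .edge _ _ _ h.symm
  | series V₁ V₂ E₁ E₂ s m t a b h₁ h₂ h ih₁ ih₂ =>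
    rw [Finset.union_comm, add_comm, rev_ser]
    exact .series _ _ _ _ _ _ _ _ _ ih₂ ih₁ (by rw [Finset.inter_comm, h])
  | parallel V₁ V₂ E₁ E₂ s t a b h₁ h₂ h ih₁ ih₂ =>
    rw [rev_par]
    exact .parallel _ _ _ _ _ _ _ _ ih₁ ih₂ (by rw [h, Finset.pair_comm])

theorem exists_touches_source (h : LabelledSP v V E s t l) : ∃ e ∈ E, Touches e s := by
  induction h with
  | edge s t a h => exact ⟨_, Multiset.mem_singleton_self _, Or.inl rfl⟩
  | flip s t a h => exact ⟨_, Multiset.mem_singleton_self _, Or.inr rfl⟩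
  | series V₁ V₂ E₁ E₂ s m t a b h₁ h₂ h ih₁ ih₂ =>
    obtain ⟨e, he, hs⟩ := ih₁
    exact ⟨e, Multiset.mem_add.2 (Or.inl he), hs⟩
  | parallel V₁ V₂ E₁ E₂ s t a b h₁ h₂ h ih₁ ih₂ =>
    obtain ⟨e, he, hs⟩ := ih₁
    exact ⟨e, Multiset.mem_add.2 (Or.inl he), hs⟩

theorem exists_touches_sink (h : LabelledSP v V E s t l) : ∃ e ∈ E, Touches e t :=
  h.reverse.exists_touches_source

/-- An edge may be turned around. -/
theorem flip_edge (h : LabelledSP v V ((x, y, a) ::ₘ F) s t l) :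
    LabelledSP v V ((y, x, a.rev) ::ₘ F) s t l := by
  generalize hE : (x, y, a) ::ₘ F = E at h
  induction h generalizing F with
  | edge s t b h =>
    obtain ⟨h', rfl⟩ := (Multiset.singleton_eq_cons_iff _).1 hE.symm
    cases h'
    simpa using LabelledSP.flip (v := v) _ _ a.rev h
  | flip s t b h =>
    obtain ⟨h', rfl⟩ := (Multiset.singleton_eq_cons_iff _).1 hE.symm
    cases h'
    exact .edge _ _ _ h
  | series V₁ V₂ E₁ E₂ s m t a b h₁ h₂ h ih₁ ih₂ =>
    rcases Multiset.add_eq_cons hE.symm with ⟨E', rfl, rfl⟩ | ⟨E', rfl, rfl⟩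
    · rw [← Multiset.cons_add]
      exact .series _ _ _ _ _ _ _ _ _ (ih₁ rfl) h₂ h
    · rw [← Multiset.add_cons]
      exact .series _ _ _ _ _ _ _ _ _ h₁ (ih₂ rfl) h
  | parallel V₁ V₂ E₁ E₂ s t a b h₁ h₂ h ih₁ ih₂ =>
    rcases Multiset.add_eq_cons hE.symm with ⟨E', rfl, rfl⟩ | ⟨E', rfl, rfl⟩
    · rw [← Multiset.cons_add]
      exact .parallel _ _ _ _ _ _ _ _ (ih₁ rfl) h₂ h
    · rw [← Multiset.add_cons]
      exact .parallel _ _ _ _ _ _ _ _ h₁ (ih₂ rfl) h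

/-- If only one edge leaves the source, then it comes first in a series composition. -/
theorem of_source_degree_one (h : LabelledSP v V ((s, x, a) ::ₘ F) s t l)
    (hF : ∀ f ∈ F, ¬ Touches f s) :
    (F = 0 ∧ x = t ∧ V = {s, t} ∧ l = a) ∨
      ∃ b, LabelledSP v (V.erase s) F x t b ∧ l = ser (v x) a b := by
  generalize hE : (s, x, a) ::ₘ F = E at h
  induction h generalizing F with
  | edge s t b h =>
    obtain ⟨h', rfl⟩ := (Multiset.singleton_eq_cons_iff _).1 hE.symm
    cases h'
    exact Or.inl ⟨rfl, rfl, rfl, rfl⟩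
  | flip s t b h =>
    obtain ⟨h', rfl⟩ := (Multiset.singleton_eq_cons_iff _).1 hE.symm
    cases h'
    exact absurd rfl h
  | series V₁ V₂ E₁ E₂ s m t a' b h₁ h₂ h ih₁ ih₂ =>
    obtain ⟨hsm, hsV, hmV⟩ := h₁.ne_and_mem
    have hs₂ : s ∉ V₂ := fun hs => hsm <| Finset.mem_singleton.1 <|
      h ▸ Finset.mem_inter.2 ⟨hsV, hs⟩
    rcases Multiset.add_eq_cons hE.symm with ⟨E', rfl, rfl⟩ | ⟨E', rfl, rfl⟩
    · have he : (V₁ ∪ V₂).erase s = V₁.erase s ∪ V₂ := by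
        rw [Finset.erase_union_distrib, Finset.erase_eq_of_notMem hs₂]
      right
      rcases ih₁ (fun f hf => hF f (Multiset.mem_add.2 (Or.inl hf))) rfl with
        ⟨rfl, rfl, rfl, rfl⟩ | ⟨b', hb', rfl⟩
      · refine ⟨b, ?_, rfl⟩
        have : ({s, x} : Finset α).erase s ∪ V₂ = V₂ := by
          have := h₂.ne_and_mem.2.1
          ext u; simp only [Finset.mem_union, Finset.mem_erase, Finset.mem_insert,
            Finset.mem_singleton]; grind
        rw [he, this, zero_add]
        exact h₂
      · refine ⟨ser (v m) b' b, ?_, by rw [ser_assoc]⟩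
        rw [he]
        refine .series _ _ _ _ _ _ _ _ _ hb' h₂ ?_
        rw [Finset.erase_inter, h, Finset.erase_eq_of_notMem (by simpa using hsm)]
    · exact absurd (h₂.mem_of_touches (Multiset.mem_cons_self _ _) (Or.inl rfl)) hs₂
  | parallel V₁ V₂ E₁ E₂ s t a' b h₁ h₂ h ih₁ ih₂ =>
    exfalso
    rcases Multiset.add_eq_cons hE.symm with ⟨E', rfl, rfl⟩ | ⟨E', rfl, rfl⟩
    · obtain ⟨e, he, hs⟩ := h₂.exists_touches_source
      exact hF e (Multiset.mem_add.2 (Or.inr he)) hs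
    · obtain ⟨e, he, hs⟩ := h₁.exists_touches_source
      exact hF e (Multiset.mem_add.2 (Or.inl he)) hs

/-- An edge between the terminals can be split off by a parallel composition. -/
theorem of_terminal_edge (h : LabelledSP v V ((s, t, a) ::ₘ F) s t l) :
    (F = 0 ∧ V = {s, t} ∧ l = a) ∨ ∃ b, LabelledSP v V F s t b ∧ l = par a b := by
  generalize hE : (s, t, a) ::ₘ F = E at h
  induction h generalizing F with
  | edge s t b h =>
    obtain ⟨h', rfl⟩ := (Multiset.singleton_eq_cons_iff _).1 hE.symm
    cases h'
    exact Or.inl ⟨rfl, rfl, rfl⟩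
  | flip s t b h =>
    obtain ⟨h', rfl⟩ := (Multiset.singleton_eq_cons_iff _).1 hE.symm
    cases h'
    exact absurd rfl h
  | series V₁ V₂ E₁ E₂ s m t a' b h₁ h₂ h ih₁ ih₂ =>
    exfalso
    obtain ⟨hsm, hsV, hmV⟩ := h₁.ne_and_mem
    obtain ⟨hmt, hmV', htV⟩ := h₂.ne_and_mem
    rcases Multiset.add_eq_cons hE.symm with ⟨E', rfl, rfl⟩ | ⟨E', rfl, rfl⟩
    · have := h₁.mem_of_touches (z := t) (Multiset.mem_cons_self _ _) (Or.inr rfl)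
      exact hmt (Finset.mem_singleton.1 (h ▸ Finset.mem_inter.2 ⟨this, htV⟩)).symm
    · have := h₂.mem_of_touches (z := s) (Multiset.mem_cons_self _ _) (Or.inl rfl)
      exact hsm (Finset.mem_singleton.1 (h ▸ Finset.mem_inter.2 ⟨hsV, this⟩))
  | parallel V₁ V₂ E₁ E₂ s t a' b h₁ h₂ h ih₁ ih₂ =>
    right
    rcases Multiset.add_eq_cons hE.symm with ⟨E', rfl, rfl⟩ | ⟨E', rfl, rfl⟩
    · rcases ih₁ rfl with ⟨rfl, rfl, rfl⟩ | ⟨b', hb', rfl⟩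
      · refine ⟨b, ?_, rfl⟩
        rwa [Finset.union_eq_right.2 (h ▸ Finset.inter_subset_right), zero_add]
      · exact ⟨par b' b, .parallel _ _ _ _ _ _ _ _ hb' h₂ h, by rw [par_assoc]⟩
    · rcases ih₂ rfl with ⟨rfl, rfl, rfl⟩ | ⟨b', hb', rfl⟩
      · refine ⟨a', ?_, par_comm _ _⟩
        rwa [Finset.union_eq_left.2 (h ▸ Finset.inter_subset_left), add_zero]
      · refine ⟨par a' b', .parallel _ _ _ _ _ _ _ _ h₁ hb' h, ?_⟩
        rw [par_comm, par_assoc, par_comm b']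

theorem merge_terminal_edges (h₁ : LabelledSP v V₁ ((s, t, a) ::ₘ F₁) s t l₁)
    (h₂ : LabelledSP v V₂ ((s, t, b) ::ₘ F₂) s t l₂) (h : V₁ ∩ V₂ = {s, t}) :
    LabelledSP v (V₁ ∪ V₂) ((s, t, par a b) ::ₘ (F₁ + F₂)) s t (par l₁ l₂) := by
  have hst := h₁.ne_and_mem.1
  have hs₁ : {s, t} ⊆ V₁ := h ▸ Finset.inter_subset_left
  have hs₂ : {s, t} ⊆ V₂ := h ▸ Finset.inter_subset_right
  have he := LabelledSP.edge (v := v) s t (par a b) hst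
  rcases h₁.of_terminal_edge with ⟨rfl, rfl, rfl⟩ | ⟨l₁', h₁', rfl⟩ <;>
    rcases h₂.of_terminal_edge with ⟨rfl, rfl, rfl⟩ | ⟨l₂', h₂', rfl⟩
  · simpa using he
  · rw [zero_add, ← Multiset.singleton_add, ← par_assoc]
    exact .parallel _ _ _ _ _ _ _ _ he h₂' h
  · rw [add_zero, ← Multiset.singleton_add, Finset.union_comm, par_assoc, par_comm l₁',
      ← par_assoc]
    exact .parallel _ _ _ _ _ _ _ _ he h₁' (by rw [Finset.inter_comm, h])
  · have e : (a.par l₁').par (b.par l₂') = (a.par b).par (l₁'.par l₂') := by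
      rw [par_assoc, ← par_assoc l₁', par_comm l₁', par_assoc b, ← par_assoc]
    rw [e, ← Multiset.singleton_add]
    have := LabelledSP.parallel _ _ _ _ _ _ _ _ he
      (.parallel _ _ _ _ _ _ _ _ h₁' h₂' h) (by rw [Finset.inter_union_distrib_left,
        Finset.inter_eq_left.2 hs₁, Finset.inter_eq_left.2 hs₂, Finset.union_self])
    rwa [Finset.union_eq_right.2 (hs₁.trans Finset.subset_union_left)] at this

/-- Two parallel edges may be replaced by a single one. -/
theorem merge_parallel (h : LabelledSP v V ((x, y, a) ::ₘ (x, y, b) ::ₘ F) s t l) :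
    LabelledSP v V ((x, y, par a b) ::ₘ F) s t l := by
  generalize hE : (x, y, a) ::ₘ (x, y, b) ::ₘ F = E at h
  induction h generalizing F with
  | edge s t b h => simpa using congrArg Multiset.card hE
  | flip s t b h => simpa using congrArg Multiset.card hE
  | series V₁ V₂ E₁ E₂ s m t a' b' h₁ h₂ h ih₁ ih₂ =>
    have cross : ∀ {e f : α × α × SPLabel R}, e ∈ E₁ → f ∈ E₂ → e.1 = x → e.2.1 = y → f.1 = x →
        f.2.1 = y → False := by
      intro e f he hf e₁ e₂ f₁ f₂
      have hx := Finset.mem_inter.2 ⟨h₁.mem_of_touches he (Or.inl e₁),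
        h₂.mem_of_touches hf (Or.inl f₁)⟩
      have hy := Finset.mem_inter.2 ⟨h₁.mem_of_touches he (Or.inr e₂),
        h₂.mem_of_touches hf (Or.inr f₂)⟩
      rw [h, Finset.mem_singleton] at hx hy
      exact (h₁.mem_of_mem e he).2.2 (by rw [e₁, e₂, hx, hy])
    rcases Multiset.add_eq_cons_cons hE.symm with ⟨E', rfl, rfl⟩ | ⟨E', E'', rfl, rfl, rfl⟩ |
      ⟨E', E'', rfl, rfl, rfl⟩ | ⟨E', rfl, rfl⟩
    · rw [← Multiset.cons_add]
      exact .series _ _ _ _ _ _ _ _ _ (ih₁ rfl) h₂ h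
    · exact (cross (Multiset.mem_cons_self _ _) (Multiset.mem_cons_self _ _) rfl rfl rfl rfl).elim
    · exact (cross (Multiset.mem_cons_self _ _) (Multiset.mem_cons_self _ _) rfl rfl rfl rfl).elim
    · rw [← Multiset.add_cons]
      exact .series _ _ _ _ _ _ _ _ _ h₁ (ih₂ rfl) h
  | parallel V₁ V₂ E₁ E₂ s t a' b' h₁ h₂ h ih₁ ih₂ =>
    have cross : ∀ {c d : SPLabel R} {E' E'' : Multiset (α × α × SPLabel R)},
        E₁ = (x, y, c) ::ₘ E' → E₂ = (x, y, d) ::ₘ E'' →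
        LabelledSP v (V₁ ∪ V₂) ((x, y, par c d) ::ₘ (E' + E'')) s t (par a' b') := by
      rintro c d E' E'' rfl rfl
      have hx := Finset.mem_inter.2 ⟨h₁.mem_of_touches (Multiset.mem_cons_self _ _) (Or.inl rfl),
        h₂.mem_of_touches (Multiset.mem_cons_self _ _) (Or.inl rfl)⟩
      have hy := Finset.mem_inter.2 ⟨h₁.mem_of_touches (Multiset.mem_cons_self _ _) (Or.inr rfl),
        h₂.mem_of_touches (Multiset.mem_cons_self _ _) (Or.inr rfl)⟩
      rw [h, Finset.mem_insert, Finset.mem_singleton] at hx hy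
      dsimp only at hx hy
      have hxy : x ≠ y := (h₁.mem_of_mem _ (Multiset.mem_cons_self _ _)).2.2
      rcases hx with rfl | rfl <;> rcases hy with rfl | rfl
      · exact absurd rfl hxy
      · exact merge_terminal_edges h₁ h₂ h
      · have := (merge_terminal_edges h₁.flip_edge h₂.flip_edge h).flip_edge
        rwa [rev_par, rev_rev, rev_rev] at this
      · exact absurd rfl hxy
    rcases Multiset.add_eq_cons_cons hE.symm with ⟨E', rfl, rfl⟩ | ⟨E', E'', h', h'', rfl⟩ |
      ⟨E', E'', h', h'', rfl⟩ | ⟨E', rfl, rfl⟩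
    · rw [← Multiset.cons_add]
      exact .parallel _ _ _ _ _ _ _ _ (ih₁ rfl) h₂ h
    · exact cross h' h''
    · rw [par_comm a b]
      exact cross h' h''
    · rw [← Multiset.add_cons]
      exact .parallel _ _ _ _ _ _ _ _ h₁ (ih₂ rfl) h

end LabelledSP

namespace LabelledSP

variable {α R : Type} [DecidableEq α] [CommSemiring R] {v : α → Bool → R} {V V₁ V₂ : Finset α}
  {E F F₁ F₂ : Multiset (α × α × SPLabel R)} {s t x y z m : α} {a b l l₁ l₂ : SPLabel R}

/-- The middle vertex of a series composition is suppressed, if it has degree two. -/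
theorem suppress_middle (h₁ : LabelledSP v V₁ ((x, m, a) ::ₘ F₁) s m l₁)
    (h₂ : LabelledSP v V₂ ((m, y, b) ::ₘ F₂) m t l₂) (h : V₁ ∩ V₂ = {m}) (hxy : x ≠ y)
    (hF : ∀ f ∈ F₁ + F₂, ¬ Touches f m) :
    LabelledSP v ((V₁ ∪ V₂).erase m) ((x, y, ser (v m) a b) ::ₘ (F₁ + F₂)) s t
      (ser (v m) l₁ l₂) := by
  have hF₁ : ∀ f ∈ F₁, ¬ Touches f m := fun f hf => hF f (Multiset.mem_add.2 (Or.inl hf))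
  have hF₂ : ∀ f ∈ F₂, ¬ Touches f m := fun f hf => hF f (Multiset.mem_add.2 (Or.inr hf))
  have hi : ∀ u, u ∈ V₁ → u ∈ V₂ → u = m := fun u hu hu' =>
    Finset.mem_singleton.1 (h ▸ Finset.mem_inter.2 ⟨hu, hu'⟩)
  obtain ⟨hsm, hs₁, hm₁⟩ := h₁.ne_and_mem
  obtain ⟨hmt, hm₂, ht₂⟩ := h₂.ne_and_mem
  have hx₁ : x ∈ V₁ := h₁.mem_of_touches (Multiset.mem_cons_self _ _) (Or.inl rfl)
  have hy₂ : y ∈ V₂ := h₂.mem_of_touches (Multiset.mem_cons_self _ _) (Or.inr rfl)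
  have hxm : x ≠ m := (h₁.mem_of_mem _ (Multiset.mem_cons_self _ _)).2.2
  have hym : m ≠ y := (h₂.mem_of_mem _ (Multiset.mem_cons_self _ _)).2.2
  have he := LabelledSP.edge (v := v) x y (ser (v m) a b) hxy
  have hl : (F₁ = 0 ∧ x = s ∧ V₁ = {s, m} ∧ l₁ = a) ∨
      ∃ l, LabelledSP v (V₁.erase m) F₁ s x l ∧ l₁ = ser (v x) l a := by
    rcases h₁.flip_edge.reverse.of_source_degree_one hF₁ with ⟨h, rfl, h', h''⟩ | ⟨l, hl, hl'⟩
    · exact Or.inl ⟨h, rfl, by rw [h', Finset.pair_comm], by simpa using congrArg rev h''⟩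
    · refine Or.inr ⟨l.rev, hl.reverse, ?_⟩
      simpa [rev_ser] using congrArg rev hl'
  rcases hl with ⟨rfl, rfl, rfl, rfl⟩ | ⟨l₁', h₁', rfl⟩ <;>
    rcases h₂.of_source_degree_one hF₂ with ⟨rfl, rfl, rfl, rfl⟩ | ⟨l₂', h₂', rfl⟩
  · have : ({x, m} ∪ {m, y} : Finset α).erase m = {x, y} := by
      ext u; simp only [Finset.mem_union, Finset.mem_erase, Finset.mem_insert,
        Finset.mem_singleton]; grind
    rw [this, add_zero]
    exact he
  · have : ({x, m} ∪ V₂ : Finset α).erase m = {x, y} ∪ V₂.erase m := by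
      ext u; simp only [Finset.mem_union, Finset.mem_erase, Finset.mem_insert,
        Finset.mem_singleton]; grind
    rw [this, zero_add, ← Multiset.singleton_add, ← ser_assoc]
    refine .series _ _ _ _ _ _ _ _ _ he h₂' ?_
    ext u; simp only [Finset.mem_inter, Finset.mem_erase, Finset.mem_insert,
        Finset.mem_singleton]; grind
  · have : (V₁ ∪ {m, y} : Finset α).erase m = V₁.erase m ∪ {x, y} := by
      ext u; simp only [Finset.mem_union, Finset.mem_erase, Finset.mem_insert,
        Finset.mem_singleton]; grind
    rw [this, add_zero, ← Multiset.singleton_add, add_comm, ser_assoc]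
    refine .series _ _ _ _ _ _ _ _ _ h₁' he ?_
    ext u; simp only [Finset.mem_inter, Finset.mem_erase, Finset.mem_insert,
        Finset.mem_singleton]; grind
  · have : (V₁ ∪ V₂ : Finset α).erase m = V₁.erase m ∪ ({x, y} ∪ V₂.erase m) := by
      ext u; simp only [Finset.mem_union, Finset.mem_erase, Finset.mem_insert,
        Finset.mem_singleton]; grind
    rw [this, ← Multiset.singleton_add, add_left_comm, ser_assoc, ← ser_assoc (v m)]
    refine .series _ _ _ _ _ _ _ _ _ h₁' (.series _ _ _ _ _ _ _ _ _ he h₂' ?_) ?_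
    · ext u; simp only [Finset.mem_inter, Finset.mem_erase, Finset.mem_insert,
        Finset.mem_singleton]; grind
    · ext u; simp only [Finset.mem_inter, Finset.mem_erase, Finset.mem_insert,
        Finset.mem_singleton, Finset.mem_union]; grind

/-- An inner vertex of degree two is suppressed. -/
theorem suppress_inner (h : LabelledSP v V ((x, z, a) ::ₘ (z, y, b) ::ₘ F) s t l)
    (hxy : x ≠ y) (hzs : z ≠ s) (hzt : z ≠ t) (hF : ∀ f ∈ F, ¬ Touches f z) :
    LabelledSP v (V.erase z) ((x, y, ser (v z) a b) ::ₘ F) s t l := by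
  generalize hE : (x, z, a) ::ₘ (z, y, b) ::ₘ F = E at h
  induction h generalizing F with
  | edge s t b h => simpa using congrArg Multiset.card hE
  | flip s t b h => simpa using congrArg Multiset.card hE
  | series V₁ V₂ E₁ E₂ s m t a' b' h₁ h₂ h ih₁ ih₂ =>
    have hi : ∀ u, u ∈ V₁ → u ∈ V₂ → u = m := fun u hu hu' =>
      Finset.mem_singleton.1 (h ▸ Finset.mem_inter.2 ⟨hu, hu'⟩)
    rcases Multiset.add_eq_cons_cons hE.symm with ⟨E', rfl, rfl⟩ | ⟨E', E'', rfl, rfl, rfl⟩ |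
      ⟨E', E'', rfl, rfl, rfl⟩ | ⟨E', rfl, rfl⟩
    · have hz₁ : z ∈ V₁ := h₁.mem_of_touches (Multiset.mem_cons_self _ _) (Or.inr rfl)
      have hz₂ : z ∉ V₂ := fun hz₂ => by
        obtain ⟨e, he, he'⟩ := h₂.exists_touches_source
        rw [← hi z hz₁ hz₂] at he'
        exact hF e (Multiset.mem_add.2 (Or.inr he)) he'
      have hzm : z ≠ m := fun e => hz₂ (e ▸ h₂.ne_and_mem.2.1)
      rw [Finset.erase_union_distrib, Finset.erase_eq_of_notMem hz₂, ← Multiset.cons_add]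
      refine .series _ _ _ _ _ _ _ _ _ (ih₁ hzs hzm
        (fun f hf => hF f (Multiset.mem_add.2 (Or.inl hf))) rfl) h₂ ?_
      rw [Finset.erase_inter, h, Finset.erase_eq_of_notMem (by simpa using hzm)]
    · obtain rfl := hi z (h₁.mem_of_touches (Multiset.mem_cons_self _ _) (Or.inr rfl))
        (h₂.mem_of_touches (Multiset.mem_cons_self _ _) (Or.inl rfl))
      exact suppress_middle h₁ h₂ h hxy hF
    · obtain rfl := hi z (h₁.mem_of_touches (Multiset.mem_cons_self _ _) (Or.inl rfl))
        (h₂.mem_of_touches (Multiset.mem_cons_self _ _) (Or.inr rfl))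
      have := (suppress_middle h₁.flip_edge h₂.flip_edge h hxy.symm hF).flip_edge
      rwa [rev_ser, rev_rev, rev_rev] at this
    · have hz₂ : z ∈ V₂ := h₂.mem_of_touches (Multiset.mem_cons_self _ _) (Or.inr rfl)
      have hz₁ : z ∉ V₁ := fun hz₁ => by
        obtain ⟨e, he, he'⟩ := h₁.exists_touches_sink
        rw [← hi z hz₁ hz₂] at he'
        exact hF e (Multiset.mem_add.2 (Or.inl he)) he'
      have hzm : z ≠ m := fun e => hz₁ (e ▸ h₁.ne_and_mem.2.2)
      rw [Finset.erase_union_distrib, Finset.erase_eq_of_notMem hz₁, ← Multiset.add_cons]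
      refine .series _ _ _ _ _ _ _ _ _ h₁ (ih₂ hzm hzt
        (fun f hf => hF f (Multiset.mem_add.2 (Or.inr hf))) rfl) ?_
      rw [Finset.inter_erase, h, Finset.erase_eq_of_notMem (by simpa using hzm)]
  | parallel V₁ V₂ E₁ E₂ s t a' b' h₁ h₂ h ih₁ ih₂ =>
    have hi : ∀ u, u ∈ V₁ → u ∈ V₂ → u = s ∨ u = t := fun u hu hu' => by
      simpa using (h ▸ Finset.mem_inter.2 ⟨hu, hu'⟩ : u ∈ ({s, t} : Finset α))
    have hz : z ∈ V₁ → z ∈ V₂ → False := fun hz₁ hz₂ => (hi z hz₁ hz₂).elim hzs hzt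
    have hzi : z ∉ ({s, t} : Finset α) := by simp [hzs, hzt]
    rcases Multiset.add_eq_cons_cons hE.symm with ⟨E', rfl, rfl⟩ | ⟨E', E'', rfl, rfl, rfl⟩ |
      ⟨E', E'', rfl, rfl, rfl⟩ | ⟨E', rfl, rfl⟩
    · have hz₁ : z ∈ V₁ := h₁.mem_of_touches (Multiset.mem_cons_self _ _) (Or.inr rfl)
      rw [Finset.erase_union_distrib, Finset.erase_eq_of_notMem (hz hz₁), ← Multiset.cons_add]
      refine .parallel _ _ _ _ _ _ _ _ (ih₁ hzs hzt
        (fun f hf => hF f (Multiset.mem_add.2 (Or.inl hf))) rfl) h₂ ?_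
      rw [Finset.erase_inter, h, Finset.erase_eq_of_notMem hzi]
    · exact (hz (h₁.mem_of_touches (Multiset.mem_cons_self _ _) (Or.inr rfl))
        (h₂.mem_of_touches (Multiset.mem_cons_self _ _) (Or.inl rfl))).elim
    · exact (hz (h₁.mem_of_touches (Multiset.mem_cons_self _ _) (Or.inl rfl))
        (h₂.mem_of_touches (Multiset.mem_cons_self _ _) (Or.inr rfl))).elim
    · have hz₂ : z ∈ V₂ := h₂.mem_of_touches (Multiset.mem_cons_self _ _) (Or.inr rfl)
      rw [Finset.erase_union_distrib, Finset.erase_eq_of_notMem (fun hz₁ => hz hz₁ hz₂),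
        ← Multiset.add_cons]
      refine .parallel _ _ _ _ _ _ _ _ h₁ (ih₂ hzs hzt
        (fun f hf => hF f (Multiset.mem_add.2 (Or.inr hf))) rfl) ?_
      rw [Finset.inter_erase, h, Finset.erase_eq_of_notMem hzi]

/-- The source of a parallel composition is suppressed, if it has degree two. One of its
neighbours becomes the new source. -/
theorem suppress_source_parallel (h₁ : LabelledSP v V₁ ((x, s, a) ::ₘ F₁) s t l₁)
    (h₂ : LabelledSP v V₂ ((s, y, b) ::ₘ F₂) s t l₂) (h : V₁ ∩ V₂ = {s, t}) (hxy : x ≠ y)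
    (hF : ∀ f ∈ F₁ + F₂, ¬ Touches f s) :
    ∃ s' l', LabelledSP v ((V₁ ∪ V₂).erase s) ((x, y, ser (v s) a b) ::ₘ (F₁ + F₂)) s' t l' ∧
      contract (v s') l' = contract (v s) (par l₁ l₂) := by
  have hF₁ : ∀ f ∈ F₁, ¬ Touches f s := fun f hf => hF f (Multiset.mem_add.2 (Or.inl hf))
  have hF₂ : ∀ f ∈ F₂, ¬ Touches f s := fun f hf => hF f (Multiset.mem_add.2 (Or.inr hf))
  have hi : ∀ u, u ∈ V₁ → u ∈ V₂ → u = s ∨ u = t := fun u hu hu' => by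
    simpa using (h ▸ Finset.mem_inter.2 ⟨hu, hu'⟩ : u ∈ ({s, t} : Finset α))
  obtain ⟨hst, hs₁, ht₁⟩ := h₁.ne_and_mem
  obtain ⟨-, hs₂, ht₂⟩ := h₂.ne_and_mem
  have hx₁ : x ∈ V₁ := h₁.mem_of_touches (Multiset.mem_cons_self _ _) (Or.inl rfl)
  have hy₂ : y ∈ V₂ := h₂.mem_of_touches (Multiset.mem_cons_self _ _) (Or.inr rfl)
  have hxs : x ≠ s := (h₁.mem_of_mem _ (Multiset.mem_cons_self _ _)).2.2
  have hys : s ≠ y := (h₂.mem_of_mem _ (Multiset.mem_cons_self _ _)).2.2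
  have he := LabelledSP.edge (v := v) x y (ser (v s) a b) hxy
  rcases h₁.flip_edge.of_source_degree_one hF₁ with ⟨rfl, rfl, rfl, rfl⟩ | ⟨l₁', h₁', rfl⟩ <;>
    rcases h₂.of_source_degree_one hF₂ with ⟨rfl, rfl, rfl, rfl⟩ | ⟨l₂', h₂', rfl⟩
  · exact absurd rfl hxy
  · refine ⟨y, par (ser (v s) a b).rev l₂', ?_, ?_⟩
    · have : ({s, x} ∪ V₂ : Finset α).erase s = {x, y} ∪ V₂.erase s := by
        ext u; simp only [Finset.mem_union, Finset.mem_erase, Finset.mem_insert,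
          Finset.mem_singleton]; grind
      rw [this, zero_add, ← Multiset.singleton_add]
      refine .parallel _ _ _ _ _ _ _ _ he.reverse h₂' ?_
      ext u; simp only [Finset.mem_inter, Finset.mem_erase, Finset.mem_insert,
          Finset.mem_singleton]; grind
    · have := contract_par_ser (v s) (v y) a.rev b l₂'
      rwa [rev_rev] at this
  · refine ⟨x, par (ser (v s) a l₂) l₁', ?_, ?_⟩
    · have : (V₁ ∪ {s, y} : Finset α).erase s = {x, y} ∪ V₁.erase s := by
        ext u; simp only [Finset.mem_union, Finset.mem_erase, Finset.mem_insert,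
          Finset.mem_singleton]; grind
      rw [this, add_zero, ← Multiset.singleton_add]
      refine .parallel _ _ _ _ _ _ _ _ he h₁' ?_
      ext u; simp only [Finset.mem_inter, Finset.mem_erase, Finset.mem_insert,
          Finset.mem_singleton]; grind
    · have := contract_par_ser (v s) (v x) l₂ a.rev l₁'
      rwa [rev_ser, rev_rev, rev_rev, par_comm l₂] at this
  · refine ⟨x, par l₁' (ser (v y) (ser (v s) a b) l₂'), ?_, ?_⟩
    · have : (V₁ ∪ V₂ : Finset α).erase s = V₁.erase s ∪ ({x, y} ∪ V₂.erase s) := by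
        ext u; simp only [Finset.mem_union, Finset.mem_erase, Finset.mem_insert,
          Finset.mem_singleton]; grind
      have hy₁ : y ∉ V₁ := fun hy₁ => by
        rcases hi y hy₁ hy₂ with e | e
        · exact hys e.symm
        · exact h₂'.ne_and_mem.1 e
      have hx₂ : x ∉ V₂ := fun hx₂ => by
        rcases hi x hx₁ hx₂ with e | e
        · exact hxs e
        · exact h₁'.ne_and_mem.1 e
      rw [this, ← Multiset.singleton_add, add_left_comm]
      refine .parallel _ _ _ _ _ _ _ _ h₁' (.series _ _ _ _ _ _ _ _ _ he h₂' ?_) ?_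
      · ext u; simp only [Finset.mem_inter, Finset.mem_erase, Finset.mem_insert,
          Finset.mem_singleton]; grind
      · ext u; simp only [Finset.mem_inter, Finset.mem_erase, Finset.mem_insert,
          Finset.mem_singleton, Finset.mem_union]; grind
    · have := contract_par_ser_ser (v s) (v x) (v y) a.rev b l₁' l₂'
      rwa [rev_rev] at this

/-- A source of degree two is suppressed. -/
theorem suppress_source (h : LabelledSP v V ((x, s, a) ::ₘ (s, y, b) ::ₘ F) s t l)
    (hxy : x ≠ y) (hF : ∀ f ∈ F, ¬ Touches f s) :
    ∃ s' l', LabelledSP v (V.erase s) ((x, y, ser (v s) a b) ::ₘ F) s' t l' ∧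
      contract (v s') l' = contract (v s) l := by
  generalize hE : (x, s, a) ::ₘ (s, y, b) ::ₘ F = E at h
  induction h generalizing F with
  | edge s t b h => simpa using congrArg Multiset.card hE
  | flip s t b h => simpa using congrArg Multiset.card hE
  | series V₁ V₂ E₁ E₂ s m t a' b' h₁ h₂ h ih₁ ih₂ =>
    obtain ⟨hsm, hsV, hmV⟩ := h₁.ne_and_mem
    have hs₂ : s ∉ V₂ := fun hs => hsm <| Finset.mem_singleton.1 <|
      h ▸ Finset.mem_inter.2 ⟨hsV, hs⟩
    rcases Multiset.add_eq_cons_cons hE.symm with ⟨E', rfl, rfl⟩ | ⟨E', E'', rfl, rfl, rfl⟩ |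
      ⟨E', E'', rfl, rfl, rfl⟩ | ⟨E', rfl, rfl⟩
    · obtain ⟨s', l', h', e'⟩ := ih₁ (fun f hf => hF f (Multiset.mem_add.2 (Or.inl hf))) rfl
      refine ⟨s', ser (v m) l' b', ?_, contract_ser e'⟩
      rw [Finset.erase_union_distrib, Finset.erase_eq_of_notMem hs₂, ← Multiset.cons_add]
      refine .series _ _ _ _ _ _ _ _ _ h' h₂ ?_
      rw [Finset.erase_inter, h, Finset.erase_eq_of_notMem (by simpa using hsm)]
    · exact (hs₂ (h₂.mem_of_touches (Multiset.mem_cons_self _ _) (Or.inl rfl))).elim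
    · exact (hs₂ (h₂.mem_of_touches (Multiset.mem_cons_self _ _) (Or.inr rfl))).elim
    · exact (hs₂ (h₂.mem_of_touches (Multiset.mem_cons_self _ _) (Or.inr rfl))).elim
  | parallel V₁ V₂ E₁ E₂ s t a' b' h₁ h₂ h ih₁ ih₂ =>
    rcases Multiset.add_eq_cons_cons hE.symm with ⟨E', rfl, rfl⟩ | ⟨E', E'', rfl, rfl, rfl⟩ |
      ⟨E', E'', rfl, rfl, rfl⟩ | ⟨E', rfl, rfl⟩
    · obtain ⟨e, he, he'⟩ := h₂.exists_touches_source
      exact (hF e (Multiset.mem_add.2 (Or.inr he)) he').elim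
    · exact suppress_source_parallel h₁ h₂ h hxy hF
    · obtain ⟨s', l', h', e'⟩ := suppress_source_parallel h₁.flip_edge h₂.flip_edge h hxy.symm hF
      refine ⟨s', l', ?_, e'⟩
      have := h'.flip_edge
      rwa [rev_ser, rev_rev, rev_rev] at this
    · obtain ⟨e, he, he'⟩ := h₁.exists_touches_source
      exact (hF e (Multiset.mem_add.2 (Or.inl he)) he').elim

/-- The suppression of any vertex of degree two leaves a series-parallel graph, possibly with other
terminals, and the same total sum. -/
theorem suppress (h : LabelledSP v V ((x, z, a) ::ₘ (z, y, b) ::ₘ F) s t l) (hxy : x ≠ y)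
    (hF : ∀ f ∈ F, ¬ Touches f z) :
    ∃ s' t' l', LabelledSP v (V.erase z) ((x, y, ser (v z) a b) ::ₘ F) s' t' l' ∧
      total (v s') (v t') l' = total (v s) (v t) l := by
  by_cases hs : z = s
  · subst hs
    obtain ⟨s', l', h', e⟩ := h.suppress_source hxy hF
    exact ⟨s', t, l', h', by simp only [total, e]⟩
  by_cases ht : z = t
  · subst ht
    obtain ⟨s', l', h', e⟩ := h.reverse.suppress_source hxy hF
    exact ⟨s', s, l', h', by rw [← total_rev (v s)]; simp only [total, e]⟩
  · exact ⟨s, t, l, h.suppress_inner hxy hs ht hF, rfl⟩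

/-- The ends of a labelled edge. -/
def ends (e : α × α × SPLabel R) : Sym2 α := s(e.1, e.2.1)

/-- A simple series-parallel graph with an inner vertex has a vertex of degree two. -/
theorem exists_degree_two (h : LabelledSP v V E s t l) (hE : (E.map ends).Nodup) :
    V = {s, t} ∨ ∃ z ∈ V, z ≠ s ∧ z ≠ t ∧ ∃ e f F, E = e ::ₘ f ::ₘ F ∧ Touches e z ∧
      Touches f z ∧ ∀ g ∈ F, ¬ Touches g z := by
  have single : ∀ {W : Finset α} {D : Multiset (α × α × SPLabel R)} {p q : α} {k : SPLabel R},
      LabelledSP v W D p q k → (D.map ends).Nodup → W = {p, q} →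
      ∃ e, D = {e} ∧ Touches e p ∧ Touches e q := by
    rintro W D p q k hD hn rfl
    have hk : ∀ e ∈ D, ends e = s(p, q) ∧ Touches e p ∧ Touches e q := by
      intro e he
      obtain ⟨h₁, h₂, h₃⟩ := hD.mem_of_mem e he
      simp only [Finset.mem_insert, Finset.mem_singleton] at h₁ h₂
      unfold ends Touches
      rw [Sym2.eq_iff]
      grind
    obtain ⟨e, he, -⟩ := hD.exists_touches_source
    obtain ⟨D', rfl⟩ := Multiset.exists_cons_of_mem he
    refine ⟨e, ?_, (hk e he).2⟩
    rcases D'.empty_or_exists_mem with rfl | ⟨f, hf⟩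
    · rfl
    · rw [Multiset.map_cons, Multiset.nodup_cons] at hn
      refine (hn.1 (Multiset.mem_map.2 ⟨f, hf, ?_⟩)).elim
      rw [(hk e he).1, (hk f (Multiset.mem_cons_of_mem hf)).1]
  induction h with
  | edge s t a h => exact Or.inl rfl
  | flip s t a h => exact Or.inl rfl
  | series V₁ V₂ E₁ E₂ s m t a b h₁ h₂ h ih₁ ih₂ =>
    right
    rw [Multiset.map_add, Multiset.nodup_add] at hE
    obtain ⟨hsm, hs₁, hm₁⟩ := h₁.ne_and_mem
    obtain ⟨hmt, hm₂, ht₂⟩ := h₂.ne_and_mem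
    have hi : ∀ u, u ∈ V₁ → u ∈ V₂ → u = m := fun u hu hu' =>
      Finset.mem_singleton.1 (h ▸ Finset.mem_inter.2 ⟨hu, hu'⟩)
    rcases ih₁ hE.1 with hV₁ | ⟨z, hz, hzs, hzm, e, f, F, rfl, he, hf, hF⟩
    · rcases ih₂ hE.2.1 with hV₂ | ⟨z, hz, hzm, hzt, e, f, F, rfl, he, hf, hF⟩
      · obtain ⟨e, rfl, -, he⟩ := single h₁ hE.1 hV₁
        obtain ⟨f, rfl, hf, -⟩ := single h₂ hE.2.1 hV₂
        exact ⟨m, Finset.mem_union_left _ hm₁, hsm.symm, hmt, e, f, 0, rfl, he, hf, by simp⟩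
      · refine ⟨z, Finset.mem_union_right _ hz, fun e => ?_, hzt, e, f, E₁ + F, by simp, he, hf,
          fun g hg => ?_⟩
        · exact hzm (hi z (e ▸ hs₁) hz)
        · rcases Multiset.mem_add.1 hg with hg | hg
          · exact fun hg' => hzm (hi z (h₁.mem_of_touches hg hg') hz)
          · exact hF g hg
    · refine ⟨z, Finset.mem_union_left _ hz, hzs, fun e => ?_, e, f, F + E₂, by simp, he, hf,
          fun g hg => ?_⟩
      · exact hzm (hi z hz (e ▸ ht₂))
      · rcases Multiset.mem_add.1 hg with hg | hg
        · exact hF g hg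
        · exact fun hg' => hzm (hi z hz (h₂.mem_of_touches hg hg'))
  | parallel V₁ V₂ E₁ E₂ s t a b h₁ h₂ h ih₁ ih₂ =>
    rw [Multiset.map_add, Multiset.nodup_add] at hE
    have hi : ∀ u, u ∈ V₁ → u ∈ V₂ → u = s ∨ u = t := fun u hu hu' => by
      simpa using (h ▸ Finset.mem_inter.2 ⟨hu, hu'⟩ : u ∈ ({s, t} : Finset α))
    rcases ih₁ hE.1 with hV₁ | ⟨z, hz, hzs, hzt, e, f, F, rfl, he, hf, hF⟩
    · rcases ih₂ hE.2.1 with hV₂ | ⟨z, hz, hzs, hzt, e, f, F, rfl, he, hf, hF⟩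
      · left
        rw [hV₁, hV₂, Finset.union_self]
      · refine Or.inr ⟨z, Finset.mem_union_right _ hz, hzs, hzt, e, f, E₁ + F, by simp, he, hf,
          fun g hg => ?_⟩
        rcases Multiset.mem_add.1 hg with hg | hg
        · exact fun hg' => (hi z (h₁.mem_of_touches hg hg') hz).elim hzs hzt
        · exact hF g hg
    · refine Or.inr ⟨z, Finset.mem_union_left _ hz, hzs, hzt, e, f, F + E₂, by simp, he, hf,
          fun g hg => ?_⟩
      rcases Multiset.mem_add.1 hg with hg | hg
      · exact hF g hg
      · exact fun hg' => (hi z hz (h₂.mem_of_touches hg hg')).elim hzs hzt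

end LabelledSP

/-! ### Connected vertex sets in series and parallel compositions -/

section Connectivity

variable {α : Type}

/-- There is a walk from `u` to `w` along the edges `E` with all its vertices in `C` (except that
the walk without edges is always allowed). -/
def Linked (E : Multiset (Sym2 α)) (C : Finset α) : α → α → Prop :=
  Relation.ReflTransGen fun a b => s(a, b) ∈ E ∧ a ∈ C ∧ b ∈ C

/-- The set `C` is nonempty and connected by the edges `E`. -/
def Conn (E : Multiset (Sym2 α)) (C : Finset α) : Prop :=
  ∃ r ∈ C, ∀ u ∈ C, Linked E C r u

variable {E E₁ E₂ : Multiset (Sym2 α)} {C C' V V₁ V₂ : Finset α} {u w m s t : α}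

theorem Linked.symm (h : Linked E C u w) : Linked E C w u := by
  induction h with
  | refl => exact .refl
  | tail _ hab ih => exact ih.head ⟨Sym2.eq_swap ▸ hab.1, hab.2.2, hab.2.1⟩

theorem Linked.trans {x : α} (h : Linked E C u w) (h' : Linked E C w x) : Linked E C u x :=
  Relation.ReflTransGen.trans h h'

theorem Linked.mono (h : Linked E₁ C u w) (hE : E₁ ≤ E) (hC : C ⊆ C') : Linked E C' u w :=
  Relation.ReflTransGen.mono
    (fun _ _ hab => ⟨Multiset.mem_of_le hE hab.1, hC hab.2.1, hC hab.2.2⟩) _ _ h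

theorem Conn.linked (h : Conn E C) (hu : u ∈ C) (hw : w ∈ C) : Linked E C u w := by
  obtain ⟨r, hr, h⟩ := h
  exact (h u hu).symm.trans (h w hw)

theorem conn_iff (hu : u ∈ C) : Conn E C ↔ ∀ w ∈ C, Linked E C u w :=
  ⟨fun h _ hw => h.linked hu hw, fun h => ⟨u, hu, h⟩⟩

theorem not_conn_empty : ¬ Conn E ∅ := by simp [Conn]

/-- The ends of all edges are in `V`. -/
def Inside (E : Multiset (Sym2 α)) (V : Finset α) : Prop := ∀ a b, s(a, b) ∈ E → a ∈ V ∧ b ∈ V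

variable [DecidableEq α]

/-- If the two parts share at most the vertex `m` of `C`, then a walk in `C` that starts in the
first part can be split at `m`. -/
theorem Linked.split (h₁ : Inside E₁ V₁) (h₂ : Inside E₂ V₂)
    (hm : ∀ x ∈ C, x ∈ V₁ → x ∈ V₂ → x = m) (h : Linked (E₁ + E₂) C u w) (hu : u ∈ C)
    (hu₁ : u ∈ V₁) : (w ∈ V₁ → Linked E₁ (C ∩ V₁) u w) ∧
      (w ∈ V₂ → Linked E₁ (C ∩ V₁) u m ∧ Linked E₂ (C ∩ V₂) m w) := by
  induction h with
  | refl =>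
    refine ⟨fun _ => .refl, fun hu₂ => ?_⟩
    rw [hm u hu hu₁ hu₂]
    exact ⟨.refl, .refl⟩
  | @tail x y hx hxy ih =>
    obtain ⟨he, hxC, hyC⟩ := hxy
    rcases Multiset.mem_add.1 he with he | he
    · obtain ⟨hx₁, hy₁⟩ := h₁ _ _ he
      have hl : Linked E₁ (C ∩ V₁) u y := (ih.1 hx₁).tail
        ⟨he, Finset.mem_inter.2 ⟨hxC, hx₁⟩, Finset.mem_inter.2 ⟨hyC, hy₁⟩⟩
      refine ⟨fun _ => hl, fun hy₂ => ?_⟩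
      rw [hm y hyC hy₁ hy₂] at hl ⊢
      exact ⟨hl, .refl⟩
    · obtain ⟨hx₂, hy₂⟩ := h₂ _ _ he
      refine ⟨fun hy₁ => ?_, fun _ => ⟨(ih.2 hx₂).1, (ih.2 hx₂).2.tail
        ⟨he, Finset.mem_inter.2 ⟨hxC, hx₂⟩, Finset.mem_inter.2 ⟨hyC, hy₂⟩⟩⟩⟩
      rw [hm y hyC hy₁ hy₂]
      exact (ih.2 hx₂).1

/-- If the two parts share no vertex of `C`, then a walk in `C` stays in its part. -/
theorem Linked.stay (h₁ : Inside E₁ V₁) (h₂ : Inside E₂ V₂)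
    (hm : ∀ x ∈ C, x ∈ V₁ → x ∉ V₂) (h : Linked (E₁ + E₂) C u w)
    (hu₁ : u ∈ V₁) : w ∈ V₁ ∧ Linked E₁ (C ∩ V₁) u w := by
  induction h with
  | refl => exact ⟨hu₁, .refl⟩
  | @tail x y hx hxy ih =>
    obtain ⟨he, hxC, hyC⟩ := hxy
    rcases Multiset.mem_add.1 he with he | he
    · obtain ⟨hx₁, hy₁⟩ := h₁ _ _ he
      exact ⟨hy₁, ih.2.tail
        ⟨he, Finset.mem_inter.2 ⟨hxC, hx₁⟩, Finset.mem_inter.2 ⟨hyC, hy₁⟩⟩⟩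
    · exact absurd (h₂ _ _ he).1 (hm x hxC ih.1)

theorem Linked.add_left (h : Linked E₁ (C ∩ V₁) u w) : Linked (E₁ + E₂) C u w :=
  h.mono (Multiset.le_add_right _ _) Finset.inter_subset_left

theorem Linked.add_right (h : Linked E₂ (C ∩ V₂) u w) : Linked (E₁ + E₂) C u w :=
  h.mono (Multiset.le_add_left _ _) Finset.inter_subset_left

theorem conn_add_iff (h₁ : Inside E₁ V₁) (h₂ : Inside E₂ V₂) (hC : C ⊆ V₁ ∪ V₂)
    (hmC : m ∈ C) (hm₁ : m ∈ V₁) (hm₂ : m ∈ V₂) (hm : ∀ x ∈ C, x ∈ V₁ → x ∈ V₂ → x = m) :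
    Conn (E₁ + E₂) C ↔ Conn E₁ (C ∩ V₁) ∧ Conn E₂ (C ∩ V₂) := by
  rw [conn_iff hmC, conn_iff (Finset.mem_inter.2 ⟨hmC, hm₁⟩),
    conn_iff (Finset.mem_inter.2 ⟨hmC, hm₂⟩)]
  constructor
  · intro h
    refine ⟨fun w hw => ?_, fun w hw => ?_⟩
    · obtain ⟨hw, hw₁⟩ := Finset.mem_inter.1 hw
      exact ((h w hw).split h₁ h₂ hm hmC hm₁).1 hw₁
    · obtain ⟨hw, hw₂⟩ := Finset.mem_inter.1 hw
      exact (((h w hw).split h₁ h₂ hm hmC hm₁).2 hw₂).2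
  · rintro ⟨h, h'⟩ w hw
    rcases Finset.mem_union.1 (hC hw) with hw' | hw'
    · exact (h w (Finset.mem_inter.2 ⟨hw, hw'⟩)).add_left
    · exact (h' w (Finset.mem_inter.2 ⟨hw, hw'⟩)).add_right

theorem conn_add_iff_of_disjoint (h₁ : Inside E₁ V₁) (h₂ : Inside E₂ V₂) (hC : C ⊆ V₁ ∪ V₂)
    (hm : ∀ x ∈ C, x ∈ V₁ → x ∉ V₂) :
    Conn (E₁ + E₂) C ↔
      (Conn E₁ (C ∩ V₁) ∧ C ∩ V₂ = ∅) ∨ (C ∩ V₁ = ∅ ∧ Conn E₂ (C ∩ V₂)) := by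
  constructor
  · rintro ⟨r, hr, h⟩
    rcases Finset.mem_union.1 (hC hr) with hr' | hr'
    · left
      refine ⟨⟨r, Finset.mem_inter.2 ⟨hr, hr'⟩, fun w hw => ?_⟩, ?_⟩
      · exact ((h w (Finset.mem_inter.1 hw).1).stay h₁ h₂ hm hr').2
      · refine Finset.eq_empty_of_forall_notMem fun w hw => ?_
        obtain ⟨hw, hw₂⟩ := Finset.mem_inter.1 hw
        exact hm w hw ((h w hw).stay h₁ h₂ hm hr').1 hw₂
    · right
      have hm' : ∀ x ∈ C, x ∈ V₂ → x ∉ V₁ := fun x hx hx₂ hx₁ => hm x hx hx₁ hx₂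
      rw [add_comm] at h
      refine ⟨?_, ⟨r, Finset.mem_inter.2 ⟨hr, hr'⟩, fun w hw => ?_⟩⟩
      · refine Finset.eq_empty_of_forall_notMem fun w hw => ?_
        obtain ⟨hw, hw₁⟩ := Finset.mem_inter.1 hw
        exact hm w hw hw₁ ((h w hw).stay h₂ h₁ hm' hr').1
      · exact ((h w (Finset.mem_inter.1 hw).1).stay h₂ h₁ hm' hr').2
  · rintro (⟨⟨r, hr, h⟩, h'⟩ | ⟨h', ⟨r, hr, h⟩⟩)
    · refine ⟨r, (Finset.mem_inter.1 hr).1, fun w hw => (h w ?_).add_left⟩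
      rcases Finset.mem_union.1 (hC hw) with hw' | hw'
      · exact Finset.mem_inter.2 ⟨hw, hw'⟩
      · exact absurd (Finset.mem_inter.2 ⟨hw, hw'⟩) (by simp [h'])
    · refine ⟨r, (Finset.mem_inter.1 hr).1, fun w hw => (h w ?_).add_right⟩
      rcases Finset.mem_union.1 (hC hw) with hw' | hw'
      · exact absurd (Finset.mem_inter.2 ⟨hw, hw'⟩) (by simp [h'])
      · exact Finset.mem_inter.2 ⟨hw, hw'⟩

namespace IsTwoTerminalSP

theorem ne_and_mem (h : IsTwoTerminalSP V E s t) : s ≠ t ∧ s ∈ V ∧ t ∈ V := by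
  induction h with
  | edge s t h => simp [h]
  | series V₁ V₂ E₁ E₂ s m t h₁ h₂ h ih₁ ih₂ =>
    refine ⟨?_, Finset.mem_union_left _ ih₁.2.1, Finset.mem_union_right _ ih₂.2.2⟩
    rintro rfl
    have : s ∈ V₁ ∩ V₂ := Finset.mem_inter.2 ⟨ih₁.2.1, ih₂.2.2⟩
    rw [h, Finset.mem_singleton] at this
    exact ih₁.1 this
  | parallel V₁ V₂ E₁ E₂ s t h₁ h₂ h ih₁ ih₂ =>
    exact ⟨ih₁.1, Finset.mem_union_left _ ih₁.2.1, Finset.mem_union_left _ ih₁.2.2⟩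

theorem inside (h : IsTwoTerminalSP V E s t) : Inside E V := by
  induction h with
  | edge s t h =>
    intro a b hab
    rw [Multiset.mem_singleton, Sym2.eq_iff] at hab
    rcases hab with ⟨rfl, rfl⟩ | ⟨rfl, rfl⟩ <;> simp
  | series V₁ V₂ E₁ E₂ s m t h₁ h₂ h ih₁ ih₂ =>
    intro a b hab
    rcases Multiset.mem_add.1 hab with hab | hab
    · have := ih₁ a b hab; simp [this]
    · have := ih₂ a b hab; simp [this]
  | parallel V₁ V₂ E₁ E₂ s t h₁ h₂ h ih₁ ih₂ =>
    intro a b hab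
    rcases Multiset.mem_add.1 hab with hab | hab
    · have := ih₁ a b hab; simp [this]
    · have := ih₂ a b hab; simp [this]

theorem conn (h : IsTwoTerminalSP V E s t) : Conn E V := by
  induction h with
  | edge s t h =>
    refine ⟨s, by simp, fun w hw => ?_⟩
    rcases Finset.mem_insert.1 hw with rfl | hw
    · exact .refl
    · rw [Finset.mem_singleton.1 hw]
      exact .single (by simp)
  | series V₁ V₂ E₁ E₂ s m t h₁ h₂ h ih₁ ih₂ =>
    have hm₁ := h₁.ne_and_mem.2.2
    have hm₂ := h₂.ne_and_mem.2.1
    refine ⟨m, Finset.mem_union_left _ hm₁, fun w hw => ?_⟩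
    rcases Finset.mem_union.1 hw with hw | hw
    · exact (ih₁.linked hm₁ hw).mono (Multiset.le_add_right _ _) Finset.subset_union_left
    · exact (ih₂.linked hm₂ hw).mono (Multiset.le_add_left _ _) Finset.subset_union_right
  | parallel V₁ V₂ E₁ E₂ s t h₁ h₂ h ih₁ ih₂ =>
    have hm₁ := h₁.ne_and_mem.2.2
    have hm₂ := h₂.ne_and_mem.2.2
    refine ⟨t, Finset.mem_union_left _ hm₁, fun w hw => ?_⟩
    rcases Finset.mem_union.1 hw with hw | hw
    · exact (ih₁.linked hm₁ hw).mono (Multiset.le_add_right _ _) Finset.subset_union_left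
    · exact (ih₂.linked hm₂ hw).mono (Multiset.le_add_left _ _) Finset.subset_union_right

end IsTwoTerminalSP

/-! ### Colour classes of two-terminal graphs -/

/-- Both `C` and the rest are connected, and `C` contains the source but not the sink. -/
def IsCut (E : Multiset (Sym2 α)) (V : Finset α) (s t : α) (C : Finset α) : Prop :=
  s ∈ C ∧ t ∉ C ∧ Conn E C ∧ Conn E (V \ C)

/-- Both `C` and the rest are connected, and `C` contains both terminals. -/
def IsConn (E : Multiset (Sym2 α)) (V : Finset α) (s t : α) (C : Finset α) : Prop :=
  s ∈ C ∧ t ∈ C ∧ Conn E C ∧ Conn E (V \ C)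

/-- The complement of `C` is connected, and `C` has two components, each with one terminal. -/
def IsSplit (E : Multiset (Sym2 α)) (V : Finset α) (s t : α) (C : Finset α) : Prop :=
  s ∈ C ∧ t ∈ C ∧ ¬ Linked E C s t ∧ (∀ u ∈ C, Linked E C s u ∨ Linked E C t u) ∧ Conn E (V \ C)

/-- The assumptions of a series composition at `m`, for the sets in question only. -/
structure SeriesData (E₁ E₂ : Multiset (Sym2 α)) (V₁ V₂ : Finset α) (s m t : α) : Prop where
  inside₁ : Inside E₁ V₁
  inside₂ : Inside E₂ V₂
  conn₁ : Conn E₁ V₁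
  conn₂ : Conn E₂ V₂
  hs : s ∈ V₁
  ht : t ∈ V₂
  hsm : s ≠ m
  hmt : m ≠ t
  inter : V₁ ∩ V₂ = {m}

/-- The assumptions of a parallel composition, for the sets in question only. -/
structure ParallelData (E₁ E₂ : Multiset (Sym2 α)) (V₁ V₂ : Finset α) (s t : α) : Prop where
  inside₁ : Inside E₁ V₁
  inside₂ : Inside E₂ V₂
  conn₁ : Conn E₁ V₁
  conn₂ : Conn E₂ V₂
  hst : s ≠ t
  inter : V₁ ∩ V₂ = {s, t}

theorem sdiff_inter_eq_empty_iff (hV : V₁ ⊆ V) : (V \ C) ∩ V₁ = ∅ ↔ C ∩ V₁ = V₁ := by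
  rw [Finset.inter_eq_right]
  constructor
  · intro h x hx
    by_contra hxC
    exact Finset.notMem_empty x (h ▸ Finset.mem_inter.2 ⟨Finset.mem_sdiff.2 ⟨hV hx, hxC⟩, hx⟩)
  · intro h
    refine Finset.eq_empty_of_forall_notMem fun x hx => ?_
    simp only [Finset.mem_inter, Finset.mem_sdiff] at hx
    exact hx.1.2 (h hx.2)

theorem sdiff_inter_of_subset (hV : V₁ ⊆ V) : (V \ C) ∩ V₁ = V₁ \ (C ∩ V₁) := by
  ext x
  simp only [Finset.mem_inter, Finset.mem_sdiff]
  constructor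
  · rintro ⟨⟨-, h⟩, h'⟩
    exact ⟨h', fun h'' => h h''.1⟩
  · rintro ⟨h, h'⟩
    exact ⟨⟨hV h, fun h'' => h' ⟨h'', h⟩⟩, h⟩

end Connectivity

section Connectivity

variable {α : Type} [DecidableEq α] {E₁ E₂ : Multiset (Sym2 α)} {C V₁ V₂ : Finset α} {s m t : α}

theorem conn_compl_iff_of_mem (h₁ : Inside E₁ V₁) (h₂ : Inside E₂ V₂)
    (hm : ∀ x ∈ V₁, x ∈ V₂ → x ∈ C) : Conn (E₁ + E₂) ((V₁ ∪ V₂) \ C) ↔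
      (Conn E₁ (V₁ \ (C ∩ V₁)) ∧ C ∩ V₂ = V₂) ∨ (C ∩ V₁ = V₁ ∧ Conn E₂ (V₂ \ (C ∩ V₂))) := by
  rw [conn_add_iff_of_disjoint h₁ h₂ Finset.sdiff_subset
    (fun x hx hx₁ hx₂ => (Finset.mem_sdiff.1 hx).2 (hm x hx₁ hx₂)),
    sdiff_inter_eq_empty_iff Finset.subset_union_left,
    sdiff_inter_eq_empty_iff Finset.subset_union_right,
    sdiff_inter_of_subset Finset.subset_union_left,
    sdiff_inter_of_subset Finset.subset_union_right]

theorem conn_compl_iff_of_notMem (h₁ : Inside E₁ V₁) (h₂ : Inside E₂ V₂) (hmC : m ∉ C)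
    (hm₁ : m ∈ V₁) (hm₂ : m ∈ V₂) (hm : ∀ x ∈ V₁, x ∈ V₂ → x ∉ C → x = m) :
    Conn (E₁ + E₂) ((V₁ ∪ V₂) \ C) ↔
      Conn E₁ (V₁ \ (C ∩ V₁)) ∧ Conn E₂ (V₂ \ (C ∩ V₂)) := by
  rw [conn_add_iff h₁ h₂ Finset.sdiff_subset
    (Finset.mem_sdiff.2 ⟨Finset.mem_union_left _ hm₁, hmC⟩) hm₁ hm₂
    (fun x hx hx₁ hx₂ => hm x hx₁ hx₂ (Finset.mem_sdiff.1 hx).2),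
    sdiff_inter_of_subset Finset.subset_union_left,
    sdiff_inter_of_subset Finset.subset_union_right]

namespace SeriesData

variable (D : SeriesData E₁ E₂ V₁ V₂ s m t)

include D

theorem mem_left : m ∈ V₁ := (Finset.mem_inter.1 (D.inter ▸ Finset.mem_singleton_self m)).1

theorem mem_right : m ∈ V₂ := (Finset.mem_inter.1 (D.inter ▸ Finset.mem_singleton_self m)).2

theorem eq_of_mem {x : α} (h₁ : x ∈ V₁) (h₂ : x ∈ V₂) : x = m :=
  Finset.mem_singleton.1 (D.inter ▸ Finset.mem_inter.2 ⟨h₁, h₂⟩)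

theorem compl_of_mem (hmC : m ∈ C) : Conn (E₁ + E₂) ((V₁ ∪ V₂) \ C) ↔
    (Conn E₁ (V₁ \ (C ∩ V₁)) ∧ C ∩ V₂ = V₂) ∨ (C ∩ V₁ = V₁ ∧ Conn E₂ (V₂ \ (C ∩ V₂))) :=
  conn_compl_iff_of_mem D.inside₁ D.inside₂ fun _ h₁ h₂ => by rwa [D.eq_of_mem h₁ h₂]

theorem compl_of_notMem (hmC : m ∉ C) : Conn (E₁ + E₂) ((V₁ ∪ V₂) \ C) ↔
    Conn E₁ (V₁ \ (C ∩ V₁)) ∧ Conn E₂ (V₂ \ (C ∩ V₂)) :=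
  conn_compl_iff_of_notMem D.inside₁ D.inside₂ hmC D.mem_left D.mem_right
    fun _ h₁ h₂ _ => D.eq_of_mem h₁ h₂

theorem conn_of_mem (hC : C ⊆ V₁ ∪ V₂) (hmC : m ∈ C) :
    Conn (E₁ + E₂) C ↔ Conn E₁ (C ∩ V₁) ∧ Conn E₂ (C ∩ V₂) :=
  conn_add_iff D.inside₁ D.inside₂ hC hmC D.mem_left D.mem_right
    fun _ _ h₁ h₂ => D.eq_of_mem h₁ h₂

theorem conn_of_notMem (hC : C ⊆ V₁ ∪ V₂) (hmC : m ∉ C) : Conn (E₁ + E₂) C ↔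
    (Conn E₁ (C ∩ V₁) ∧ C ∩ V₂ = ∅) ∨ (C ∩ V₁ = ∅ ∧ Conn E₂ (C ∩ V₂)) :=
  conn_add_iff_of_disjoint D.inside₁ D.inside₂ hC
    fun _ hx h₁ h₂ => hmC (D.eq_of_mem h₁ h₂ ▸ hx)

theorem mem_facts : (s ∈ C ↔ s ∈ C ∩ V₁) ∧ (t ∈ C ↔ t ∈ C ∩ V₂) ∧ (m ∈ C ↔ m ∈ C ∩ V₁) ∧
    (m ∈ C ↔ m ∈ C ∩ V₂) := by
  simp [D.hs, D.ht, D.mem_left, D.mem_right]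

theorem isCut_iff (hC : C ⊆ V₁ ∪ V₂) : IsCut (E₁ + E₂) (V₁ ∪ V₂) s t C ↔
    (C ∩ V₁ = V₁ ∧ IsCut E₂ V₂ m t (C ∩ V₂)) ∨ (IsCut E₁ V₁ s m (C ∩ V₁) ∧ C ∩ V₂ = ∅) := by
  obtain ⟨hs, ht, hm₁, hm₂⟩ := D.mem_facts (C := C)
  have := D.conn₁; have := D.conn₂; have := D.hs; have := D.ht
  have h₀ : V₂ \ (∅ : Finset α) = V₂ := Finset.sdiff_empty
  have n₁ : s ∉ (∅ : Finset α) := Finset.notMem_empty s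
  have n₂ : t ∉ (∅ : Finset α) := Finset.notMem_empty t
  have n₃ : m ∉ (∅ : Finset α) := Finset.notMem_empty m
  have := D.mem_left
  unfold IsCut
  by_cases hm : m ∈ C
  · rw [D.compl_of_mem hm, D.conn_of_mem hC hm, hs, ht]
    rw [hm₁] at hm
    rw [hm₁] at hm₂
    generalize C ∩ V₁ = C₁ at *
    generalize C ∩ V₂ = C₂ at *
    grind
  · rw [D.compl_of_notMem hm, D.conn_of_notMem hC hm, hs, ht]
    rw [hm₁] at hm
    rw [hm₁] at hm₂
    generalize C ∩ V₁ = C₁ at *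
    generalize C ∩ V₂ = C₂ at *
    grind

theorem isConn_iff (hC : C ⊆ V₁ ∪ V₂) : IsConn (E₁ + E₂) (V₁ ∪ V₂) s t C ↔
    (C ∩ V₁ = V₁ ∧ IsConn E₂ V₂ m t (C ∩ V₂)) ∨ (IsConn E₁ V₁ s m (C ∩ V₁) ∧ C ∩ V₂ = V₂) := by
  obtain ⟨hs, ht, hm₁, hm₂⟩ := D.mem_facts (C := C)
  have := D.conn₁; have := D.conn₂; have := D.hs; have := D.ht
  have n₁ : s ∉ (∅ : Finset α) := Finset.notMem_empty s
  have n₂ : t ∉ (∅ : Finset α) := Finset.notMem_empty t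
  have := D.mem_left; have := D.mem_right
  unfold IsConn
  by_cases hm : m ∈ C
  · rw [D.compl_of_mem hm, D.conn_of_mem hC hm, hs, ht]
    rw [hm₁] at hm
    rw [hm₁] at hm₂
    generalize C ∩ V₁ = C₁ at *
    generalize C ∩ V₂ = C₂ at *
    grind
  · rw [D.compl_of_notMem hm, D.conn_of_notMem hC hm, hs, ht]
    rw [hm₁] at hm
    rw [hm₁] at hm₂
    generalize C ∩ V₁ = C₁ at *
    generalize C ∩ V₂ = C₂ at *
    grind

theorem symm : SeriesData E₂ E₁ V₂ V₁ t m s :=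
  ⟨D.inside₂, D.inside₁, D.conn₂, D.conn₁, D.ht, D.hs, D.hmt.symm, D.hsm.symm,
    Finset.inter_comm V₂ V₁ ▸ D.inter⟩

theorem linked_left {u w : α} (hu : u ∈ C ∩ V₁) (hw : w ∈ V₁) :
    Linked (E₁ + E₂) C u w ↔ Linked E₁ (C ∩ V₁) u w :=
  ⟨fun h => (h.split D.inside₁ D.inside₂ (fun _ _ => D.eq_of_mem) (Finset.mem_inter.1 hu).1
    (Finset.mem_inter.1 hu).2).1 hw, .add_left⟩

theorem linked_right {u w : α} (hu : u ∈ C ∩ V₁) (hw : w ∈ V₂) :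
    Linked (E₁ + E₂) C u w ↔ Linked E₁ (C ∩ V₁) u m ∧ Linked E₂ (C ∩ V₂) m w :=
  ⟨fun h => (h.split D.inside₁ D.inside₂ (fun _ _ => D.eq_of_mem) (Finset.mem_inter.1 hu).1
    (Finset.mem_inter.1 hu).2).2 hw, fun h => h.1.add_left.trans h.2.add_right⟩

theorem not_linked_right {u w : α} (hm : m ∉ C) (hu : u ∈ C ∩ V₁) (hw : w ∈ C ∩ V₂) :
    ¬ Linked (E₁ + E₂) C u w := fun h => by
  have h' := (h.stay D.inside₁ D.inside₂ (fun x hx h₁ h₂ => hm (D.eq_of_mem h₁ h₂ ▸ hx))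
    (Finset.mem_inter.1 hu).2).1
  exact hm (D.eq_of_mem h' (Finset.mem_inter.1 hw).2 ▸ (Finset.mem_inter.1 hw).1)

theorem isSplit_iff (hC : C ⊆ V₁ ∪ V₂) : IsSplit (E₁ + E₂) (V₁ ∪ V₂) s t C ↔
    (C ∩ V₁ = V₁ ∧ IsSplit E₂ V₂ m t (C ∩ V₂)) ∨ (IsSplit E₁ V₁ s m (C ∩ V₁) ∧ C ∩ V₂ = V₂) ∨
      (IsCut E₁ V₁ s m (C ∩ V₁) ∧ IsCut E₂ V₂ t m (C ∩ V₂)) := by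
  obtain ⟨hs, ht, hm₁, hm₂⟩ := D.mem_facts (C := C)
  have k₁ := D.conn₁
  have k₂ := D.conn₂
  have m₁ := D.hs; have m₂ := D.ht
  have m₃ := D.mem_left; have m₄ := D.mem_right
  have c₁ : ∀ u ∈ C, u ∈ C ∩ V₁ ∨ u ∈ C ∩ V₂ := fun u hu => by
    have := hC hu
    simpa [hu] using this
  have c₂ : ∀ u ∈ C ∩ V₁, u ∈ C ∧ u ∈ V₁ := fun u => Finset.mem_inter.1
  have c₃ : ∀ u ∈ C ∩ V₂, u ∈ C ∧ u ∈ V₂ := fun u => Finset.mem_inter.1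
  have l₁ : ∀ u ∈ V₁, ∀ w ∈ V₁, Linked E₁ V₁ u w := fun u hu w hw => k₁.linked hu hw
  have l₂ : ∀ u ∈ V₂, ∀ w ∈ V₂, Linked E₂ V₂ u w := fun u hu w hw => k₂.linked hu hw
  have f₁ : s ∈ C ∩ V₁ → ∀ u ∈ C ∩ V₁,
      (Linked (E₁ + E₂) C s u ↔ Linked E₁ (C ∩ V₁) s u) :=
    fun h u hu => D.linked_left h (c₂ u hu).2
  have f₂ : s ∈ C ∩ V₁ → ∀ u ∈ C ∩ V₂, (Linked (E₁ + E₂) C s u ↔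
      Linked E₁ (C ∩ V₁) s m ∧ Linked E₂ (C ∩ V₂) m u) :=
    fun h u hu => D.linked_right h (c₃ u hu).2
  have f₃ : t ∈ C ∩ V₂ → ∀ u ∈ C ∩ V₂,
      (Linked (E₁ + E₂) C t u ↔ Linked E₂ (C ∩ V₂) t u) :=
    fun h u hu => by rw [add_comm]; exact D.symm.linked_left h (c₃ u hu).2
  have f₄ : t ∈ C ∩ V₂ → ∀ u ∈ C ∩ V₁, (Linked (E₁ + E₂) C t u ↔
      Linked E₂ (C ∩ V₂) t m ∧ Linked E₁ (C ∩ V₁) m u) :=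
    fun h u hu => by rw [add_comm]; exact D.symm.linked_right h (c₂ u hu).2
  have g₁ : m ∉ C → s ∈ C ∩ V₁ → ∀ u ∈ C ∩ V₂, ¬ Linked (E₁ + E₂) C s u :=
    fun hm h u hu => D.not_linked_right hm h hu
  have g₂ : m ∉ C → t ∈ C ∩ V₂ → ∀ u ∈ C ∩ V₁, ¬ Linked (E₁ + E₂) C t u :=
    fun hm h u hu => by rw [add_comm]; exact D.symm.not_linked_right hm h hu
  have s₁ : ∀ u w, Linked E₁ (C ∩ V₁) u w → Linked E₁ (C ∩ V₁) w u := fun u w h => h.symm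
  have s₂ : ∀ u w, Linked E₂ (C ∩ V₂) u w → Linked E₂ (C ∩ V₂) w u := fun u w h => h.symm
  unfold IsSplit IsCut
  by_cases hm : m ∈ C
  · rw [D.compl_of_mem hm, hs, ht]
    rw [hm₁] at hm
    rw [hm₁] at hm₂
    clear hC g₁ g₂
    generalize C ∩ V₁ = C₁ at *
    generalize C ∩ V₂ = C₂ at *
    generalize Linked (E₁ + E₂) C = L at *
    grind
  · rw [D.compl_of_notMem hm, hs, ht]
    have r₁ : s ∈ C ∩ V₁ → (Conn E₁ (C ∩ V₁) ↔ ∀ w ∈ C ∩ V₁, Linked E₁ (C ∩ V₁) s w) := conn_iff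
    have r₂ : t ∈ C ∩ V₂ → (Conn E₂ (C ∩ V₂) ↔ ∀ w ∈ C ∩ V₂, Linked E₂ (C ∩ V₂) t w) := conn_iff
    clear hC f₂ f₄
    generalize C ∩ V₁ = C₁ at *
    generalize C ∩ V₂ = C₂ at *
    generalize Linked (E₁ + E₂) C = L at *
    grind

end SeriesData

namespace ParallelData

variable (D : ParallelData E₁ E₂ V₁ V₂ s t)

include D

theorem eq_or_eq_of_mem {x : α} (h₁ : x ∈ V₁) (h₂ : x ∈ V₂) : x = s ∨ x = t := by
  simpa using (D.inter ▸ Finset.mem_inter.2 ⟨h₁, h₂⟩ : x ∈ ({s, t} : Finset α))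

theorem mem : s ∈ V₁ ∧ s ∈ V₂ ∧ t ∈ V₁ ∧ t ∈ V₂ := by
  have h₁ : s ∈ V₁ ∩ V₂ := D.inter ▸ Finset.mem_insert_self _ _
  have h₂ : t ∈ V₁ ∩ V₂ := D.inter ▸ Finset.mem_insert_of_mem (Finset.mem_singleton_self _)
  simp only [Finset.mem_inter] at h₁ h₂
  exact ⟨h₁.1, h₁.2, h₂.1, h₂.2⟩

theorem mem_facts : (s ∈ C ↔ s ∈ C ∩ V₁) ∧ (t ∈ C ↔ t ∈ C ∩ V₁) ∧ (s ∈ C ↔ s ∈ C ∩ V₂) ∧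
    (t ∈ C ↔ t ∈ C ∩ V₂) := by
  simp [D.mem]

theorem symm : ParallelData E₂ E₁ V₂ V₁ s t :=
  ⟨D.inside₂, D.inside₁, D.conn₂, D.conn₁, D.hst, Finset.inter_comm V₂ V₁ ▸ D.inter⟩

theorem isCut_iff (hC : C ⊆ V₁ ∪ V₂) : IsCut (E₁ + E₂) (V₁ ∪ V₂) s t C ↔
    IsCut E₁ V₁ s t (C ∩ V₁) ∧ IsCut E₂ V₂ s t (C ∩ V₂) := by
  obtain ⟨hs₁, ht₁, hs₂, ht₂⟩ := D.mem_facts (C := C)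
  obtain ⟨ms₁, ms₂, mt₁, mt₂⟩ := D.mem
  unfold IsCut
  by_cases hs : s ∈ C
  · by_cases ht : t ∈ C
    · grind
    · rw [conn_add_iff D.inside₁ D.inside₂ hC hs ms₁ ms₂ (fun x hx h₁ h₂ =>
          (D.eq_or_eq_of_mem h₁ h₂).resolve_right fun h => ht (h ▸ hx)),
        conn_compl_iff_of_notMem D.inside₁ D.inside₂ ht mt₁ mt₂ (fun x h₁ h₂ hx =>
          (D.eq_or_eq_of_mem h₁ h₂).resolve_left fun h => hx (h ▸ hs))]
      grind
  · grind

theorem linked_terminal {u r : α} (h : Linked (E₁ + E₂) C r u) (hr : r = s ∨ r = t)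
    (hu : u ∈ V₁) : Linked E₁ (C ∩ V₁) s u ∨ Linked E₁ (C ∩ V₁) t u := by
  induction h with
  | refl => rcases hr with rfl | rfl <;> [left; right] <;> exact .refl
  | @tail x y hx hxy ih =>
    obtain ⟨he, hxC, hyC⟩ := hxy
    rcases Multiset.mem_add.1 he with he | he
    · obtain ⟨hx₁, hy₁⟩ := D.inside₁ _ _ he
      have h' := (show s(x, y) ∈ E₁ ∧ x ∈ C ∩ V₁ ∧ y ∈ C ∩ V₁ from
        ⟨he, Finset.mem_inter.2 ⟨hxC, hx₁⟩, Finset.mem_inter.2 ⟨hyC, hy₁⟩⟩)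
      exact (ih hx₁).imp (fun l => l.tail h') (fun l => l.tail h')
    · obtain ⟨hx₂, hy₂⟩ := D.inside₂ _ _ he
      rcases D.eq_or_eq_of_mem hu hy₂ with rfl | rfl <;> [left; right] <;> exact .refl

/-- If the second part belongs to `C`, then it connects the terminals, so that `C` is connected as
soon as each of its vertices is linked to one of the terminals inside the first part. -/
theorem conn_of_inter_eq (hC : C ⊆ V₁ ∪ V₂) (h : C ∩ V₂ = V₂) : Conn (E₁ + E₂) C ↔
    ∀ u ∈ C ∩ V₁, Linked E₁ (C ∩ V₁) s u ∨ Linked E₁ (C ∩ V₁) t u := by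
  obtain ⟨ms₁, ms₂, mt₁, mt₂⟩ := D.mem
  have hs : s ∈ C := (Finset.mem_inter.1 (h.symm ▸ ms₂ : s ∈ C ∩ V₂)).1
  have l₂ : ∀ w ∈ V₂, Linked (E₁ + E₂) C s w := fun w hw =>
    Linked.add_right (V₂ := V₂) (by rw [h]; exact D.conn₂.linked ms₂ hw)
  rw [conn_iff hs]
  constructor
  · intro hl u hu
    obtain ⟨hu, hu₁⟩ := Finset.mem_inter.1 hu
    exact D.linked_terminal (hl u hu) (Or.inl rfl) hu₁
  · intro hl w hw
    rcases Finset.mem_union.1 (hC hw) with hw' | hw'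
    · rcases hl w (Finset.mem_inter.2 ⟨hw, hw'⟩) with h' | h'
      · exact h'.add_left
      · exact (l₂ t mt₂).trans h'.add_left
    · exact l₂ w hw'

theorem compl (hs : s ∈ C) (ht : t ∈ C) : Conn (E₁ + E₂) ((V₁ ∪ V₂) \ C) ↔
      (Conn E₁ (V₁ \ (C ∩ V₁)) ∧ C ∩ V₂ = V₂) ∨ (C ∩ V₁ = V₁ ∧ Conn E₂ (V₂ \ (C ∩ V₂))) :=
  conn_compl_iff_of_mem D.inside₁ D.inside₂ fun x h₁ h₂ => by
    rcases D.eq_or_eq_of_mem h₁ h₂ with rfl | rfl <;> assumption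

theorem isConn_iff (hC : C ⊆ V₁ ∪ V₂) : IsConn (E₁ + E₂) (V₁ ∪ V₂) s t C ↔
    ((IsConn E₁ V₁ s t (C ∩ V₁) ∨ IsSplit E₁ V₁ s t (C ∩ V₁)) ∧ C ∩ V₂ = V₂) ∨
      (C ∩ V₁ = V₁ ∧ (IsConn E₂ V₂ s t (C ∩ V₂) ∨ IsSplit E₂ V₂ s t (C ∩ V₂))) := by
  obtain ⟨hs₁, ht₁, hs₂, ht₂⟩ := D.mem_facts (C := C)
  obtain ⟨ms₁, ms₂, mt₁, mt₂⟩ := D.mem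
  have key : ∀ {E : Multiset (Sym2 α)} {C : Finset α}, s ∈ C → t ∈ C →
      ((Conn E C ∨ (¬ Linked E C s t ∧ ∀ u ∈ C, Linked E C s u ∨ Linked E C t u)) ↔
        ∀ u ∈ C, Linked E C s u ∨ Linked E C t u) := by
    intro E C hs ht
    constructor
    · rintro (h | h)
      · exact fun u hu => Or.inl (h.linked hs hu)
      · exact h.2
    · intro h
      by_cases hl : Linked E C s t
      · refine Or.inl ((conn_iff hs).2 fun u hu => ?_)
        rcases h u hu with h' | h'
        · exact h'
        · exact hl.trans h'
      · exact Or.inr ⟨hl, h⟩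
  have k₁ : C ∩ V₂ = V₂ → (Conn (E₁ + E₂) C ↔
    ∀ u ∈ C ∩ V₁, Linked E₁ (C ∩ V₁) s u ∨ Linked E₁ (C ∩ V₁) t u) := D.conn_of_inter_eq hC
  have k₂ : C ∩ V₁ = V₁ → (Conn (E₁ + E₂) C ↔
      ∀ u ∈ C ∩ V₂, Linked E₂ (C ∩ V₂) s u ∨ Linked E₂ (C ∩ V₂) t u) := by
    rw [add_comm]; exact D.symm.conn_of_inter_eq (Finset.union_comm V₁ V₂ ▸ hC)
  have e₁ := key (E := E₁) (C := C ∩ V₁)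
  have e₂ := key (E := E₂) (C := C ∩ V₂)
  unfold IsConn IsSplit
  by_cases hs : s ∈ C
  · by_cases ht : t ∈ C
    · rw [D.compl hs ht]
      clear hC key
      generalize C ∩ V₁ = C₁ at *
      generalize C ∩ V₂ = C₂ at *
      grind
    · clear hC key k₁ k₂ e₁ e₂
      generalize C ∩ V₁ = C₁ at *
      generalize C ∩ V₂ = C₂ at *
      grind
  · clear hC key k₁ k₂ e₁ e₂
    generalize C ∩ V₁ = C₁ at *
    generalize C ∩ V₂ = C₂ at *
    grind

theorem not_isSplit : ¬ IsSplit (E₁ + E₂) (V₁ ∪ V₂) s t C := by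
  rintro ⟨hs, ht, hl, -, h⟩
  obtain ⟨ms₁, ms₂, mt₁, mt₂⟩ := D.mem
  rw [D.compl hs ht] at h
  rcases h with ⟨-, h⟩ | ⟨h, -⟩
  · exact hl (Linked.add_right (V₂ := V₂) (by rw [h]; exact D.conn₂.linked ms₂ mt₂))
  · exact hl (Linked.add_left (V₁ := V₁) (by rw [h]; exact D.conn₁.linked ms₁ mt₁))

end ParallelData
end Connectivity

/-! ### The label of a series-parallel graph -/

section Sums

open scoped Classical in
theorem Multiset.exists_add_of_map_eq_add {β γ : Type*} {f : β → γ} {A B : Multiset γ} :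
    ∀ {D : Multiset β}, D.map f = A + B → ∃ D₁ D₂, D = D₁ + D₂ ∧ D₁.map f = A ∧ D₂.map f = B := by
  induction A using Multiset.induction with
  | empty => exact fun {D} h => ⟨0, D, by simp, by simp, by simpa using h⟩
  | cons a A ih =>
    intro D h
    rw [Multiset.cons_add] at h
    obtain ⟨e, he, rfl, h'⟩ := (Multiset.map_eq_cons _ _ _ _).2 h
    obtain ⟨D₁, D₂, h₁, rfl, rfl⟩ := ih h'
    exact ⟨e ::ₘ D₁, D₂, by rw [Multiset.cons_add, ← h₁, Multiset.cons_erase he], by simp, rfl⟩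

open scoped Classical in
/-- The subsets of `V` with the property `p`. -/
noncomputable def subsetsWith {α : Type} (V : Finset α) (p : Finset α → Prop) : Finset (Finset α) :=
  V.powerset.filter p

theorem mem_subsetsWith {α : Type} {V C : Finset α} {p : Finset α → Prop} :
    C ∈ subsetsWith V p ↔ C ⊆ V ∧ p C := by
  simp [subsetsWith]

variable {α R : Type} [DecidableEq α] [CommSemiring R]

/-- The product of the weights of the vertices in `T`, if those in `C` have the colour `c` and the
other ones the colour `!c`. -/
def colourWt (v : α → Bool → R) (c : Bool) (T C : Finset α) : R :=
  ∏ u ∈ T, v u (if u ∈ C then c else !c)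

/-- The sum of the weights, over the vertices in `T`, of the colourings of `V` whose colour class
of `c` has the property `p`. -/
noncomputable def classSum (v : α → Bool → R) (c : Bool) (V T : Finset α) (p : Finset α → Prop) :
    R :=
  ∑ C ∈ subsetsWith V p, colourWt v c T C

/-- The label of a two-terminal graph, as it is defined by sums over colourings. -/
noncomputable def graphLabel (v : α → Bool → R) (E : Multiset (Sym2 α)) (V : Finset α) (s t : α) :
    SPLabel R where
  mono c := ∏ u ∈ V \ {s, t}, v u c
  cut c := classSum v c V (V \ {s, t}) (IsCut E V s t)
  conn c := classSum v c V (V \ {s, t}) (IsConn E V s t)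
  split c := classSum v c V (V \ {s, t}) (IsSplit E V s t)

variable {v : α → Bool → R} {c : Bool} {V V₁ V₂ T T₁ T₂ C : Finset α} {p p₁ p₂ q : Finset α → Prop}
  {E E₁ E₂ : Multiset (Sym2 α)} {s m t : α}

theorem classSum_congr (h : ∀ C ⊆ V, (p C ↔ q C)) : classSum v c V T p = classSum v c V T q := by
  unfold classSum
  congr 1
  ext C
  simp only [mem_subsetsWith]
  exact and_congr_right fun hC => h C hC

theorem classSum_or (h : ∀ C ⊆ V, p C → ¬ q C) :
    classSum v c V T (fun C => p C ∨ q C) = classSum v c V T p + classSum v c V T q := by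
  unfold classSum
  have : subsetsWith V (fun C => p C ∨ q C) = subsetsWith V p ∪ subsetsWith V q := by
    ext C
    simp only [mem_subsetsWith, Finset.mem_union]
    tauto
  rw [this, Finset.sum_union]
  rw [Finset.disjoint_left]
  intro C
  simp only [mem_subsetsWith]
  exact fun h₁ h₂ => h C h₁.1 h₁.2 h₂.2

theorem classSum_eq_zero (h : ∀ C ⊆ V, ¬ p C) : classSum v c V T p = 0 := by
  unfold classSum
  refine Finset.sum_eq_zero fun C hC => ?_
  rw [mem_subsetsWith] at hC
  exact absurd hC.2 (h C hC.1)

theorem classSum_eq_univ (hT : T ⊆ V) :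
    classSum v c V T (fun C => C = V) = ∏ u ∈ T, v u c := by
  unfold classSum
  rw [Finset.sum_eq_single_of_mem V (by simp [mem_subsetsWith])
    (fun C hC hne => absurd (mem_subsetsWith.1 hC).2 hne)]
  exact Finset.prod_congr rfl fun u hu => by rw [if_pos (hT hu)]

theorem classSum_eq_empty :
    classSum v c V T (fun C => C = ∅) = ∏ u ∈ T, v u (!c) := by
  unfold classSum
  rw [Finset.sum_eq_single_of_mem ∅ (by simp [mem_subsetsWith])
    (fun C hC hne => absurd (mem_subsetsWith.1 hC).2 hne)]
  exact Finset.prod_congr rfl fun u _ => by rw [if_neg (Finset.notMem_empty u)]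

/-- Exchange of the colours. -/
theorem classSum_compl (hT : T ⊆ V) :
    classSum v c V T p = classSum v (!c) V T (fun C => p (V \ C)) := by
  unfold classSum
  refine Finset.sum_nbij' (fun C => V \ C) (fun C => V \ C) ?_ ?_ ?_ ?_ ?_
  · intro C hC
    simp only [mem_subsetsWith] at hC ⊢
    rw [Finset.sdiff_sdiff_eq_self hC.1]
    exact ⟨Finset.sdiff_subset, hC.2⟩
  · intro C hC
    simp only [mem_subsetsWith] at hC ⊢
    exact ⟨Finset.sdiff_subset, hC.2⟩
  · intro C hC
    exact Finset.sdiff_sdiff_eq_self (mem_subsetsWith.1 hC).1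
  · intro C hC
    exact Finset.sdiff_sdiff_eq_self (mem_subsetsWith.1 hC).1
  · intro C hC
    refine Finset.prod_congr rfl fun u hu => ?_
    by_cases h : u ∈ C <;> simp [h, hT hu]

/-- A sum over colourings of two parts that agree on the common vertices is a product. -/
theorem classSum_glue (k : R) (hp : ∀ C ⊆ V₁ ∪ V₂, (p C ↔ p₁ (C ∩ V₁) ∧ p₂ (C ∩ V₂)))
    (hc : ∀ C₁ ⊆ V₁, ∀ C₂ ⊆ V₂, p₁ C₁ → p₂ C₂ → ∀ x ∈ V₁, x ∈ V₂ → (x ∈ C₁ ↔ x ∈ C₂))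
    (hg : ∀ C ⊆ V₁ ∪ V₂, p C → colourWt v c T C =
      k * (colourWt v c T₁ (C ∩ V₁) * colourWt v c T₂ (C ∩ V₂))) :
    classSum v c (V₁ ∪ V₂) T p = k * (classSum v c V₁ T₁ p₁ * classSum v c V₂ T₂ p₂) := by
  unfold classSum
  rw [Finset.sum_mul_sum, ← Finset.sum_product', Finset.mul_sum]
  have hu : ∀ C₁ ⊆ V₁, ∀ C₂ ⊆ V₂, p₁ C₁ → p₂ C₂ →
      (C₁ ∪ C₂) ∩ V₁ = C₁ ∧ (C₁ ∪ C₂) ∩ V₂ = C₂ := by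
    intro C₁ h₁ C₂ h₂ hp₁ hp₂
    have := hc C₁ h₁ C₂ h₂ hp₁ hp₂
    constructor <;> ext x <;> simp only [Finset.mem_inter, Finset.mem_union] <;> grind
  have hi : ∀ C ⊆ V₁ ∪ V₂, C ∩ V₁ ∪ C ∩ V₂ = C := fun C hC => by
    rw [← Finset.inter_union_distrib_left, Finset.inter_eq_left.2 hC]
  refine Finset.sum_nbij' (fun C => (C ∩ V₁, C ∩ V₂)) (fun D => D.1 ∪ D.2) ?_ ?_ ?_ ?_ ?_
  · intro C hC
    simp only [mem_subsetsWith, Finset.mem_product] at hC ⊢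
    have := (hp C hC.1).1 hC.2
    exact ⟨⟨Finset.inter_subset_right, this.1⟩, Finset.inter_subset_right, this.2⟩
  · rintro ⟨C₁, C₂⟩ hC
    simp only [mem_subsetsWith, Finset.mem_product] at hC ⊢
    obtain ⟨⟨h₁, hp₁⟩, h₂, hp₂⟩ := hC
    have hs := Finset.union_subset_union h₁ h₂
    rw [hp _ hs, (hu C₁ h₁ C₂ h₂ hp₁ hp₂).1, (hu C₁ h₁ C₂ h₂ hp₁ hp₂).2]
    exact ⟨hs, hp₁, hp₂⟩
  · intro C hC
    exact hi C (mem_subsetsWith.1 hC).1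
  · rintro ⟨C₁, C₂⟩ hC
    simp only [mem_subsetsWith, Finset.mem_product] at hC ⊢
    obtain ⟨⟨h₁, hp₁⟩, h₂, hp₂⟩ := hC
    rw [(hu C₁ h₁ C₂ h₂ hp₁ hp₂).1, (hu C₁ h₁ C₂ h₂ hp₁ hp₂).2]
  · intro C hC
    simp only [mem_subsetsWith] at hC
    exact hg C hC.1 hC.2

theorem colourWt_inter (h : T ⊆ V) : colourWt v c T (C ∩ V) = colourWt v c T C :=
  Finset.prod_congr rfl fun u hu => by simp [h hu]

theorem SeriesData.prod_inner (D : SeriesData E₁ E₂ V₁ V₂ s m t) (f : α → R) :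
    ∏ u ∈ (V₁ ∪ V₂) \ {s, t}, f u =
      f m * ((∏ u ∈ V₁ \ {s, m}, f u) * ∏ u ∈ V₂ \ {m, t}, f u) := by
  have h₁ := D.mem_left; have h₂ := D.mem_right
  have h₃ := D.hs; have h₄ := D.ht; have h₅ := D.hsm; have h₆ := D.hmt
  have h₇ : ∀ x, x ∈ V₁ → x ∈ V₂ → x = m := fun x => D.eq_of_mem
  rw [← Finset.prod_union, ← Finset.prod_insert (s := _ ∪ _) (a := m)]
  · congr 1
    ext x
    simp only [Finset.mem_insert, Finset.mem_union, Finset.mem_sdiff, Finset.mem_singleton]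
    grind
  · simp
  · rw [Finset.disjoint_left]
    intro x
    simp only [Finset.mem_insert, Finset.mem_sdiff, Finset.mem_singleton]
    grind

theorem SeriesData.colourWt_inner (D : SeriesData E₁ E₂ V₁ V₂ s m t) :
    colourWt v c ((V₁ ∪ V₂) \ {s, t}) C = v m (if m ∈ C then c else !c) *
      (colourWt v c (V₁ \ {s, m}) (C ∩ V₁) * colourWt v c (V₂ \ {m, t}) (C ∩ V₂)) := by
  rw [colourWt_inter Finset.sdiff_subset, colourWt_inter Finset.sdiff_subset]
  exact D.prod_inner _

theorem SeriesData.graphLabel_eq (D : SeriesData E₁ E₂ V₁ V₂ s m t) :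
    graphLabel v (E₁ + E₂) (V₁ ∪ V₂) s t =
      ser (v m) (graphLabel v E₁ V₁ s m) (graphLabel v E₂ V₂ m t) := by
  have hm : ∀ x ∈ V₁, x ∈ V₂ → x = m := fun x => D.eq_of_mem
  have hm₁ := D.mem_left
  have hm₂ := D.mem_right
  ext c
  · simp only [graphLabel, ser]
    rw [D.prod_inner]
    ring
  · simp only [graphLabel, ser]
    rw [classSum_congr fun C hC => D.isCut_iff hC, classSum_or,
      classSum_glue (v m c) (p₁ := fun C => C = V₁) (p₂ := IsCut E₂ V₂ m t)
        (T₁ := V₁ \ {s, m}) (T₂ := V₂ \ {m, t}) (fun C hC => Iff.rfl),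
      classSum_glue (v m (!c)) (p₁ := IsCut E₁ V₁ s m) (p₂ := fun C => C = ∅)
        (T₁ := V₁ \ {s, m}) (T₂ := V₂ \ {m, t}) (fun C hC => Iff.rfl),
      classSum_eq_univ Finset.sdiff_subset, classSum_eq_empty]
    · ring
    · rintro C₁ - C₂ - h₁ rfl x hx₁ hx₂
      obtain rfl := hm x hx₁ hx₂
      simp [h₁.2.1]
    · rintro C - ⟨h, -⟩
      have : m ∉ C := fun h' => h.2.1 (Finset.mem_inter.2 ⟨h', hm₁⟩)
      rw [D.colourWt_inner, if_neg this]
    · rintro C₁ - C₂ - rfl h₁ x hx₁ hx₂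
      obtain rfl := hm x hx₁ hx₂
      simp [h₁.1, hx₁]
    · rintro C - ⟨-, h⟩
      rw [D.colourWt_inner, if_pos (Finset.mem_inter.1 h.1).1]
    · rintro C - ⟨-, h⟩ ⟨-, h'⟩
      have := h.1
      rw [h'] at this
      simp at this
  · simp only [graphLabel, ser]
    rw [classSum_congr fun C hC => D.isConn_iff hC, classSum_or,
      classSum_glue (v m c) (p₁ := fun C => C = V₁) (p₂ := IsConn E₂ V₂ m t)
        (T₁ := V₁ \ {s, m}) (T₂ := V₂ \ {m, t}) (fun C hC => Iff.rfl),
      classSum_glue (v m c) (p₁ := IsConn E₁ V₁ s m) (p₂ := fun C => C = V₂)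
        (T₁ := V₁ \ {s, m}) (T₂ := V₂ \ {m, t}) (fun C hC => Iff.rfl),
      classSum_eq_univ Finset.sdiff_subset, classSum_eq_univ Finset.sdiff_subset]
    · ring
    · rintro C₁ - C₂ - h₁ rfl x hx₁ hx₂
      obtain rfl := hm x hx₁ hx₂
      simp [h₁.2.1, hx₂]
    · rintro C - ⟨h, -⟩
      rw [D.colourWt_inner, if_pos (Finset.mem_inter.1 h.2.1).1]
    · rintro C₁ - C₂ - rfl h₁ x hx₁ hx₂
      obtain rfl := hm x hx₁ hx₂
      simp [h₁.1, hx₁]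
    · rintro C - ⟨-, h⟩
      rw [D.colourWt_inner, if_pos (Finset.mem_inter.1 h.1).1]
    · rintro C - ⟨h, -⟩ ⟨h', -⟩
      have := h'.2.2.2
      rw [h, Finset.sdiff_self] at this
      exact not_conn_empty this
  · simp only [graphLabel, ser]
    rw [classSum_congr fun C hC => D.isSplit_iff hC, classSum_or, classSum_or,
      classSum_glue (v m c) (p₁ := fun C => C = V₁) (p₂ := IsSplit E₂ V₂ m t)
        (T₁ := V₁ \ {s, m}) (T₂ := V₂ \ {m, t}) (fun C hC => Iff.rfl),
      classSum_glue (v m c) (p₁ := IsSplit E₁ V₁ s m) (p₂ := fun C => C = V₂)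
        (T₁ := V₁ \ {s, m}) (T₂ := V₂ \ {m, t}) (fun C hC => Iff.rfl),
      classSum_glue (v m (!c)) (p₁ := IsCut E₁ V₁ s m) (p₂ := IsCut E₂ V₂ t m)
        (T₁ := V₁ \ {s, m}) (T₂ := V₂ \ {m, t}) (fun C hC => Iff.rfl),
      classSum_eq_univ Finset.sdiff_subset, classSum_eq_univ Finset.sdiff_subset,
      classSum_compl (p := IsCut E₂ V₂ t m) Finset.sdiff_subset,
      classSum_congr (p := fun C => IsCut E₂ V₂ t m (V₂ \ C)) (q := IsCut E₂ V₂ m t)]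
    · ring
    · intro C hC
      unfold IsCut
      rw [Finset.sdiff_sdiff_eq_self hC]
      simp only [Finset.mem_sdiff, D.ht, hm₂]
      tauto
    · rintro C₁ - C₂ - h₁ h₂ x hx₁ hx₂
      obtain rfl := hm x hx₁ hx₂
      simp [h₁.2.1, h₂.2.1]
    · rintro C - ⟨h, -⟩
      have : m ∉ C := fun h' => h.2.1 (Finset.mem_inter.2 ⟨h', hm₁⟩)
      rw [D.colourWt_inner, if_neg this]
    · rintro C₁ - C₂ - h₁ rfl x hx₁ hx₂
      obtain rfl := hm x hx₁ hx₂
      simp [h₁.2.1, hx₂]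
    · rintro C - ⟨h, -⟩
      rw [D.colourWt_inner, if_pos (Finset.mem_inter.1 h.2.1).1]
    · rintro C₁ - C₂ - rfl h₁ x hx₁ hx₂
      obtain rfl := hm x hx₁ hx₂
      simp [h₁.1, hx₁]
    · rintro C - ⟨-, h⟩
      rw [D.colourWt_inner, if_pos (Finset.mem_inter.1 h.1).1]
    · rintro C - ⟨h, -⟩ ⟨h', -⟩
      exact h'.2.1 h.2.1
    · rintro C - ⟨h, h''⟩ (⟨h', -⟩ | ⟨h', -⟩)
      · have := h'.2.2.2.2
        rw [h, Finset.sdiff_self] at this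
        exact not_conn_empty this
      · exact h'.2.1 (h.symm ▸ hm₁)

theorem ParallelData.prod_inner (D : ParallelData E₁ E₂ V₁ V₂ s t) (f : α → R) :
    ∏ u ∈ (V₁ ∪ V₂) \ {s, t}, f u =
      (∏ u ∈ V₁ \ {s, t}, f u) * ∏ u ∈ V₂ \ {s, t}, f u := by
  have h₇ : ∀ x, x ∈ V₁ → x ∈ V₂ → x = s ∨ x = t := fun x => D.eq_or_eq_of_mem
  rw [← Finset.prod_union, Finset.union_sdiff_distrib]
  rw [Finset.disjoint_left]
  intro x
  simp only [Finset.mem_insert, Finset.mem_sdiff, Finset.mem_singleton]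
  grind

theorem ParallelData.colourWt_inner (D : ParallelData E₁ E₂ V₁ V₂ s t) :
    colourWt v c ((V₁ ∪ V₂) \ {s, t}) C = 1 *
      (colourWt v c (V₁ \ {s, t}) (C ∩ V₁) * colourWt v c (V₂ \ {s, t}) (C ∩ V₂)) := by
  rw [colourWt_inter Finset.sdiff_subset, colourWt_inter Finset.sdiff_subset, one_mul]
  exact D.prod_inner _

theorem ParallelData.graphLabel_eq (D : ParallelData E₁ E₂ V₁ V₂ s t) :
    graphLabel v (E₁ + E₂) (V₁ ∪ V₂) s t =
      par (graphLabel v E₁ V₁ s t) (graphLabel v E₂ V₂ s t) := by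
  have hm : ∀ x ∈ V₁, x ∈ V₂ → x = s ∨ x = t := fun x => D.eq_or_eq_of_mem
  have hor : ∀ (E : Multiset (Sym2 α)) (V : Finset α), ∀ C ⊆ V, IsConn E V s t C →
      ¬ IsSplit E V s t C := fun E V C _ h h' => h'.2.2.1 (h.2.2.1.linked h.1 h.2.1)
  ext c
  · exact D.prod_inner _
  · simp only [graphLabel, par]
    rw [classSum_glue 1 (fun C hC => D.isCut_iff hC), one_mul]
    · rintro C₁ - C₂ - h₁ h₂ x hx₁ hx₂
      rcases hm x hx₁ hx₂ with rfl | rfl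
      · simp [h₁.1, h₂.1]
      · simp [h₁.2.1, h₂.2.1]
    · exact fun C _ _ => D.colourWt_inner
  · simp only [graphLabel, par]
    rw [classSum_congr fun C hC => D.isConn_iff hC, classSum_or,
      classSum_glue 1 (p₁ := fun C => IsConn E₁ V₁ s t C ∨ IsSplit E₁ V₁ s t C)
        (p₂ := fun C => C = V₂) (T₁ := V₁ \ {s, t}) (T₂ := V₂ \ {s, t}) (fun C hC => Iff.rfl),
      classSum_glue 1 (p₂ := fun C => IsConn E₂ V₂ s t C ∨ IsSplit E₂ V₂ s t C)
        (p₁ := fun C => C = V₁) (T₁ := V₁ \ {s, t}) (T₂ := V₂ \ {s, t}) (fun C hC => Iff.rfl),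
      classSum_eq_univ Finset.sdiff_subset, classSum_eq_univ Finset.sdiff_subset,
      classSum_or (hor E₁ V₁), classSum_or (hor E₂ V₂), one_mul, one_mul]
    · rintro C₁ - C₂ - rfl h₁ x hx₁ hx₂
      rcases hm x hx₁ hx₂ with rfl | rfl <;> rcases h₁ with h₁ | h₁ <;> simp [h₁.1, h₁.2.1, hx₁]
    · exact fun C _ _ => D.colourWt_inner
    · rintro C₁ - C₂ - h₁ rfl x hx₁ hx₂
      rcases hm x hx₁ hx₂ with rfl | rfl <;> rcases h₁ with h₁ | h₁ <;> simp [h₁.1, h₁.2.1, hx₂]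
    · exact fun C _ _ => D.colourWt_inner
    · rintro C - ⟨h | h, -⟩ ⟨h', -⟩
      · have := h.2.2.2
        rw [h', Finset.sdiff_self] at this
        exact not_conn_empty this
      · have := h.2.2.2.2
        rw [h', Finset.sdiff_self] at this
        exact not_conn_empty this
  · exact classSum_eq_zero fun C _ => D.not_isSplit

theorem graphLabel_edge (h : s ≠ t) : graphLabel v {s(s, t)} {s, t} s t = unit := by
  have h₀ : ({s, t} : Finset α) \ {s, t} = ∅ := Finset.sdiff_self _
  have hfull : ∀ C ⊆ ({s, t} : Finset α), s ∈ C → t ∈ C → {s, t} \ C = ∅ := by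
    intro C hC hs ht
    rw [Finset.sdiff_eq_empty_iff_subset]
    exact Finset.insert_subset hs (Finset.singleton_subset_iff.2 ht)
  ext c
  · simp [graphLabel, unit]
  · simp only [graphLabel, unit, classSum]
    rw [h₀, Finset.sum_eq_single_of_mem {s}]
    · simp [colourWt]
    · simp only [mem_subsetsWith, Finset.singleton_subset_iff,
        Finset.mem_insert_self, true_and, IsCut, Finset.mem_singleton]
      have : ({s, t} : Finset α) \ {s} = {t} := by
        ext x; simp only [Finset.mem_sdiff, Finset.mem_insert, Finset.mem_singleton]; grind
      rw [this]
      refine ⟨h.symm, ⟨s, by simp, fun u hu => ?_⟩, ⟨t, by simp, fun u hu => ?_⟩⟩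
      · rw [Finset.mem_singleton.1 hu]; exact .refl
      · rw [Finset.mem_singleton.1 hu]; exact .refl
    · intro C hC hne
      obtain ⟨hC, hs, ht, -⟩ := mem_subsetsWith.1 hC
      refine absurd ?_ hne
      ext x
      constructor
      · intro hx
        have := hC hx
        simp only [Finset.mem_insert, Finset.mem_singleton] at this ⊢
        rcases this with rfl | rfl
        · rfl
        · exact absurd hx ht
      · intro hx
        rwa [Finset.mem_singleton.1 hx]
  · change classSum v c {s, t} ({s, t} \ {s, t}) _ = 0
    refine classSum_eq_zero fun C hC h' => ?_
    have := h'.2.2.2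
    rw [hfull C hC h'.1 h'.2.1] at this
    exact not_conn_empty this
  · change classSum v c {s, t} ({s, t} \ {s, t}) _ = 0
    refine classSum_eq_zero fun C hC h' => ?_
    have := h'.2.2.2.2
    rw [hfull C hC h'.1 h'.2.1] at this
    exact not_conn_empty this

/-- A series-parallel graph with unit labels on its edges has the label that is defined by sums
over colourings. -/
theorem IsTwoTerminalSP.labelledSP (h : IsTwoTerminalSP V E s t)
    {F : Multiset (α × α × SPLabel R)} (hF : F.map LabelledSP.ends = E)
    (hu : ∀ e ∈ F, e.2.2 = unit) : LabelledSP v V F s t (graphLabel v E V s t) := by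
  induction h generalizing F with
  | edge s t h =>
    rw [graphLabel_edge h]
    obtain ⟨⟨x, y, a⟩, rfl, he⟩ := Multiset.map_eq_singleton.1 hF
    obtain rfl : a = unit := hu _ (Multiset.mem_singleton_self _)
    rcases Sym2.eq_iff.1 he with ⟨h₁, h₂⟩ | ⟨h₁, h₂⟩ <;> dsimp only at h₁ h₂ <;> subst h₁ h₂
    · exact .edge _ _ _ h
    · exact .flip _ _ _ h
  | series V₁ V₂ E₁ E₂ s m t h₁ h₂ h ih₁ ih₂ =>
    obtain ⟨F₁, F₂, rfl, hF₁, hF₂⟩ := Multiset.exists_add_of_map_eq_add hF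
    have D : SeriesData E₁ E₂ V₁ V₂ s m t := ⟨h₁.inside, h₂.inside, h₁.conn, h₂.conn,
      h₁.ne_and_mem.2.1, h₂.ne_and_mem.2.2, h₁.ne_and_mem.1, h₂.ne_and_mem.1, h⟩
    rw [D.graphLabel_eq]
    exact .series _ _ _ _ _ _ _ _ _
      (ih₁ hF₁ fun e he => hu e (Multiset.mem_add.2 (Or.inl he)))
      (ih₂ hF₂ fun e he => hu e (Multiset.mem_add.2 (Or.inr he))) h
  | parallel V₁ V₂ E₁ E₂ s t h₁ h₂ h ih₁ ih₂ =>
    obtain ⟨F₁, F₂, rfl, hF₁, hF₂⟩ := Multiset.exists_add_of_map_eq_add hF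
    have D : ParallelData E₁ E₂ V₁ V₂ s t := ⟨h₁.inside, h₂.inside, h₁.conn, h₂.conn,
      h₁.ne_and_mem.1, h⟩
    rw [D.graphLabel_eq]
    exact .parallel _ _ _ _ _ _ _ _
      (ih₁ hF₁ fun e he => hu e (Multiset.mem_add.2 (Or.inl he)))
      (ih₂ hF₂ fun e he => hu e (Multiset.mem_add.2 (Or.inr he))) h

/-- Both `A` and the rest of `V` are nonempty and connected. -/
def IsBond (E : Multiset (Sym2 α)) (V A : Finset α) : Prop := Conn E A ∧ Conn E (V \ A)

/-- The label of a graph determines the sum over all its connected 2-partitions. -/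
theorem total_graphLabel (hs : s ∈ V) (ht : t ∈ V) (hst : s ≠ t) :
    total (v s) (v t) (graphLabel v E V s t) = classSum v true V V (IsBond E V) := by
  have hT : V \ {s, t} ⊆ V := Finset.sdiff_subset
  have hVe : ∀ C, colourWt v true V C = v s (if s ∈ C then true else false) *
      (v t (if t ∈ C then true else false) * colourWt v true (V \ {s, t}) C) := by
    intro C
    unfold colourWt
    have : V = insert s (insert t (V \ {s, t})) := by
      ext x; simp only [Finset.mem_sdiff, Finset.mem_insert, Finset.mem_singleton]; grind
    nth_rw 1 [this]
    rw [Finset.prod_insert (by simp [hst]), Finset.prod_insert (by simp)]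
    rfl
  have hsum : ∀ (p : Finset α → Prop) (x y : Bool), (∀ C ⊆ V, p C →
      (if s ∈ C then true else false) = x ∧ (if t ∈ C then true else false) = y) →
      classSum v true V V p = v s x * (v t y * classSum v true V (V \ {s, t}) p) := by
    intro p x y h
    unfold classSum
    rw [Finset.mul_sum, Finset.mul_sum]
    refine Finset.sum_congr rfl fun C hC => ?_
    obtain ⟨hC, hp⟩ := mem_subsetsWith.1 hC
    rw [hVe, (h C hC hp).1, (h C hC hp).2]
  have hcases : ∀ C ⊆ V, (IsBond E V C ↔ IsConn E V s t C ∨ IsCut E V s t C ∨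
      IsConn E V s t (V \ C) ∨ IsCut E V s t (V \ C)) := by
    intro C hC
    unfold IsBond IsConn IsCut
    rw [Finset.sdiff_sdiff_eq_self hC]
    simp only [Finset.mem_sdiff, hs, ht, true_and]
    tauto
  rw [classSum_congr hcases, classSum_or, classSum_or, classSum_or,
    hsum (IsConn E V s t) true true, hsum (IsCut E V s t) true false,
    hsum (fun C => IsConn E V s t (V \ C)) false false,
    hsum (fun C => IsCut E V s t (V \ C)) false true]
  · simp only [total, contract, graphLabel, Bool.not_true, Bool.not_false]
    rw [classSum_compl (c := false) (p := IsConn E V s t) hT,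
      classSum_compl (c := false) (p := IsCut E V s t) hT, Bool.not_false]
    ring
  · rintro C hC ⟨h₁, h₂, -⟩
    simp only [Finset.mem_sdiff, hs, ht, true_and, not_not] at h₁ h₂
    simp [h₁, h₂]
  · rintro C hC ⟨h₁, h₂, -⟩
    simp only [Finset.mem_sdiff, hs, ht, true_and] at h₁ h₂
    simp [h₁, h₂]
  · rintro C hC ⟨h₁, h₂, -⟩
    simp [h₁, h₂]
  · rintro C hC ⟨h₁, h₂, -⟩
    simp [h₁, h₂]
  · rintro C hC ⟨h₁, h₂, -⟩ ⟨h₃, h₄, -⟩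
    exact h₄ h₂
  · rintro C hC ⟨h₁, h₂, -⟩ (⟨h₃, h₄, -⟩ | ⟨h₃, h₄, -⟩)
    · exact (Finset.mem_sdiff.1 h₃).2 h₁
    · exact (Finset.mem_sdiff.1 h₃).2 h₁
  · rintro C hC ⟨h₁, h₂, -⟩ (⟨h₃, h₄, -⟩ | ⟨h₃, h₄, -⟩ | ⟨h₃, h₄, -⟩)
    · exact h₄ h₂
    · exact (Finset.mem_sdiff.1 h₃).2 h₁
    · exact (Finset.mem_sdiff.1 h₃).2 h₁

end Sums

/-! ### Elimination of vertices of degree two -/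

section Elimination

variable {α R : Type} [DecidableEq α] [CommSemiring R] {v : α → Bool → R} {V : Finset α}
  {F E : Multiset (α × α × SPLabel R)} {s t x y z : α} {l : SPLabel R}

open LabelledSP (ends)

/-- Parallel edges without label information may be removed. -/
theorem LabelledSP.exists_simple (h : LabelledSP v V F s t l) (hu : ∀ e ∈ F, e.2.2 = unit) :
    ∃ E, LabelledSP v V E s t l ∧ (∀ e ∈ E, e.2.2 = unit) ∧ (E.map ends).Nodup ∧
      ∀ k, k ∈ E.map ends ↔ k ∈ F.map ends := by
  induction F using Multiset.strongInductionOn with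
  | ih F ih =>
  by_cases hn : (F.map ends).Nodup
  · exact ⟨F, h, hu, hn, fun _ => Iff.rfl⟩
  obtain ⟨k, hk⟩ : ∃ k, k ::ₘ k ::ₘ 0 ≤ F.map ends := by
    by_contra hk
    exact hn (Multiset.nodup_iff_le.2 fun a ha => hk ⟨a, ha⟩)
  obtain ⟨K, hK⟩ := Multiset.le_iff_exists_add.1 hk
  rw [Multiset.cons_add, Multiset.cons_add, zero_add] at hK
  classical
  obtain ⟨⟨x, y, a⟩, he, rfl, h₁⟩ := (Multiset.map_eq_cons _ _ _ _).2 hK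
  obtain ⟨F₁, rfl⟩ := Multiset.exists_cons_of_mem he
  rw [Multiset.erase_cons_head] at h₁
  obtain ⟨⟨x', y', b⟩, hf, hk', h₂⟩ := (Multiset.map_eq_cons _ _ _ _).2 h₁
  obtain ⟨F₂, rfl⟩ := Multiset.exists_cons_of_mem hf
  obtain rfl : a = unit := hu _ (Multiset.mem_cons_self _ _)
  obtain rfl : b = unit := hu _ (Multiset.mem_cons_of_mem (Multiset.mem_cons_self _ _))
  have h' : LabelledSP v V ((x, y, unit) ::ₘ (x, y, unit) ::ₘ F₂) s t l := by
    rcases Sym2.eq_iff.1 hk' with ⟨h₁, h₂⟩ | ⟨h₁, h₂⟩ <;> dsimp only at h₁ h₂ <;> subst h₁ h₂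
    · exact h
    · rw [Multiset.cons_swap] at h ⊢
      have := h.flip_edge
      rwa [rev_unit] at this
  have h'' := h'.merge_parallel
  rw [par_unit_unit] at h''
  have hlt : (x, y, (unit : SPLabel R)) ::ₘ F₂ < (x, y, unit) ::ₘ (x', y', unit) ::ₘ F₂ := by
    rw [Multiset.cons_lt_cons_iff]
    exact Multiset.lt_cons_self _ _
  obtain ⟨E, hE, hE₁, hE₂, hE₃⟩ := ih _ hlt h'' fun e he => hu e (by
    rcases Multiset.mem_cons.1 he with rfl | he
    · exact Multiset.mem_cons_self _ _
    · exact Multiset.mem_cons_of_mem (Multiset.mem_cons_of_mem he))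
  refine ⟨E, hE, hE₁, hE₂, fun k => ?_⟩
  rw [hE₃, Multiset.map_cons, Multiset.map_cons, Multiset.map_cons, hk']
  simp

/-- The state `adj`, `lab` of the elimination describes the labelled edges `E`: the graph is simple,
and both orientations of every edge are recorded. -/
structure Describes (adj : α → α → Prop) (lab : α → α → SPLabel R)
    (E : Multiset (α × α × SPLabel R)) : Prop where
  nodup : (E.map ends).Nodup
  of_mem : ∀ e ∈ E, adj e.1 e.2.1 ∧ e.2.2 = lab e.1 e.2.1
  mem_of_adj : ∀ u w, adj u w → s(u, w) ∈ E.map ends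
  symm : ∀ u w, adj u w → adj w u
  rev : ∀ u w, lab w u = (lab u w).rev

/-- The state `adj`, `lab` of the elimination describes a series-parallel graph on `V` for which the
sum over all connected 2-partitions is `Z`. -/
def Represents (v : α → Bool → R) (adj : α → α → Prop) (lab : α → α → SPLabel R) (V : Finset α)
    (Z : R) : Prop :=
  ∃ E s t l, LabelledSP v V E s t l ∧ total (v s) (v t) l = Z ∧ Describes adj lab E

variable {adj : α → α → Prop} {lab : α → α → SPLabel R} {Z : R}

omit [DecidableEq α] [CommSemiring R] in
theorem Describes.orient {e : α × α × SPLabel R} (h : Describes adj lab (e ::ₘ F))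
    (he : ends e = s(x, y)) : Describes adj lab ((x, y, lab x y) ::ₘ F) := by
  obtain ⟨ha, -⟩ := h.of_mem e (Multiset.mem_cons_self _ _)
  have hm : (((x, y, lab x y) ::ₘ F).map ends) = ((e ::ₘ F).map ends) := by
    rw [Multiset.map_cons, Multiset.map_cons, he]
    rfl
  refine ⟨hm ▸ h.nodup, fun f hf => ?_, fun u w huw => hm ▸ h.mem_of_adj u w huw, h.symm, h.rev⟩
  rcases Multiset.mem_cons.1 hf with rfl | hf
  · refine ⟨?_, rfl⟩
    rcases Sym2.eq_iff.1 he with ⟨h₁, h₂⟩ | ⟨h₁, h₂⟩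
    · rw [h₁, h₂] at ha; exact ha
    · rw [h₁, h₂] at ha; exact h.symm _ _ ha
  · exact h.of_mem f (Multiset.mem_cons_of_mem hf)

theorem LabelledSP.orient {e : α × α × SPLabel R} (hl : LabelledSP v V (e ::ₘ F) s t l)
    (hlab : e.2.2 = lab e.1 e.2.1) (hr : ∀ u w, lab w u = (lab u w).rev)
    (he : ends e = s(x, y)) : LabelledSP v V ((x, y, lab x y) ::ₘ F) s t l := by
  obtain ⟨p, q, a⟩ := e
  dsimp only at hlab
  subst hlab
  rcases Sym2.eq_iff.1 he with ⟨h₁, h₂⟩ | ⟨h₁, h₂⟩ <;> dsimp only at h₁ h₂ <;> subst h₁ h₂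
  · exact hl
  · have := hl.flip_edge
    rwa [← hr] at this

/-- A bypass `b` of an edge with the label `a`; if `e` is false then there is no such edge. -/
def bypass (e : Prop) [Decidable e] (a b : SPLabel R) : SPLabel R :=
  if e then par a b else b

/-- The elimination of the vertex `z` with the two neighbours `x` and `y`. -/
theorem Represents.eliminate [DecidableRel adj] (h : Represents v adj lab V Z) (hxy : x ≠ y)
    (hz : ∀ u, adj z u ↔ u = x ∨ u = y) {adj' : α → α → Prop} {lab' : α → α → SPLabel R}
    (hadj : ∀ u w, adj' u w ↔
      (adj u w ∧ u ≠ z ∧ w ≠ z) ∨ (u = x ∧ w = y) ∨ (u = y ∧ w = x))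
    (hlab : lab' x y = bypass (adj x y) (lab x y) (ser (v z) (lab x z) (lab z y)))
    (hlab' : lab' y x = (lab' x y).rev)
    (hlab'' : ∀ u w, ¬ (u = x ∧ w = y) → ¬ (u = y ∧ w = x) → lab' u w = lab u w) :
    z ∈ V ∧ Represents v adj' lab' (V.erase z) Z := by
  obtain ⟨E, s, t, l, hl, hZ, hD⟩ := h
  have hzx := (hz x).2 (Or.inl rfl)
  have hzy := (hz y).2 (Or.inr rfl)
  obtain ⟨e₁, he₁, hk₁⟩ := Multiset.mem_map.1 (hD.mem_of_adj _ _ (hD.symm _ _ hzx))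
  obtain ⟨e₂, he₂, hk₂⟩ := Multiset.mem_map.1 (hD.mem_of_adj _ _ hzy)
  obtain ⟨E₁, rfl⟩ := Multiset.exists_cons_of_mem he₁
  have hne : ∀ e ∈ e₁ ::ₘ E₁, e.1 ≠ e.2.1 := fun e he => (hl.mem_of_mem e he).2.2
  have hxz : x ≠ z := by
    have := hne e₁ he₁
    rcases Sym2.eq_iff.1 hk₁ with ⟨h₁, h₂⟩ | ⟨h₁, h₂⟩ <;> rw [h₁, h₂] at this
    exacts [this, this.symm]
  have hyz : y ≠ z := by
    have := hne e₂ he₂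
    rcases Sym2.eq_iff.1 hk₂ with ⟨h₁, h₂⟩ | ⟨h₁, h₂⟩ <;> rw [h₁, h₂] at this
    exacts [this.symm, this]
  have he₂' : e₂ ∈ E₁ := by
    rcases Multiset.mem_cons.1 he₂ with rfl | h
    · rw [hk₁, Sym2.eq_iff] at hk₂
      rcases hk₂ with ⟨h, -⟩ | ⟨h, -⟩
      · exact absurd h hxz
      · exact absurd h hxy
    · exact h
  obtain ⟨F, rfl⟩ := Multiset.exists_cons_of_mem he₂'
  have hl₁ := hl.orient (hD.of_mem e₁ he₁).2 hD.rev hk₁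
  have hD₁ := hD.orient hk₁
  rw [Multiset.cons_swap] at hl₁ hD₁
  have hl₂ := hl₁.orient (hD₁.of_mem e₂ (Multiset.mem_cons_self _ _)).2 hD.rev hk₂
  have hD₂ := hD₁.orient hk₂
  rw [Multiset.cons_swap] at hl₂ hD₂
  have hn := hD₂.nodup
  simp only [Multiset.map_cons, Multiset.nodup_cons, Multiset.mem_cons, not_or] at hn
  obtain ⟨⟨-, hn₁⟩, hn₂, hn₃⟩ := hn
  have hFm : ∀ f ∈ F, f ∈ (x, z, lab x z) ::ₘ (z, y, lab z y) ::ₘ F := fun f hf =>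
    Multiset.mem_cons_of_mem (Multiset.mem_cons_of_mem hf)
  have hF : ∀ f ∈ F, ¬ Touches f z := by
    intro f hf hfz
    have ha := (hD₂.of_mem f (hFm f hf)).1
    have hkF : ends f ∈ F.map ends := Multiset.mem_map_of_mem _ hf
    have : ∃ u, adj z u ∧ ends f = s(z, u) := by
      rcases hfz with h | h
      · exact ⟨f.2.1, h ▸ ha, by rw [← h]; rfl⟩
      · exact ⟨f.1, h ▸ hD.symm _ _ ha, by rw [← h, Sym2.eq_swap]; rfl⟩
    obtain ⟨u, hu, hfu⟩ := this
    rw [hfu] at hkF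
    rcases (hz u).1 hu with rfl | rfl
    · rw [Sym2.eq_swap] at hkF; exact hn₁ hkF
    · exact hn₂ hkF
  obtain ⟨s', t', l', hs, hs'⟩ := hl₂.suppress hxy hF
  -- The new edge is merged with an edge between `x` and `y`, if there is one.
  obtain ⟨F', hl', hn', hFF', hkF⟩ : ∃ F',
      LabelledSP v (V.erase z) ((x, y, lab' x y) ::ₘ F') s' t' l' ∧
      (((x, y, lab' x y) ::ₘ F').map ends).Nodup ∧ (∀ f ∈ F', f ∈ F) ∧
      ∀ k ∈ F.map ends, k = s(x, y) ∨ k ∈ F'.map ends := by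
    by_cases ha : adj x y
    · have hk := hD₂.mem_of_adj x y ha
      rw [Multiset.map_cons, Multiset.map_cons, Multiset.mem_cons, Multiset.mem_cons] at hk
      have hk' : s(x, y) ∈ F.map ends := by
        rcases hk with hk | hk | hk
        · rcases Sym2.eq_iff.1 hk with ⟨-, h⟩ | ⟨h, -⟩
          · exact absurd h hyz
          · exact absurd h hxz
        · rcases Sym2.eq_iff.1 hk with ⟨h, -⟩ | ⟨h, -⟩
          · exact absurd h hxz
          · exact absurd h hxy
        · exact hk
      obtain ⟨e₃, he₃, hk₃⟩ := Multiset.mem_map.1 hk'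
      obtain ⟨F', rfl⟩ := Multiset.exists_cons_of_mem he₃
      rw [Multiset.cons_swap] at hs
      have hs₂ := hs.orient (hD₂.of_mem e₃ (hFm e₃ he₃)).2 hD.rev hk₃
      have hs₃ := hs₂.merge_parallel
      rw [hlab, bypass, if_pos ha]
      refine ⟨F', hs₃, ?_, fun f hf => Multiset.mem_cons_of_mem hf, fun k hk => ?_⟩
      · rw [Multiset.map_cons] at hn₃ ⊢
        rwa [hk₃] at hn₃
      · rw [Multiset.map_cons, Multiset.mem_cons, hk₃] at hk
        exact hk
    · rw [hlab, bypass, if_neg ha]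
      refine ⟨F, hs, ?_, fun f hf => hf, fun k hk => Or.inr hk⟩
      rw [Multiset.map_cons, Multiset.nodup_cons]
      refine ⟨fun hk => ?_, hn₃⟩
      obtain ⟨f, hf, hkf⟩ := Multiset.mem_map.1 hk
      have := (hD₂.of_mem f (hFm f hf)).1
      rcases Sym2.eq_iff.1 hkf with ⟨h₁, h₂⟩ | ⟨h₁, h₂⟩ <;> rw [h₁, h₂] at this
      exacts [ha this, ha (hD.symm _ _ this)]
  refine ⟨hl.mem_of_touches he₂ ?_, _, s', t', l', hl', hs'.trans hZ, ?_⟩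
  · rcases Sym2.eq_iff.1 hk₂ with ⟨h₁, -⟩ | ⟨-, h₂⟩
    exacts [Or.inl h₁, Or.inr h₂]
  refine ⟨hn', fun e he => ?_, fun u w huw => ?_, fun u w huw => ?_, fun u w => ?_⟩
  · rcases Multiset.mem_cons.1 he with rfl | he
    · exact ⟨(hadj _ _).2 (Or.inr (Or.inl ⟨rfl, rfl⟩)), rfl⟩
    · obtain ⟨h₁, h₂⟩ := hD₂.of_mem e (hFm e (hFF' e he))
      have h₃ := hF e (hFF' e he)
      rw [Multiset.map_cons, Multiset.nodup_cons] at hn'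
      have h₄ : ends e ≠ s(x, y) := fun h => hn'.1 (by
        have := Multiset.mem_map_of_mem ends he
        rw [h] at this
        exact this)
      refine ⟨(hadj _ _).2 (Or.inl ⟨h₁, fun h => h₃ (Or.inl h), fun h => h₃ (Or.inr h)⟩), ?_⟩
      rw [h₂, hlab'']
      · rintro ⟨h, h'⟩; exact h₄ (by rw [ends, h, h'])
      · rintro ⟨h, h'⟩; exact h₄ (by rw [ends, h, h', Sym2.eq_swap])
  · rw [Multiset.map_cons, Multiset.mem_cons]
    rcases (hadj u w).1 huw with ⟨h, hu, hw⟩ | ⟨rfl, rfl⟩ | ⟨rfl, rfl⟩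
    · have hk := hD₂.mem_of_adj u w h
      rw [Multiset.map_cons, Multiset.map_cons, Multiset.mem_cons, Multiset.mem_cons] at hk
      rcases hk with hk | hk | hk
      · rcases Sym2.eq_iff.1 hk with ⟨-, h⟩ | ⟨h, -⟩
        · exact absurd h hw
        · exact absurd h hu
      · rcases Sym2.eq_iff.1 hk with ⟨h, -⟩ | ⟨-, h⟩
        · exact absurd h hu
        · exact absurd h hw
      · exact hkF _ hk
    · exact Or.inl rfl
    · exact Or.inl Sym2.eq_swap
  · rw [hadj] at huw ⊢
    rcases huw with ⟨h, hu, hw⟩ | ⟨rfl, rfl⟩ | ⟨rfl, rfl⟩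
    · exact Or.inl ⟨hD.symm _ _ h, hw, hu⟩
    · exact Or.inr (Or.inr ⟨rfl, rfl⟩)
    · exact Or.inr (Or.inl ⟨rfl, rfl⟩)
  · by_cases h₁ : u = x ∧ w = y
    · rw [h₁.1, h₁.2, hlab']
    by_cases h₂ : u = y ∧ w = x
    · rw [h₂.1, h₂.2, hlab', rev_rev]
    · rw [hlab'' u w h₁ h₂, hlab'' w u (fun h => h₂ ⟨h.2, h.1⟩) (fun h => h₁ ⟨h.2, h.1⟩), hD.rev]

/-- As long as there are more than two vertices, one of them can be eliminated. -/
theorem Represents.exists_degree_two (h : Represents v adj lab V Z) (hV : 2 < V.card) :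
    ∃ z ∈ V, ∃ x y, x ≠ y ∧ ∀ u, adj z u ↔ u = x ∨ u = y := by
  obtain ⟨E, s, t, l, hl, -, hD⟩ := h
  rcases hl.exists_degree_two hD.nodup with rfl | ⟨z, hz, -, -, e, f, F, rfl, he, hf, hF⟩
  · exact absurd Finset.card_le_two (not_le.2 hV)
  · have key : ∀ {g : α × α × SPLabel R}, g ∈ e ::ₘ f ::ₘ F → Touches g z →
        ∃ x, ends g = s(z, x) ∧ adj z x := by
      intro g hg hgz
      have ha := (hD.of_mem g hg).1
      rcases hgz with h | h
      · exact ⟨g.2.1, by rw [← h]; rfl, h ▸ ha⟩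
      · exact ⟨g.1, by rw [← h, Sym2.eq_swap]; rfl, h ▸ hD.symm _ _ ha⟩
    obtain ⟨x, hx, hzx⟩ := key (Multiset.mem_cons_self _ _) he
    obtain ⟨y, hy, hzy⟩ := key (Multiset.mem_cons_of_mem (Multiset.mem_cons_self _ _)) hf
    have hn := hD.nodup
    simp only [Multiset.map_cons, Multiset.nodup_cons, Multiset.mem_cons, not_or] at hn
    refine ⟨z, hz, x, y, ?_, fun u => ⟨fun hu => ?_, ?_⟩⟩
    · rintro rfl
      exact hn.1.1 (hx.trans hy.symm)
    · have hk := hD.mem_of_adj z u hu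
      rw [Multiset.map_cons, Multiset.map_cons, Multiset.mem_cons, Multiset.mem_cons, hx, hy,
        Sym2.congr_right, Sym2.congr_right] at hk
      rcases hk with hk | hk | hk
      · exact Or.inl hk
      · exact Or.inr hk
      · obtain ⟨g, hg, hgk⟩ := Multiset.mem_map.1 hk
        refine absurd ?_ (hF g hg)
        rcases Sym2.eq_iff.1 hgk with ⟨h₁, -⟩ | ⟨-, h₂⟩
        exacts [Or.inl h₁, Or.inr h₂]
    · rintro (rfl | rfl) <;> assumption

/-- When two vertices are left, the label of the edge between them determines the sum. -/
theorem Represents.eq_total (h : Represents v adj lab V Z) (hV : V.card ≤ 2) (hxy : adj x y) :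
    Z = total (v x) (v y) (lab x y) := by
  obtain ⟨E, s, t, l, hl, rfl, hD⟩ := h
  obtain ⟨hst, hs, ht⟩ := hl.ne_and_mem
  have hVe : V = {s, t} := by
    refine (Finset.eq_of_subset_of_card_le
      (Finset.insert_subset hs (Finset.singleton_subset_iff.2 ht)) ?_).symm
    rwa [Finset.card_pair hst]
  have hk : ∀ e ∈ E, ends e = s(s, t) := by
    intro e he
    obtain ⟨h₁, h₂, h₃⟩ := hl.mem_of_mem e he
    rw [hVe] at h₁ h₂
    simp only [Finset.mem_insert, Finset.mem_singleton] at h₁ h₂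
    rw [ends, Sym2.eq_iff]
    grind
  obtain ⟨e, he, hxye⟩ := Multiset.mem_map.1 (hD.mem_of_adj x y hxy)
  obtain ⟨F, rfl⟩ := Multiset.exists_cons_of_mem he
  have hF : F = 0 := by
    refine Multiset.eq_zero_of_forall_notMem fun f hf => ?_
    have hn := hD.nodup
    rw [Multiset.map_cons, Multiset.nodup_cons] at hn
    refine hn.1 (Multiset.mem_map.2 ⟨f, hf, ?_⟩)
    rw [hk e he, hk f (Multiset.mem_cons_of_mem hf)]
  subst hF
  have hl' := hl.orient (hD.of_mem e he).2 hD.rev (hk e he)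
  have hlab : l = lab s t := by
    rcases hl'.of_terminal_edge with ⟨-, -, h⟩ | ⟨b, hb, -⟩
    · exact h
    · obtain ⟨f, hf, -⟩ := hb.exists_touches_source
      simp at hf
  rw [hlab]
  rw [hk e he] at hxye
  rcases Sym2.eq_iff.1 hxye with ⟨rfl, rfl⟩ | ⟨rfl, rfl⟩
  · rfl
  · rw [hD.rev t s, total_rev]

/-- At the start of the elimination all edges have the label of a single edge. -/
theorem Represents.of_isTwoTerminalSP {K : Multiset (Sym2 α)} (h : IsTwoTerminalSP V K s t) :
    Represents v (fun u w => s(u, w) ∈ K) (fun _ _ => unit) V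
      (classSum v true V V (IsBond K V)) := by
  obtain ⟨hst, hs, ht⟩ := h.ne_and_mem
  have hmap :
      (K.map fun k => ((Quot.out k).1, (Quot.out k).2, (unit : SPLabel R))).map ends = K := by
    rw [Multiset.map_map]
    conv_rhs => rw [← Multiset.map_id K]
    refine Multiset.map_congr rfl fun k _ => ?_
    exact Quot.out_eq k
  have hl := h.labelledSP (v := v) hmap (by
    intro e he
    obtain ⟨k, -, rfl⟩ := Multiset.mem_map.1 he
    rfl)
  obtain ⟨E, hE, hE₁, hE₂, hE₃⟩ := hl.exists_simple (by
    intro e he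
    obtain ⟨k, -, rfl⟩ := Multiset.mem_map.1 he
    rfl)
  rw [hmap] at hE₃
  refine ⟨E, s, t, _, hE, total_graphLabel hs ht hst, hE₂, fun e he => ⟨?_, hE₁ e he⟩,
    fun u w huw => (hE₃ _).2 huw, fun u w huw => by rwa [Sym2.eq_swap], fun _ _ => rfl⟩
  exact (hE₃ _).1 (Multiset.mem_map_of_mem _ he)

theorem Represents.symm (h : Represents v adj lab V Z) {u w : α} (hu : adj u w) : adj w u := by
  obtain ⟨E, s, t, l, -, -, hD⟩ := h
  exact hD.symm _ _ hu

theorem Represents.rev (h : Represents v adj lab V Z) (u w : α) : lab w u = (lab u w).rev := by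
  obtain ⟨E, s, t, l, -, -, hD⟩ := h
  exact hD.rev _ _

theorem Represents.ne (h : Represents v adj lab V Z) {u w : α} (hu : adj u w) : u ≠ w := by
  obtain ⟨E, s, t, l, hl, -, hD⟩ := h
  obtain ⟨e, he, hk⟩ := Multiset.mem_map.1 (hD.mem_of_adj u w hu)
  have := (hl.mem_of_mem e he).2.2
  rcases Sym2.eq_iff.1 hk with ⟨h₁, h₂⟩ | ⟨h₁, h₂⟩ <;> rw [h₁, h₂] at this
  exacts [this, this.symm]

end Elimination

/-! ### Reasoning about programs -/

namespace BoundedLoop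

namespace Store

theorem set_self (h : Store) (f a b x : ℕ) : h.set f a b x f a b = x := by simp [set]

theorem set_of_ne (h : Store) {f f' : ℕ} (hf : f' ≠ f) (a b x : ℕ) : h.set f a b x f' = h f' := by
  funext a' b'
  simp [set, hf]

end Store

namespace Stmt

/-- The effect of a program on the arrays. -/
def run (w : List ℕ) (p : Stmt) (h : Store) : Store := (p.den w ⟨h, []⟩).h

theorem den_h (w : List ℕ) (p : Stmt) (σ : Config) : (p.den w σ).h = p.run w σ.h := by
  obtain ⟨h, out⟩ := σ
  suffices H : ∀ out', (p.den w ⟨h, out⟩).h = (p.den w ⟨h, out'⟩).h from H []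
  induction p generalizing h out with
  | skip => intro; rfl
  | put => intro; rfl
  | write => intro; rfl
  | seq p q ihp ihq =>
    intro out'
    have := ihp h out out'
    simp only [den]
    rw [show p.den w ⟨h, out⟩ = ⟨(p.den w ⟨h, out⟩).h, (p.den w ⟨h, out⟩).out⟩ from rfl, this]
    exact ihq _ _ _
  | ite e p q ihp ihq =>
    intro out'
    simp only [den]
    split_ifs
    exacts [ihq _ _ _, ihp _ _ _]
  | rep e p ih =>
    intro out'
    simp only [den]
    generalize w.getD (e.eval w h) 0 = k
    induction k generalizing h out out' with
    | zero => rfl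
    | succ k ihk =>
      rw [Function.iterate_succ_apply, Function.iterate_succ_apply]
      have := ih h out out'
      rw [show p.den w ⟨h, out⟩ = ⟨(p.den w ⟨h, out⟩).h, (p.den w ⟨h, out⟩).out⟩ from rfl, this]
      exact ihk _ _ _

variable (w : List ℕ) (h : Store)

theorem run_skip : skip.run w h = h := rfl

@[simp] theorem run_put (f : ℕ) (a b e : Expr) :
    (put f a b e).run w h = h.set f (a.eval w h) (b.eval w h) (e.eval w h) := rfl

@[simp] theorem run_seq (p q : Stmt) : (seq p q).run w h = q.run w (p.run w h) :=
  den_h w q _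

theorem run_ite (e : Expr) (p q : Stmt) :
    (ite e p q).run w h = if e.eval w h = 0 then q.run w h else p.run w h := by
  simp only [run, den]
  split_ifs <;> rfl

theorem run_rep (e : Expr) (p : Stmt) :
    (rep e p).run w h = (p.run w)^[w.getD (e.eval w h) 0] h := by
  change ((p.den w)^[w.getD (e.eval w h) 0] ⟨h, []⟩).h = _
  generalize w.getD (e.eval w h) 0 = k
  suffices H : ∀ σ : Config, ((p.den w)^[k] σ).h = (p.run w)^[k] σ.h from H _
  induction k with
  | zero => intro; rfl
  | succ k ih => intro σ; rw [Function.iterate_succ_apply, Function.iterate_succ_apply, ih, den_h]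

/-- Whether a program assigns to entries of the array `f`. -/
def Writes (f : ℕ) : Stmt → Bool
  | skip => false
  | put f' _ _ _ => f == f'
  | write _ => false
  | seq p q => p.Writes f || q.Writes f
  | ite _ p q => p.Writes f || q.Writes f
  | rep _ p => p.Writes f

theorem run_of_not_writes {f : ℕ} {p : Stmt} (hf : p.Writes f = false) : p.run w h f = h f := by
  induction p generalizing h with
  | skip => rfl
  | put f' a b e => exact Store.set_of_ne h (by simpa [Writes] using hf) _ _ _
  | write => rfl
  | seq p q ihp ihq =>
    simp only [Writes, Bool.or_eq_false_iff] at hf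
    rw [run_seq, ihq _ hf.2, ihp _ hf.1]
  | ite e p q ihp ihq =>
    simp only [Writes, Bool.or_eq_false_iff] at hf
    rw [run_ite]
    split_ifs
    exacts [ihq _ hf.2, ihp _ hf.1]
  | rep e p ih =>
    rw [run_rep]
    generalize w.getD (e.eval w h) 0 = k
    induction k with
    | zero => rfl
    | succ k ihk => rw [Function.iterate_succ_apply', ih _ hf, ihk]

/-- Whether a program contains no output statement. -/
def Silent : Stmt → Bool
  | skip => true
  | put _ _ _ _ => true
  | write _ => false
  | seq p q => p.Silent && q.Silent
  | ite _ p q => p.Silent && q.Silent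
  | rep _ p => p.Silent

theorem den_of_silent {p : Stmt} (hp : p.Silent = true) (σ : Config) :
    p.den w σ = ⟨p.run w σ.h, σ.out⟩ := by
  suffices H : (p.den w σ).out = σ.out by rw [← den_h, ← H]
  induction p generalizing σ with
  | skip => rfl
  | put => rfl
  | write => simp [Silent] at hp
  | seq p q ihp ihq =>
    simp only [Silent, Bool.and_eq_true] at hp
    rw [den, ihq hp.2, ihp hp.1]
  | ite e p q ihp ihq =>
    simp only [Silent, Bool.and_eq_true] at hp
    rw [den]
    split_ifs
    exacts [ihq hp.2 _, ihp hp.1 _]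
  | rep e p ih =>
    rw [den]
    generalize w.getD (e.eval w σ.h) 0 = k
    induction k with
    | zero => rfl
    | succ k ihk => rw [Function.iterate_succ_apply', ih hp, ihk]

end Stmt

open BoundedLoop.Expr BoundedLoop.Stmt

/-- The value of a scalar. -/
def Expr.var (f : ℕ) : Expr := .get f (.lit 0) (.lit 0)

@[simp] theorem Expr.eval_var (w : List ℕ) (h : Store) (f : ℕ) : (var f).eval w h = h f 0 0 := rfl

@[simp] theorem Expr.eval_lit (w : List ℕ) (h : Store) (c : ℕ) : (lit c).eval w h = c := rfl

@[simp] theorem Expr.eval_add (w : List ℕ) (h : Store) (a b : Expr) :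
    (add a b).eval w h = a.eval w h + b.eval w h := rfl

@[simp] theorem Expr.eval_sub (w : List ℕ) (h : Store) (a b : Expr) :
    (sub a b).eval w h = a.eval w h - b.eval w h := rfl

@[simp] theorem Expr.eval_div (w : List ℕ) (h : Store) (a b : Expr) :
    (div a b).eval w h = a.eval w h / b.eval w h := rfl

@[simp] theorem Expr.eval_mul (w : List ℕ) (h : Store) (a b : Expr) :
    (mul a b).eval w h = (a.eval w h * b.eval w h) % (h 1 0 0 + 1) := rfl

@[simp] theorem Expr.eval_get (w : List ℕ) (h : Store) (f : ℕ) (a b : Expr) :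
    (get f a b).eval w h = h f (a.eval w h) (b.eval w h) := rfl

@[simp] theorem Expr.eval_inp (w : List ℕ) (h : Store) (a : Expr) :
    (inp a).eval w h = w.getD (a.eval w h) 0 := rfl

/-- Assignment to a scalar. -/
def Stmt.assign (f : ℕ) (e : Expr) : Stmt := .put f (.lit 0) (.lit 0) e

@[simp] theorem Stmt.run_assign (w : List ℕ) (h : Store) (f : ℕ) (e : Expr) :
    (assign f e).run w h = h.set f 0 0 (e.eval w h) := rfl

/-- Assignments in a row. -/
def Stmt.block : List Stmt → Stmt
  | [] => .skip
  | p :: l => .seq p (block l)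

@[simp] theorem Stmt.run_block_nil (w : List ℕ) (h : Store) : (block []).run w h = h := by
  rw [block, run_skip]

@[simp] theorem Stmt.run_block_cons (w : List ℕ) (h : Store) (p : Stmt) (l : List Stmt) :
    (block (p :: l)).run w h = (block l).run w (p.run w h) := run_seq w h p _

/-- The loop that does `p` for the values `0, 1, …` of the scalar `i`; the number of rounds is
entry number `e` of the input. -/
def Stmt.forLoop (i : ℕ) (e : Expr) (p : Stmt) : Stmt :=
  .seq (assign i (.lit 0)) (.rep e (.seq p (assign i (.add (.var i) (.lit 1)))))

/-- The rule for loops: the invariant does not depend on the loop variable. -/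
theorem Stmt.run_forLoop {w : List ℕ} {i k : ℕ} {c : ℕ} {p : Stmt} (hp : p.Writes i = false)
    (hk : w.getD c 0 = k) (Inv : ℕ → Store → Prop)
    (hInv : ∀ j h x, Inv j h → Inv j (h.set i 0 0 x)) {h : Store} (h₀ : Inv 0 h)
    (step : ∀ j < k, ∀ h, h i 0 0 = j → Inv j h → Inv (j + 1) (p.run w h)) :
    Inv k ((forLoop i (.lit c) p).run w h) := by
  rw [forLoop, run_seq, run_rep, Expr.eval_lit, hk, run_assign, Expr.eval_lit]
  suffices H : ∀ j ≤ k, Inv j (((seq p (assign i (.add (.var i) (.lit 1)))).run w)^[j]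
      (h.set i 0 0 0)) ∧ (((seq p (assign i (.add (.var i) (.lit 1)))).run w)^[j]
      (h.set i 0 0 0)) i 0 0 = j from (H k le_rfl).1
  intro j
  induction j with
  | zero => exact fun _ => ⟨hInv _ _ _ h₀, Store.set_self _ _ _ _ _⟩
  | succ j ih =>
    intro hj
    obtain ⟨h₁, h₂⟩ := ih (by omega)
    rw [Function.iterate_succ_apply', run_seq, run_assign]
    refine ⟨hInv _ _ _ (step j (by omega) _ h₂ h₁), ?_⟩
    rw [Store.set_self, Expr.eval_add, Expr.eval_var, run_of_not_writes _ _ hp, h₂]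
    rfl

/-- The rule for repetitions. -/
theorem Stmt.run_rep_induction {w : List ℕ} {k : ℕ} {e : Expr} {p : Stmt} {h : Store}
    (hk : w.getD (e.eval w h) 0 = k) (Inv : ℕ → Store → Prop) (h₀ : Inv 0 h)
    (step : ∀ j < k, ∀ h, Inv j h → Inv (j + 1) (p.run w h)) : Inv k ((rep e p).run w h) := by
  rw [run_rep, hk]
  suffices H : ∀ j ≤ k, Inv j ((p.run w)^[j] h) from H k le_rfl
  intro j
  induction j with
  | zero => exact fun _ => h₀
  | succ j ih =>
    intro hj
    rw [Function.iterate_succ_apply']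
    exact step j (by omega) _ (ih (by omega))

end BoundedLoop

/-! ### The program for the sum over all connected 2-partitions -/

/-! The counting program uses these arrays; a scalar is the entry `0, 0` of its array.

* `1`: the modulus minus one; `4`: the power of the base from which the result is read off.
* `6`, `7`, `8`: loop variables; `6` is also the vertex that is tried, `8` its number of neighbours.
* `9`, `10`: the neighbours of the vertex that is tried; `11`, `12`: the ends of some edge.
* `16`: the result.
* `20`, `21`: the weights of the vertices with the colours `true` and `false`, at the indices `u, 0`.
* `30`: the adjacency matrix.
* `31`, `32`: `mono true` and `mono false`; `33`: `cut true`; `34`, `35`: `conn true` and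
  `conn false`; `36`, `37`: `split true` and `split false`, for every ordered pair of vertices. -/

namespace BoundedLoop

open BoundedLoop.Expr BoundedLoop.Stmt

/-- Sets the array `f` to the constant `c`. -/
def fill (f c : ℕ) : Stmt :=
  forLoop 7 (lit 0) (forLoop 8 (lit 0) (put f (var 7) (var 8) (lit c)))

theorem run_fill {w : List ℕ} {n f c : ℕ} (hn : w.getD 0 0 = n) (h₇ : f ≠ 7) (h₈ : f ≠ 8)
    (h : Store) : ∀ u < n, ∀ v < n, (fill f c).run w h f u v = c := by
  refine run_forLoop (by simp [Writes, forLoop, assign, h₇.symm]) hn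
    (fun j h => ∀ u < j, ∀ v < n, h f u v = c) (fun j h x H => ?_) (by simp) fun j hj h hj' H => ?_
  · rwa [Store.set_of_ne _ h₇]
  have key := run_forLoop (w := w) (i := 8) (c := 0) (k := n) (h := h)
    (p := put f (var 7) (var 8) (lit c)) (by simp [Writes, h₈.symm]) hn
    (fun i h => h 7 0 0 = j ∧ (∀ u < j, ∀ v < n, h f u v = c) ∧ ∀ v < i, h f j v = c)
    (fun i h x H => ?_) ⟨hj', H, by simp⟩ fun i hi h hi' H => ?_
  · intro u hu v hv
    rcases Nat.lt_succ_iff_lt_or_eq.1 hu with hu | rfl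
    exacts [key.2.1 u hu v hv, key.2.2 v hv]
  · rwa [Store.set_of_ne _ h₈, Store.set_of_ne _ (by norm_num)]
  · obtain ⟨H₁, H₂, H₃⟩ := H
    simp only [run_put, eval_var, eval_lit, H₁, hi']
    rw [Store.set_of_ne _ h₇.symm]
    refine ⟨H₁, fun u hu v hv => ?_, fun v hv => ?_⟩
    · simp [Store.set, H₂ u hu v hv]
    · by_cases h₁ : v = i
      · simp [Store.set, h₁]
      · simp [Store.set, H₃ v (by omega)]

/-- Enters the edges into the adjacency matrix, and stores the ends of the last one. -/
def readEdges : Stmt :=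
  forLoop 6 (lit 1) (block [
    assign 11 (inp (add (lit 2) (add (var 6) (var 6)))),
    assign 12 (inp (add (lit 3) (add (var 6) (var 6)))),
    put 30 (var 11) (var 12) (lit 1),
    put 30 (var 12) (var 11) (lit 1)])

theorem run_readEdges {w : List ℕ} {m n : ℕ} (hm : w.getD 1 0 = m) {h : Store}
    (h₀ : ∀ u < n, ∀ v < n, h 30 u v = 0) :
    (∀ u < n, ∀ v < n, readEdges.run w h 30 u v ≠ 0 ↔ ∃ e < m,
      (w.getD (2 + (e + e)) 0 = u ∧ w.getD (3 + (e + e)) 0 = v) ∨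
      (w.getD (2 + (e + e)) 0 = v ∧ w.getD (3 + (e + e)) 0 = u)) ∧
    (0 < m → ∃ e < m, w.getD (2 + (e + e)) 0 = readEdges.run w h 11 0 0 ∧
      w.getD (3 + (e + e)) 0 = readEdges.run w h 12 0 0) := by
  refine run_forLoop rfl hm (fun j h =>
    (∀ u < n, ∀ v < n, h 30 u v ≠ 0 ↔ ∃ e < j,
      (w.getD (2 + (e + e)) 0 = u ∧ w.getD (3 + (e + e)) 0 = v) ∨
      (w.getD (2 + (e + e)) 0 = v ∧ w.getD (3 + (e + e)) 0 = u)) ∧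
    (0 < j → ∃ e < j, w.getD (2 + (e + e)) 0 = h 11 0 0 ∧ w.getD (3 + (e + e)) 0 = h 12 0 0))
    (fun j h x H => ?_) ⟨fun u hu v hv => by simp [h₀ u hu v hv], by simp⟩ fun j hj h hj' H => ?_
  · rwa [Store.set_of_ne _ (by norm_num), Store.set_of_ne _ (by norm_num),
      Store.set_of_ne _ (by norm_num)]
  · refine ⟨fun u hu v hv => ?_, fun _ => ⟨j, by omega, ?_⟩⟩
    · simp only [run_block_cons, run_block_nil, run_assign, run_put, eval_var, eval_lit, eval_add,
        eval_inp]
      rw [Store.set_of_ne _ (show 6 ≠ 11 by norm_num), hj']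
      have := H.1 u hu v hv
      simp only [Nat.lt_succ_iff_lt_or_eq, or_and_right, exists_or, exists_eq_left]
      rw [← this]
      generalize w.getD (2 + (j + j)) 0 = a
      generalize w.getD (3 + (j + j)) 0 = b
      simp only [Store.set_self, Store.set_of_ne _ (show 12 ≠ 30 by norm_num),
        Store.set_of_ne _ (show 11 ≠ 30 by norm_num), Store.set_of_ne _ (show 11 ≠ 12 by norm_num)]
      by_cases h₁ : u = a ∧ v = b
      · simp [Store.set, h₁]
      by_cases h₂ : u = b ∧ v = a
      · simp [Store.set, h₂]
      · have e : (((h.set 11 0 0 a).set 12 0 0 b).set 30 a b 1).set 30 b a 1 30 u v = h 30 u v := by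
          simp [Store.set, h₁, h₂]
        rw [e]
        grind
    · simp [Store.set, hj']

/-- Determines the number of neighbours of a vertex and, if there are two of them, these. -/
def scan : Stmt :=
  seq (assign 8 (lit 0)) (forLoop 7 (lit 0) (ite (get 30 (var 6) (var 7))
    (block [assign 10 (var 9), assign 9 (var 7), assign 8 (add (var 8) (lit 1))]) skip))

theorem run_scan {w : List ℕ} {n z : ℕ} (hn : w.getD 0 0 = n) {h : Store} (hz : h 6 0 0 = z) :
    scan.run w h 8 0 0 = ((Finset.range n).filter fun u => h 30 z u ≠ 0).card ∧
    (scan.run w h 8 0 0 = 2 → (Finset.range n).filter (fun u => h 30 z u ≠ 0) =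
      {scan.run w h 9 0 0, scan.run w h 10 0 0}) := by
  rw [scan, run_seq]
  have H := run_forLoop (w := w) (i := 7) (c := 0) (k := n)
    (p := ite (get 30 (var 6) (var 7))
      (block [assign 10 (var 9), assign 9 (var 7), assign 8 (add (var 8) (lit 1))]) skip)
    (h := (assign 8 (lit 0)).run w h) rfl hn
    (fun j h' => h' 30 = h 30 ∧ h' 6 0 0 = z ∧
      h' 8 0 0 = ((Finset.range j).filter fun u => h 30 z u ≠ 0).card ∧
      (h' 8 0 0 = 1 → (Finset.range j).filter (fun u => h 30 z u ≠ 0) = {h' 9 0 0}) ∧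
      (h' 8 0 0 = 2 → (Finset.range j).filter (fun u => h 30 z u ≠ 0) = {h' 9 0 0, h' 10 0 0}))
    (fun j h' x H => ?_) ?_ fun j hj h' hj' H => ?_
  · exact ⟨H.2.2.1, H.2.2.2.2⟩
  · simpa [Store.set_of_ne] using H
  · simp [Store.set_of_ne, Store.set_self, hz]
  obtain ⟨h₁, h₂, h₃, h₄, h₅⟩ := H
  rw [run_ite, Finset.range_add_one, Finset.filter_insert]
  simp only [eval_get, eval_var, h₁, h₂, hj']
  by_cases ha : h 30 z j = 0
  · rw [if_pos ha, if_neg (not_not.2 ha)]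
    exact ⟨h₁, h₂, h₃, h₄, h₅⟩
  · rw [if_neg ha, if_pos ha, Finset.card_insert_of_notMem (by simp), ← h₃]
    simp only [run_block_cons, run_block_nil, run_assign, eval_var, eval_lit, eval_add,
      Store.set_self, Store.set_of_ne, ne_eq, Nat.reduceEqDiff, not_false_eq_true, hj', h₂, h₁,
      true_and]
    refine ⟨fun h₆ => ?_, fun h₆ => ?_⟩
    · have h₇ : h' 8 0 0 = 0 := by omega
      rw [h₃, Finset.card_eq_zero] at h₇
      rw [h₇]
      rfl
    · rw [h₄ (by omega)]

end BoundedLoop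

namespace SPLabel

variable {R : Type}

/-- The labels agree, except perhaps for the entry `cut false`. -/
def HalfEq (a b : SPLabel R) : Prop :=
  (∀ c, a.mono c = b.mono c) ∧ a.cut true = b.cut true ∧ (∀ c, a.conn c = b.conn c) ∧
    ∀ c, a.split c = b.split c

theorem HalfEq.trans {a b d : SPLabel R} (h : HalfEq a b) (h' : HalfEq b d) : HalfEq a d :=
  ⟨fun c => (h.1 c).trans (h'.1 c), h.2.1.trans h'.2.1, fun c => (h.2.2.1 c).trans (h'.2.2.1 c),
    fun c => (h.2.2.2 c).trans (h'.2.2.2 c)⟩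

theorem HalfEq.eq {a b : SPLabel R} (h : HalfEq a b) (h' : HalfEq a.rev b.rev) : a = b := by
  ext c
  · exact h.1 c
  · cases c
    exacts [h'.2.1, h.2.1]
  · exact h.2.2.1 c
  · exact h.2.2.2 c

theorem HalfEq.bypass [CommSemiring R] {a b : SPLabel R} (h : HalfEq a b) (e : Prop) [Decidable e]
    (d : SPLabel R) : HalfEq (bypass e a d) (bypass e b d) := by
  obtain ⟨h₁, h₂, h₃, h₄⟩ := h
  unfold _root_.bypass
  split_ifs
  · simp [HalfEq, par, h₁, h₂, h₃, h₄]
  · simp [HalfEq]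

theorem rev_bypass [CommSemiring R] (e : Prop) [Decidable e] (a b : SPLabel R) :
    (_root_.bypass e a b).rev = _root_.bypass e a.rev b.rev := by
  unfold _root_.bypass
  split_ifs
  exacts [rev_par a b, rfl]

end SPLabel

namespace BoundedLoop

open BoundedLoop.Expr BoundedLoop.Stmt

/-- The expression for `mono c` of the pair `a`, `b`. -/
def monoE (c : Bool) (a b : Expr) : Expr := get (bif c then 31 else 32) a b

/-- The expression for `cut c` of the pair `a`, `b`. The array `33` holds `cut true`; the values of
`cut false` are those of the reversed pairs. -/
def cutE (c : Bool) (a b : Expr) : Expr := bif c then get 33 a b else get 33 b a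

/-- The expression for `conn c` of the pair `a`, `b`. -/
def connE (c : Bool) (a b : Expr) : Expr := get (bif c then 34 else 35) a b

/-- The expression for `split c` of the pair `a`, `b`. -/
def splitE (c : Bool) (a b : Expr) : Expr := get (bif c then 36 else 37) a b

/-- The expression for the weight of the vertex `a` with the colour `c`. -/
def valE (c : Bool) (a : Expr) : Expr := get (bif c then 20 else 21) a (lit 0)

/-- The label of the pair `u`, `v`. -/
def labelOf (M : ℕ) (h : Store) (u v : ℕ) : SPLabel (ZMod M) where
  mono c := h (bif c then 31 else 32) u v
  cut c := bif c then h 33 u v else h 33 v u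
  conn c := h (bif c then 34 else 35) u v
  split c := h (bif c then 36 else 37) u v

/-- The weight of the vertex `u` with the colour `c`. -/
def valOf (M : ℕ) (h : Store) (u : ℕ) (c : Bool) : ZMod M := h (bif c then 20 else 21) u 0

/-- The vertex with the label from the scalar `6`, which is eliminated. -/
def zE : Expr := var 6
/-- The first neighbour of the vertex that is eliminated. -/
def xE : Expr := var 9
/-- The second neighbour of the vertex that is eliminated. -/
def yE : Expr := var 10

/-- The expression for `mono c` of the series composition. -/
def serMono (c : Bool) : Expr := mul (mul (monoE c xE zE) (valE c zE)) (monoE c zE yE)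

/-- The expression for `cut true` of the series composition. -/
def serCut : Expr :=
  add (mul (mul (cutE true xE zE) (valE false zE)) (monoE false zE yE))
    (mul (mul (monoE true xE zE) (valE true zE)) (cutE true zE yE))

/-- The expression for `conn c` of the series composition. -/
def serConn (c : Bool) : Expr :=
  mul (valE c zE) (add (mul (connE c xE zE) (monoE c zE yE)) (mul (monoE c xE zE) (connE c zE yE)))

/-- The expression for `split c` of the series composition. -/
def serSplit (c : Bool) : Expr :=
  add (mul (valE c zE)
      (add (mul (splitE c xE zE) (monoE c zE yE)) (mul (monoE c xE zE) (splitE c zE yE))))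
    (mul (valE (!c) zE) (mul (cutE c xE zE) (cutE (!c) zE yE)))

/-- The expression for `conn c` of the parallel composition with the label of `x`, `y`. -/
def parConn (c : Bool) : Expr :=
  add (mul (add (connE c xE yE) (splitE c xE yE)) (serMono c))
    (mul (monoE c xE yE) (add (serConn c) (serSplit c)))

/-- Computes the new label of the pair `x`, `y`, except for `cut false`. -/
def updateLabel : Stmt :=
  ite (get 30 xE yE)
    (block [
      put 34 xE yE (parConn true), put 35 xE yE (parConn false),
      put 36 xE yE (lit 0), put 37 xE yE (lit 0),
      put 33 xE yE (mul (cutE true xE yE) serCut),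
      put 31 xE yE (mul (monoE true xE yE) (serMono true)),
      put 32 xE yE (mul (monoE false xE yE) (serMono false))])
    (block [
      put 34 xE yE (serConn true), put 35 xE yE (serConn false),
      put 36 xE yE (serSplit true), put 37 xE yE (serSplit false),
      put 33 xE yE serCut,
      put 31 xE yE (serMono true), put 32 xE yE (serMono false)])

theorem run_updateLabel_of_ne (w : List ℕ) (h : Store) (f u v : ℕ)
    (huv : ¬ (u = h 9 0 0 ∧ v = h 10 0 0)) : updateLabel.run w h f u v = h f u v := by
  rw [updateLabel, run_ite]
  split_ifs <;> simp [Store.set, xE, yE, huv]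

/-- The stores agree except for the entries `x`, `y` of the arrays. -/
def AgreeOff (x y : ℕ) (h h' : Store) : Prop := ∀ f u v, ¬ (u = x ∧ v = y) → h' f u v = h f u v

theorem AgreeOff.refl (x y : ℕ) (h : Store) : AgreeOff x y h h := fun _ _ _ _ => rfl

theorem AgreeOff.set {x y : ℕ} {h h' : Store} (A : AgreeOff x y h h') (f e : ℕ) :
    AgreeOff x y h (h'.set f x y e) := fun f' u v huv => by
  rw [← A f' u v huv]
  simp [Store.set, huv]

/-- The scalars for an elimination: the modulus, the vertex `z` and its neighbours `x` and `y`. -/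
structure Selected (h : Store) (M x y z : ℕ) : Prop where
  modulus : h 1 0 0 + 1 = M
  x_eq : h 9 0 0 = x
  y_eq : h 10 0 0 = y
  z_eq : h 6 0 0 = z
  x_ne_y : x ≠ y
  x_ne_z : x ≠ z
  y_ne_z : y ≠ z

section

variable {h h' : Store} {M x y z : ℕ} (w : List ℕ)

theorem Selected.of_agreeOff (S : Selected h M x y z) (A : AgreeOff x y h h') :
    Selected h' M x y z := by
  have hxy := S.x_ne_y
  exact ⟨by rw [A _ _ _ (by omega), S.modulus], by rw [A _ _ _ (by omega), S.x_eq],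
    by rw [A _ _ _ (by omega), S.y_eq], by rw [A _ _ _ (by omega), S.z_eq], hxy, S.x_ne_z, S.y_ne_z⟩

theorem Selected.eval_xE (S : Selected h M x y z) : xE.eval w h = x := S.x_eq

theorem Selected.eval_yE (S : Selected h M x y z) : yE.eval w h = y := S.y_eq

theorem Selected.eval_zE (S : Selected h M x y z) : zE.eval w h = z := S.z_eq

/-- The label of the path from `x` through `z` to `y`. -/
def serLabel (M : ℕ) (h : Store) (x y z : ℕ) : SPLabel (ZMod M) :=
  ser (valOf M h z) (labelOf M h x z) (labelOf M h z y)

theorem serLabel_of_agreeOff (S : Selected h M x y z) (A : AgreeOff x y h h') :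
    serLabel M h' x y z = serLabel M h x y z := by
  have h₁ := S.x_ne_z
  have h₂ := S.y_ne_z
  have e₁ : labelOf M h' x z = labelOf M h x z := by
    simp only [labelOf, A _ x z (by omega), A _ z x (by omega)]
  have e₂ : labelOf M h' z y = labelOf M h z y := by
    simp only [labelOf, A _ z y (by omega), A _ y z (by omega)]
  have e₃ : valOf M h' z = valOf M h z := by
    funext c
    simp only [valOf, A _ z 0 (by omega)]
  rw [serLabel, e₁, e₂, e₃, serLabel]

theorem cast_serMono (S : Selected h M x y z) (c : Bool) :
    ((serMono c).eval w h : ZMod M) = (serLabel M h x y z).mono c := by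
  simp [serMono, monoE, valE, S.eval_xE, S.eval_yE, S.eval_zE, S.modulus, serLabel, ser, labelOf,
    valOf]

theorem cast_serCut (S : Selected h M x y z) :
    (serCut.eval w h : ZMod M) = (serLabel M h x y z).cut true := by
  simp [serCut, monoE, cutE, valE, S.eval_xE, S.eval_yE, S.eval_zE, S.modulus, serLabel, ser,
    labelOf, valOf]

theorem cast_serConn (S : Selected h M x y z) (c : Bool) :
    ((serConn c).eval w h : ZMod M) = (serLabel M h x y z).conn c := by
  simp [serConn, monoE, connE, valE, S.eval_xE, S.eval_yE, S.eval_zE, S.modulus, serLabel, ser,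
    labelOf, valOf]

theorem cast_serSplit (S : Selected h M x y z) (c : Bool) :
    ((serSplit c).eval w h : ZMod M) = (serLabel M h x y z).split c := by
  cases c <;> simp [serSplit, monoE, splitE, cutE, valE, S.eval_xE, S.eval_yE, S.eval_zE,
    S.modulus, serLabel, ser, labelOf, valOf]

theorem cast_parConn (S : Selected h M x y z) (c : Bool) :
    ((parConn c).eval w h : ZMod M) = (par (labelOf M h x y) (serLabel M h x y z)).conn c := by
  simp [parConn, cast_serMono w S, cast_serConn w S, cast_serSplit w S, S.modulus, par, monoE,
    connE, splitE, S.eval_xE, S.eval_yE, labelOf]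

/-- An assignment to the entries of `x`, `y`. -/
theorem Selected.run_put (S : Selected h M x y z) (A : AgreeOff x y h h') (f : ℕ) (e : Expr) :
    ∃ h'', (put f xE yE e).run w h' = h'' ∧ AgreeOff x y h h'' ∧ Selected h'' M x y z ∧
      serLabel M h'' x y z = serLabel M h x y z ∧ h'' f x y = e.eval w h' ∧
      ∀ f' ≠ f, h'' f' = h' f' := by
  have S' := S.of_agreeOff A
  have A' := A.set f (e.eval w h')
  refine ⟨_, rfl, ?_⟩
  rw [Stmt.run_put, S'.eval_xE, S'.eval_yE]
  exact ⟨A', S.of_agreeOff A', serLabel_of_agreeOff S A', Store.set_self _ _ _ _ _,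
    fun f' hf => Store.set_of_ne _ hf _ _ _⟩

/-- The label of `x`, `y` becomes that of the parallel composition of the series composition with
the edge between `x` and `y`, if there is one. -/
theorem run_updateLabel (S : Selected h M x y z) : HalfEq (labelOf M (updateLabel.run w h) x y)
    (bypass (h 30 x y ≠ 0) (labelOf M h x y) (serLabel M h x y z)) := by
  rw [updateLabel, run_ite]
  by_cases ha : h 30 x y = 0
  · rw [if_pos (by simp [S.eval_xE, S.eval_yE, ha])]
    rw [bypass, if_neg (not_not.2 ha)]
    simp only [run_block_cons, run_block_nil]
    have A₀ := AgreeOff.refl x y h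
    obtain ⟨h₁, r₁, A₁, S₁, l₁, e₁, n₁⟩ := S.run_put w A₀ 34 (serConn true)
    rw [r₁]
    obtain ⟨h₂, r₂, A₂, S₂, l₂, e₂, n₂⟩ := S.run_put w A₁ 35 (serConn false)
    rw [r₂]
    obtain ⟨h₃, r₃, A₃, S₃, l₃, e₃, n₃⟩ := S.run_put w A₂ 36 (serSplit true)
    rw [r₃]
    obtain ⟨h₄, r₄, A₄, S₄, l₄, e₄, n₄⟩ := S.run_put w A₃ 37 (serSplit false)
    rw [r₄]
    obtain ⟨h₅, r₅, A₅, S₅, l₅, e₅, n₅⟩ := S.run_put w A₄ 33 serCut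
    rw [r₅]
    obtain ⟨h₆, r₆, A₆, S₆, l₆, e₆, n₆⟩ := S.run_put w A₅ 31 (serMono true)
    rw [r₆]
    obtain ⟨h₇, r₇, A₇, S₇, l₇, e₇, n₇⟩ := S.run_put w A₆ 32 (serMono false)
    rw [r₇]
    refine ⟨fun c => ?_, ?_, fun c => ?_, fun c => ?_⟩ <;> (try cases c) <;>
    simp only [labelOf, cond_true, cond_false, e₁, e₂, e₃, e₄, e₅, e₆, e₇, n₂, n₃, n₄, n₅, n₆, n₇,
      ne_eq, Nat.reduceEqDiff, not_false_eq_true]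
    · rw [cast_serMono w S₆, l₆]
    · rw [cast_serMono w S₅, l₅]
    · rw [cast_serCut w S₄, l₄]
    · rw [cast_serConn w S₁, l₁]
    · rw [cast_serConn w S]
    · rw [cast_serSplit w S₃, l₃]
    · rw [cast_serSplit w S₂, l₂]
  · rw [if_neg (by simp [S.eval_xE, S.eval_yE, ha])]
    rw [bypass, if_pos ha]
    simp only [run_block_cons, run_block_nil]
    have A₀ := AgreeOff.refl x y h
    obtain ⟨h₁, r₁, A₁, S₁, l₁, e₁, n₁⟩ := S.run_put w A₀ 34 (parConn true)
    rw [r₁]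
    obtain ⟨h₂, r₂, A₂, S₂, l₂, e₂, n₂⟩ := S.run_put w A₁ 35 (parConn false)
    rw [r₂]
    obtain ⟨h₃, r₃, A₃, S₃, l₃, e₃, n₃⟩ := S.run_put w A₂ 36 (lit 0)
    rw [r₃]
    obtain ⟨h₄, r₄, A₄, S₄, l₄, e₄, n₄⟩ := S.run_put w A₃ 37 (lit 0)
    rw [r₄]
    obtain ⟨h₅, r₅, A₅, S₅, l₅, e₅, n₅⟩ := S.run_put w A₄ 33 (mul (cutE true xE yE) serCut)
    rw [r₅]
    obtain ⟨h₆, r₆, A₆, S₆, l₆, e₆, n₆⟩ := S.run_put w A₅ 31 (mul (monoE true xE yE) (serMono true))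
    rw [r₆]
    obtain ⟨h₇, r₇, A₇, S₇, l₇, e₇, n₇⟩ :=
      S.run_put w A₆ 32 (mul (monoE false xE yE) (serMono false))
    rw [r₇]
    refine ⟨fun c => ?_, ?_, fun c => ?_, fun c => ?_⟩ <;> (try cases c) <;>
    simp only [labelOf, cond_true, cond_false, e₁, e₂, e₃, e₄, e₅, e₆, e₇, n₂, n₃, n₄, n₅, n₆, n₇,
      ne_eq, Nat.reduceEqDiff, not_false_eq_true]
    · rw [eval_mul, S₆.modulus, ZMod.natCast_mod, Nat.cast_mul, cast_serMono w S₆, l₆, monoE,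
        eval_get, S₆.eval_xE, S₆.eval_yE]
      simp [n₁, n₂, n₃, n₄, n₅, n₆, par]
    · rw [eval_mul, S₅.modulus, ZMod.natCast_mod, Nat.cast_mul, cast_serMono w S₅, l₅, monoE,
        eval_get, S₅.eval_xE, S₅.eval_yE]
      simp [n₁, n₂, n₃, n₄, n₅, par]
    · rw [eval_mul, S₄.modulus, ZMod.natCast_mod, Nat.cast_mul, cast_serCut w S₄, l₄, cutE,
        cond_true, eval_get, S₄.eval_xE, S₄.eval_yE]
      simp [n₁, n₂, n₃, n₄, par]
    · rw [cast_parConn w S₁, l₁]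
      simp [n₁, par, labelOf]
    · rw [cast_parConn w S]
      simp [par, labelOf]
    · simp [par]
    · simp [par]

theorem labelOf_congr {u v : ℕ} (h₁ : ∀ f, 30 < f → h' f u v = h f u v)
    (h₂ : ∀ f, 30 < f → h' f v u = h f v u) : labelOf M h' u v = labelOf M h u v := by
  ext c <;> cases c <;> simp [labelOf, h₁, h₂]

theorem halfEq_labelOf {u v : ℕ} (h₁ : ∀ f, 30 < f → h' f u v = h f u v) :
    HalfEq (labelOf M h' u v) (labelOf M h u v) := by
  refine ⟨fun c => ?_, ?_, fun c => ?_, fun c => ?_⟩ <;> (try cases c) <;> simp [labelOf, h₁]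

/-- Eliminates the selected vertex. The update of the label is done for both orientations of the new
edge, with the neighbours exchanged in between. -/
def eliminate : Stmt := block [
  updateLabel,
  assign 8 xE, assign 9 yE, assign 10 (var 8),
  updateLabel,
  put 30 zE xE (lit 0), put 30 xE zE (lit 0), put 30 zE yE (lit 0), put 30 yE zE (lit 0),
  put 30 xE yE (lit 1), put 30 yE xE (lit 1),
  assign 11 xE, assign 12 yE]

/-- The two updates in an elimination. The first one changes only entries of the pair `x`, `y` and the
second one needs only entries of other pairs, so that it computes the reversed label. -/
theorem run_updateLabel_twice (S : Selected h M x y z)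
    (hr : ∀ u v, (u = x ∨ u = y ∨ u = z) → (v = x ∨ v = y ∨ v = z) →
      labelOf M h v u = (labelOf M h u v).rev) (ha : h 30 x y ≠ 0 ↔ h 30 y x ≠ 0) {h₁ h₂ h₃ : Store}
    (e₁ : updateLabel.run w h = h₁)
    (e₂ : (((h₁.set 8 0 0 x).set 9 0 0 y).set 10 0 0 x) = h₂)
    (e₃ : updateLabel.run w h₂ = h₃) :
    Selected h₂ M y x z ∧ (∀ f u v, 10 < f → ¬ (u = x ∧ v = y) → ¬ (u = y ∧ v = x) →
      h₃ f u v = h f u v) ∧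
    labelOf M h₃ x y = bypass (h 30 x y ≠ 0) (labelOf M h x y)
      (ser (valOf M h z) (labelOf M h x z) (labelOf M h z y)) ∧
    labelOf M h₃ y x = (labelOf M h₃ x y).rev := by
  obtain ⟨S₁, S₂, S₃, S₄, hxy, hxz, hyz⟩ := S
  have n₁ : ∀ f u v, ¬ (u = x ∧ v = y) → h₁ f u v = h f u v := fun f u v huv => by
    rw [← e₁, run_updateLabel_of_ne w h f u v (by rwa [S₂, S₃])]
  have n₂ : ∀ f, 10 < f → h₂ f = h₁ f := fun f hf => by
    rw [← e₂, Store.set_of_ne _ (by omega), Store.set_of_ne _ (by omega),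
      Store.set_of_ne _ (by omega)]
  have T : Selected h₂ M y x z := by
    refine ⟨?_, ?_, ?_, ?_, hxy.symm, hyz, hxz⟩ <;> rw [← e₂]
    · rw [Store.set_of_ne _ (by omega), Store.set_of_ne _ (by omega),
        Store.set_of_ne _ (by omega), n₁ _ _ _ (by omega), S₁]
    · rw [Store.set_of_ne _ (by omega), Store.set_self]
    · rw [Store.set_self]
    · rw [Store.set_of_ne _ (by omega), Store.set_of_ne _ (by omega),
        Store.set_of_ne _ (by omega), n₁ _ _ _ (by omega), S₄]
  have n₃ : ∀ f u v, ¬ (u = y ∧ v = x) → h₃ f u v = h₂ f u v := fun f u v huv => by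
    rw [← e₃, run_updateLabel_of_ne w h₂ f u v (by rwa [T.x_eq, T.y_eq])]
  have n : ∀ f u v, 10 < f → ¬ (u = x ∧ v = y) → ¬ (u = y ∧ v = x) → h₃ f u v = h f u v :=
    fun f u v hf h₁ h₂ => by rw [n₃ f u v h₂, n₂ f hf, n₁ f u v h₁]
  have L₁ := run_updateLabel w ⟨S₁, S₂, S₃, S₄, hxy, hxz, hyz⟩
  rw [e₁] at L₁
  have L₂ := run_updateLabel w T
  rw [e₃] at L₂
  have K₁ : HalfEq (labelOf M h₃ x y) (bypass (h 30 x y ≠ 0) (labelOf M h x y)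
      (serLabel M h x y z)) := by
    refine (halfEq_labelOf fun f hf => ?_).trans L₁
    rw [n₃ f x y (by omega), n₂ f (by omega)]
  have hs : serLabel M h₂ y x z = (serLabel M h x y z).rev := by
    have c : ∀ u v, ¬ (u = x ∧ v = y) → ¬ (u = y ∧ v = x) →
        labelOf M h₂ u v = labelOf M h u v := fun u v h₁ h₂ =>
      labelOf_congr (fun f hf => by rw [n₂ f (by omega), n₁ f u v h₁])
        fun f hf => by rw [n₂ f (by omega), n₁ f v u (by omega)]
    have cv : valOf M h₂ z = valOf M h z := by
      funext c
      cases c <;> simp only [valOf, cond_true, cond_false] <;>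
      rw [n₂ _ (by omega), n₁ _ _ _ (by omega)]
    rw [serLabel, serLabel, rev_ser, ← hr z y (by simp) (by simp), ← hr x z (by simp) (by simp),
      c _ _ (by omega) (by omega), c _ _ (by omega) (by omega), cv]
  have K₂ : HalfEq (labelOf M h₃ y x) (bypass (h 30 x y ≠ 0) (labelOf M h x y)
      (serLabel M h x y z)).rev := by
    refine L₂.trans ?_
    rw [rev_bypass, hs, ← hr x y (by simp) (by simp)]
    have ha' : h₂ 30 y x = h 30 y x := by rw [n₂ _ (by omega), n₁ _ _ _ (by omega)]
    rw [ha']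
    simp only [ha]
    exact (halfEq_labelOf fun f hf => by rw [n₂ f (by omega), n₁ _ _ _ (by omega)]).bypass _ _
  have hrev : (labelOf M h₃ x y).rev = labelOf M h₃ y x := by
    have hm : ∀ c, (labelOf M h₃ x y).mono c = (labelOf M h₃ y x).mono c := fun c =>
      (K₁.1 c).trans (K₂.1 c).symm
    have hc : ∀ c, (labelOf M h₃ x y).conn c = (labelOf M h₃ y x).conn c := fun c =>
      (K₁.2.2.1 c).trans (K₂.2.2.1 c).symm
    have hd : ∀ c, (labelOf M h₃ x y).split c = (labelOf M h₃ y x).split c := fun c =>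
      (K₁.2.2.2 c).trans (K₂.2.2.2 c).symm
    ext c
    · exact hm c
    · cases c <;> rfl
    · exact hc c
    · exact hd c
  exact ⟨T, n, K₁.eq (hrev ▸ K₂), hrev.symm⟩

end

end BoundedLoop

/-! ### Correctness of the elimination -/

namespace BoundedLoop

open BoundedLoop.Expr BoundedLoop.Stmt

/-- The arrays describe a series-parallel graph on `V` for which the sum over all connected
2-partitions is `Z`. -/
def IsState (n M : ℕ) (h : Store) (V : Finset (Fin n)) (Z : ZMod M) : Prop :=
  Represents (fun u : Fin n => valOf M h u) (fun u v : Fin n => h 30 u v ≠ 0)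
    (fun u v : Fin n => labelOf M h u v) V Z

/-- The scalars `11` and `12` hold the ends of an edge. -/
def HasEdge (n : ℕ) (h : Store) : Prop :=
  ∃ x y : Fin n, h 11 0 0 = x ∧ h 12 0 0 = y ∧ h 30 x y ≠ 0

section

variable {n M : ℕ} {h h' : Store} {V : Finset (Fin n)} {Z : ZMod M} (w : List ℕ)

theorem IsState.congr (H : IsState n M h V Z) (h₁ : h' 20 = h 20) (h₂ : h' 21 = h 21)
    (h₃ : ∀ f, 30 ≤ f → h' f = h f) : IsState n M h' V Z := by
  have e₁ : ∀ u c, valOf M h' u c = valOf M h u c := fun u c => by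
    cases c <;> simp [valOf, h₁, h₂]
  have e₂ : ∀ u v, labelOf M h' u v = labelOf M h u v := fun u v =>
    labelOf_congr (fun f hf => by rw [h₃ f hf.le]) fun f hf => by rw [h₃ f hf.le]
  unfold IsState at H ⊢
  simp only [e₂, h₃ 30 le_rfl]
  rw [show (fun u : Fin n => valOf M h' u) = fun u : Fin n => valOf M h u from
    funext fun u => funext fun c => e₁ u c]
  exact H

/-- An elimination leaves the sum over the connected 2-partitions unchanged. -/
theorem run_eliminate {x y z : Fin n} (S : Selected h M x y z) (H : IsState n M h V Z)
    (hz : ∀ u : Fin n, h 30 z u ≠ 0 ↔ u = x ∨ u = y) :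
    z ∈ V ∧ IsState n M (eliminate.run w h) (V.erase z) Z ∧ HasEdge n (eliminate.run w h) := by
  have hxy : x ≠ y := fun e => S.x_ne_y (congrArg _ e)
  have hxz : x ≠ z := fun e => S.x_ne_z (congrArg _ e)
  have hyz : y ≠ z := fun e => S.y_ne_z (congrArg _ e)
  obtain ⟨h₁, e₁⟩ : ∃ h₁, updateLabel.run w h = h₁ := ⟨_, rfl⟩
  obtain ⟨h₂, e₂⟩ : ∃ h₂, (((h₁.set 8 0 0 x).set 9 0 0 y).set 10 0 0 x) = h₂ := ⟨_, rfl⟩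
  obtain ⟨h₃, e₃⟩ : ∃ h₃, updateLabel.run w h₂ = h₃ := ⟨_, rfl⟩
  have hsymm : ∀ u v : Fin n, h 30 u v ≠ 0 → h 30 v u ≠ 0 := fun u v => Represents.symm H
  obtain ⟨T, hoff, hlab, hrev⟩ := run_updateLabel_twice w S (by
    rintro u v (rfl | rfl | rfl) (rfl | rfl | rfl) <;> exact Represents.rev H _ _)
    ⟨hsymm x y, hsymm y x⟩ e₁ e₂ e₃
  have f₁ : h₁ 9 = h 9 := by rw [← e₁]; exact run_of_not_writes w h rfl
  have f₂ : h₁ 10 = h 10 := by rw [← e₁]; exact run_of_not_writes w h rfl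
  have T₁ : h₃ 6 0 0 = z := by rw [← e₃, run_of_not_writes w h₂ rfl, T.z_eq]
  have T₂ : h₃ 9 0 0 = y := by rw [← e₃, run_of_not_writes w h₂ rfl, T.x_eq]
  have T₃ : h₃ 10 0 0 = x := by rw [← e₃, run_of_not_writes w h₂ rfl, T.y_eq]
  obtain ⟨h₄, e₄⟩ : ∃ h₄, ((((((h₃.set 30 z y 0).set 30 y z 0).set 30 z x 0).set 30 x z 0).set
      30 y x 1).set 30 x y 1) = h₄ := ⟨_, rfl⟩
  have E : eliminate.run w h = (h₄.set 11 0 0 y).set 12 0 0 x := by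
    rw [eliminate, run_block_cons, e₁]
    simp only [run_block_cons, run_block_nil, run_assign, run_put, eval_lit]
    rw [show xE.eval w h₁ = x by rw [xE, eval_var, f₁, S.x_eq]]
    rw [show yE.eval w (h₁.set 8 0 0 x) = y by
      rw [yE, eval_var, Store.set_of_ne _ (by norm_num), f₂, S.y_eq]]
    rw [show (var 8).eval w ((h₁.set 8 0 0 x).set 9 0 0 y) = x by
      rw [eval_var, Store.set_of_ne _ (by norm_num), Store.set_self]]
    rw [e₂, e₃, ← e₄]
    simp only [xE, yE, zE, eval_var, Store.set_of_ne, T₁, T₂, T₃, ne_eq, Nat.reduceEqDiff,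
      not_false_eq_true]
  have hf : ∀ f, 12 < f → eliminate.run w h f = h₄ f := fun f hf => by
    rw [E, Store.set_of_ne _ (by omega), Store.set_of_ne _ (by omega)]
  have hf' : ∀ f, 12 < f → f ≠ 30 → eliminate.run w h f = h₃ f := fun f hf₁ hf₂ => by
    rw [hf f hf₁, ← e₄]
    simp only [Store.set_of_ne _ hf₂]
  have hl : ∀ u v, labelOf M (eliminate.run w h) u v = labelOf M h₃ u v := fun u v =>
    labelOf_congr (fun f hf => by rw [hf' f (by omega) (by omega)])
      fun f hf => by rw [hf' f (by omega) (by omega)]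
  have h₃30 : h₃ 30 = h 30 := by
    rw [← e₃, run_of_not_writes w h₂ rfl, ← e₂, Store.set_of_ne _ (by omega),
      Store.set_of_ne _ (by omega), Store.set_of_ne _ (by omega), ← e₁, run_of_not_writes w h rfl]
  have h₄30 : ∀ u v : Fin n, h₄ 30 u v = if u = x ∧ v = y then 1 else if u = y ∧ v = x then 1 else
      if u = z ∨ v = z then 0 else h 30 u v := by
    intro u v
    have h0 : ∀ u : Fin n, ¬ (u = x ∨ u = y) → h 30 z u = 0 := fun u hu => by
      by_contra hne
      exact hu ((hz u).1 hne)
    have h0' : ∀ u : Fin n, ¬ (u = x ∨ u = y) → h 30 u z = 0 := fun u hu => by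
      by_contra hne
      exact hu ((hz u).1 (hsymm _ _ hne))
    rw [← e₄]
    simp only [Store.set, h₃30, true_and, Fin.val_inj]
    split_ifs <;> grind
  have hval : (fun u : Fin n => valOf M (eliminate.run w h) u) = fun u : Fin n => valOf M h u := by
    funext u c
    have hu : ∀ f, 12 < f → f ≠ 30 → (∀ f', f' = f → updateLabel.Writes f' = false) →
        eliminate.run w h f = h f := fun f hf₁ hf₂ hf₃ => by
      rw [hf' f hf₁ hf₂, ← e₃, run_of_not_writes w h₂ (hf₃ f rfl), ← e₂,
        Store.set_of_ne _ (by omega), Store.set_of_ne _ (by omega), Store.set_of_ne _ (by omega),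
        ← e₁, run_of_not_writes w h (hf₃ f rfl)]
    cases c <;> simp only [valOf, cond_true, cond_false] <;>
    rw [hu _ (by norm_num) (by norm_num) (by rintro _ rfl; rfl)]
  have R := Represents.eliminate H hxy hz (adj' := fun u v => eliminate.run w h 30 u v ≠ 0)
    (lab' := fun u v => labelOf M (eliminate.run w h) u v) (fun u v => by
      rw [hf 30 (by norm_num), h₄30]
      grind) (by rw [hl]; exact hlab) (by rw [hl, hl]; exact hrev)
    (fun u v h₁ h₂ => by
      rw [hl]
      simp only [← Fin.val_inj] at h₁ h₂
      refine labelOf_congr (fun f hf => hoff f u v (by omega) h₁ h₂)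
        fun f hf => hoff f v u (by omega) (by omega) (by omega))
  refine ⟨R.1, ?_, y, x, ?_, ?_, ?_⟩
  · rw [IsState, hval]
    exact R.2
  · rw [E, Store.set_of_ne _ (by norm_num), Store.set_self]
  · rw [E, Store.set_self]
  · rw [hf 30 (by norm_num), h₄30]
    simp [hxy, hxy.symm]

/-- Eliminates the vertex in the scalar `6` if it has exactly two neighbours. -/
def tryEliminate : Stmt :=
  seq scan (ite (add (sub (var 8) (lit 2)) (sub (lit 2) (var 8))) skip eliminate)

theorem run_tryEliminate (hn : w.getD 0 0 = n) (hM : h 1 0 0 + 1 = M) {z : Fin n}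
    (hz : h 6 0 0 = z) (H : IsState n M h V Z) (he : HasEdge n h) :
    ∃ V', IsState n M (tryEliminate.run w h) V' Z ∧ HasEdge n (tryEliminate.run w h) ∧
      V'.card ≤ V.card ∧ (V'.card < V.card ∨
        V' = V ∧ (∀ f, 30 ≤ f → tryEliminate.run w h f = h f) ∧
        ¬ ∃ x y : Fin n, x ≠ y ∧ ∀ u : Fin n, h 30 z u ≠ 0 ↔ u = x ∨ u = y) := by
  obtain ⟨h₁, h₂⟩ := run_scan hn hz
  obtain ⟨h', e⟩ : ∃ h', scan.run w h = h' := ⟨_, rfl⟩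
  have hw : ∀ f, scan.Writes f = false → h' f = h f := fun f hf => by
    rw [← e, run_of_not_writes w h hf]
  have hw' : ∀ f, 10 < f → h' f = h f := fun f hf => hw f (by
    simp [scan, Writes, forLoop, assign, block]
    omega)
  rw [e] at h₁ h₂
  have H' : IsState n M h' V Z :=
    H.congr (hw' _ (by norm_num)) (hw' _ (by norm_num)) fun f hf => hw' f (by omega)
  have he' : HasEdge n h' := by
    obtain ⟨x, y, h₁, h₂, h₃⟩ := he
    exact ⟨x, y, by rw [hw' _ (by norm_num), h₁], by rw [hw' _ (by norm_num), h₂],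
      by rwa [hw' _ (by norm_num)]⟩
  have hfilter : ∀ u : Fin n, (u : ℕ) ∈ (Finset.range n).filter (fun u => h 30 z u ≠ 0) ↔
      h 30 z u ≠ 0 := fun u => by simp
  rw [tryEliminate, run_seq, e, run_ite]
  by_cases h8 : h' 8 0 0 = 2
  · rw [if_pos (by simp only [eval_add, eval_sub, eval_var, eval_lit]; omega)]
    have hS := h₂ h8
    have hx : h' 9 0 0 ∈ (Finset.range n).filter (fun u => h 30 z u ≠ 0) := by rw [hS]; simp
    have hy : h' 10 0 0 ∈ (Finset.range n).filter (fun u => h 30 z u ≠ 0) := by rw [hS]; simp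
    have hne : h' 9 0 0 ≠ h' 10 0 0 := by
      intro hxy
      rw [h8, hS, hxy, Finset.pair_eq_singleton, Finset.card_singleton] at h₁
      omega
    rw [Finset.mem_filter, Finset.mem_range] at hx hy
    have hzx := Represents.ne H (u := z) (w := ⟨_, hx.1⟩) hx.2
    have hzy := Represents.ne H (u := z) (w := ⟨_, hy.1⟩) hy.2
    have S : Selected h' M (⟨_, hx.1⟩ : Fin n) (⟨_, hy.1⟩ : Fin n) z :=
      ⟨by rw [hw 1 rfl, hM], rfl, rfl, by rw [hw 6 rfl, hz], hne,
        fun hh => hzx (Fin.ext hh.symm), fun hh => hzy (Fin.ext hh.symm)⟩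
    obtain ⟨R₁, R₂, R₃⟩ := run_eliminate w S H' fun u => by
      rw [hw' 30 (by norm_num), ← hfilter, hS]
      simp [Fin.ext_iff]
    refine ⟨_, R₂, R₃, ?_, Or.inl ?_⟩
    · exact Finset.card_le_card (Finset.erase_subset _ _)
    · exact Finset.card_erase_lt_of_mem R₁
  · rw [if_neg (by simp only [eval_add, eval_sub, eval_var, eval_lit]; omega)]
    refine ⟨V, H', he', le_rfl, Or.inr ⟨rfl, fun f hf => hw' f (by omega), ?_⟩⟩
    rintro ⟨x, y, hxy, hu⟩
    have : (Finset.range n).filter (fun u => h 30 z u ≠ 0) = {(x : ℕ), (y : ℕ)} := by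
      ext u
      constructor
      · intro hu'
        rw [Finset.mem_filter, Finset.mem_range] at hu'
        rcases (hu ⟨u, hu'.1⟩).1 hu'.2 with rfl | rfl <;> simp
      · intro hu'
        rw [Finset.mem_insert, Finset.mem_singleton] at hu'
        rcases hu' with rfl | rfl
        · exact (hfilter x).2 ((hu x).2 (Or.inl rfl))
        · exact (hfilter y).2 ((hu y).2 (Or.inr rfl))
    rw [this, Finset.card_pair (fun h => hxy (Fin.ext h))] at h₁
    exact h8 h₁

/-- Tries every vertex once. -/
def eliminateRound : Stmt := forLoop 6 (lit 0) tryEliminate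

theorem run_eliminateRound (hn : w.getD 0 0 = n) (hM : h 1 0 0 + 1 = M) (H : IsState n M h V Z)
    (he : HasEdge n h) : ∃ V', IsState n M (eliminateRound.run w h) V' Z ∧
      HasEdge n (eliminateRound.run w h) ∧ V'.card ≤ max 2 (V.card - 1) := by
  have key := (run_forLoop (w := w) (i := 6) (c := 0) (k := n)
    (p := tryEliminate) (h := h) rfl hn
    (fun j h' => h' 1 0 0 + 1 = M ∧ ∃ V', IsState n M h' V' Z ∧ HasEdge n h' ∧
      V'.card ≤ V.card ∧ (V'.card < V.card ∨ ∀ z : Fin n, z < j →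
        ¬ ∃ x y : Fin n, x ≠ y ∧ ∀ u : Fin n, h' 30 z u ≠ 0 ↔ u = x ∨ u = y))
    (fun j h' x K => ?_) ⟨hM, V, H, he, le_rfl, Or.inr fun z hz => absurd hz (Nat.not_lt_zero _)⟩
    fun j hj h' hj' K => ?_).2
  · obtain ⟨V', H', he', hc, hd⟩ := key
    refine ⟨V', H', he', ?_⟩
    rcases hd with hd | hd
    · omega
    · refine le_max_of_le_left (not_lt.1 fun hlt => ?_)
      obtain ⟨z, -, x, y, hxy, hz⟩ := Represents.exists_degree_two H' hlt
      exact hd z z.2 ⟨x, y, hxy, hz⟩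
  · have e : ∀ f, f ≠ 6 → h'.set 6 0 0 x f = h' f := fun f hf => Store.set_of_ne _ hf _ _ _
    obtain ⟨K₁, V', K₂, ⟨a, b, K₃⟩, K₄, K₅⟩ := K
    refine ⟨by rwa [e 1 (by norm_num)], V', K₂.congr (e _ (by norm_num)) (e _ (by norm_num))
      fun f hf => e f (by omega), ⟨a, b, ?_⟩, K₄, ?_⟩
    · rwa [e 11 (by norm_num), e 12 (by norm_num), e 30 (by norm_num)]
    · rwa [e 30 (by norm_num)]
  · obtain ⟨K₁, V', K₂, K₃, K₄, K₅⟩ := K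
    obtain ⟨V'', J₁, J₂, J₃, J₄⟩ := run_tryEliminate w hn K₁ (z := ⟨j, hj⟩) hj' K₂ K₃
    refine ⟨?_, V'', J₁, J₂, J₃.trans K₄, ?_⟩
    · rw [run_of_not_writes w h' rfl, K₁]
    · rcases J₄ with J₄ | ⟨rfl, J₅, J₆⟩
      · exact Or.inl (J₄.trans_le K₄)
      · refine K₅.imp_right fun K₅ z hz => ?_
        rw [J₅ 30 le_rfl]
        rcases Nat.lt_succ_iff_lt_or_eq.1 hz with hz | hz
        · exact K₅ z hz
        · obtain rfl : z = ⟨j, hj⟩ := Fin.ext hz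
          exact J₆

/-- After sufficiently many rounds only two vertices are left. -/
theorem run_eliminateRounds (hn : w.getD 0 0 = n) (hM : h 1 0 0 + 1 = M) (H : IsState n M h V Z)
    (he : HasEdge n h) : ∃ V', IsState n M ((rep (lit 0) eliminateRound).run w h) V' Z ∧
      HasEdge n ((rep (lit 0) eliminateRound).run w h) ∧ V'.card ≤ 2 := by
  have key := (run_rep_induction (w := w) (k := n) (e := lit 0)
    (p := eliminateRound) (h := h) hn
    (fun j h' => h' 1 0 0 + 1 = M ∧ ∃ V', IsState n M h' V' Z ∧ HasEdge n h' ∧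
      V'.card ≤ max 2 (n - j))
    ⟨hM, V, H, he, le_max_of_le_right (by simpa using Finset.card_le_univ V)⟩
    fun j hj h' K => ?_).2
  · obtain ⟨V', H', he', hc⟩ := key
    exact ⟨V', H', he', by omega⟩
  · obtain ⟨K₁, V', K₂, K₃, K₄⟩ := K
    obtain ⟨V'', J₁, J₂, J₃⟩ := run_eliminateRound w hn K₁ K₂ K₃
    exact ⟨by rw [run_of_not_writes w h' rfl, K₁], V'', J₁, J₂, by omega⟩

/-- The sum over the connected 2-partitions, read off from the label of the last edge. -/
def totalE : Expr :=
  let s := var 11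
  let t := var 12
  mul (lit 1) (add
    (mul (valE true t) (add (mul (valE true s) (connE true s t))
      (mul (valE false s) (cutE false s t))))
    (mul (valE false t) (add (mul (valE false s) (connE false s t))
      (mul (valE true s) (cutE true s t)))))

/-- Resets the adjacency matrix and gives all pairs the label of a single edge. -/
def initArrays : Stmt := block [
  fill 30 0, fill 31 1, fill 32 1, fill 33 1, fill 34 0, fill 35 0, fill 36 0, fill 37 0]

theorem run_initArrays (hn : w.getD 0 0 = n) : ∀ u < n, ∀ v < n, ∀ h₁, initArrays.run w h = h₁ →
    h₁ 30 u v = 0 ∧ h₁ 31 u v = 1 ∧ h₁ 32 u v = 1 ∧ h₁ 33 u v = 1 ∧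
      h₁ 34 u v = 0 ∧ h₁ 35 u v = 0 ∧ h₁ 36 u v = 0 ∧ h₁ 37 u v = 0 := by
  rintro u hu v hv h₁ rfl
  have F : ∀ f c f' (h : Store), f' ≠ 7 → f' ≠ 8 → f' ≠ f → (fill f c).run w h f' = h f' :=
    fun f c f' h h₁ h₂ h₃ => run_of_not_writes w h (by simp [fill, forLoop, assign, Writes]; omega)
  simp only [initArrays, run_block_cons, run_block_nil]
  refine ⟨?_, ?_, ?_, ?_, ?_, ?_, ?_, ?_⟩ <;>
  · try simp only [F, ne_eq, Nat.reduceEqDiff, not_false_eq_true]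
    rw [run_fill hn (by norm_num) (by norm_num) _ u hu v hv]

/-- Computes the sum over all connected 2-partitions and, from it, the number of those that are
counted by the coefficient of the power in the scalar `4`. -/
def count : Stmt :=
  seq initArrays (seq readEdges (seq (rep (lit 0) eliminateRound) (assign 16 (div totalE (var 4)))))

/-- The counting program determines the residue of a representative `K` of the sum. -/
theorem run_count (hn : w.getD 0 0 = n) {m : ℕ} (hm : w.getD 1 0 = m) (hm₀ : 0 < m)
    {a b : ℕ → Fin n} (ha : ∀ e < m, w.getD (2 + (e + e)) 0 = a e)
    (hb : ∀ e < m, w.getD (3 + (e + e)) 0 = b e) (hM : h 1 0 0 + 1 = M)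
    (H : Represents (fun u : Fin n => valOf M h u)
      (fun u v => ∃ e < m, (a e = u ∧ b e = v) ∨ (a e = v ∧ b e = u)) (fun _ _ => unit) V Z)
    {K : ℕ} (hK : Z = K) : count.run w h 16 0 0 = K % M / h 4 0 0 := by
  obtain ⟨h₁, e₁⟩ : ∃ h₁, initArrays.run w h = h₁ := ⟨_, rfl⟩
  have hc : count.run w h = (assign 16 (div totalE (var 4))).run w
      ((rep (lit 0) eliminateRound).run w (readEdges.run w h₁)) := by
    rw [count, run_seq, run_seq, run_seq, e₁]
  have hfill := fun u hu v hv => run_initArrays w (h := h) hn u hu v hv h₁ e₁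
  obtain ⟨hE₁, hE₂⟩ := run_readEdges (w := w) (n := n) hm (h := h₁) fun u hu v hv =>
    (hfill u hu v hv).1
  obtain ⟨h₂, e₂⟩ : ∃ h₂, readEdges.run w h₁ = h₂ := ⟨_, rfl⟩
  rw [e₂] at hc hE₁ hE₂
  have hE₃ : ∀ u v : Fin n, h₂ 30 u v ≠ 0 ↔
      ∃ e < m, (a e = u ∧ b e = v) ∨ (a e = v ∧ b e = u) := by
    intro u v
    rw [hE₁ u u.2 v v.2]
    refine exists_congr fun e => and_congr_right fun he => ?_
    rw [ha e he, hb e he]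
    simp only [Fin.val_inj]
  have w₂ : ∀ f, f ≠ 6 → f ≠ 11 → f ≠ 12 → f ≠ 30 → h₂ f = h₁ f := fun f f₁ f₂ f₃ f₄ => by
    rw [← e₂, run_of_not_writes w h₁]
    simp [readEdges, forLoop, assign, block, Writes]
    omega
  have hlab : ∀ u v : Fin n, labelOf M h₂ u v = unit := by
    intro u v
    obtain ⟨-, f₁, f₂, f₃, f₄, f₅, f₆, f₇⟩ := hfill u u.2 v v.2
    obtain ⟨-, -, -, f₃', -⟩ := hfill v v.2 u u.2
    ext c <;> cases c <;> simp [labelOf, unit, w₂, f₁, f₂, f₃, f₄, f₅, f₆, f₇, f₃']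
  have hw₁ : ∀ f, initArrays.Writes f = false → h₁ f = h f := fun f hf => by
    rw [← e₁, run_of_not_writes w h hf]
  have hval : (fun u : Fin n => valOf M h₂ u) = fun u : Fin n => valOf M h u := by
    funext u c
    cases c <;> simp only [valOf, cond_true, cond_false] <;>
    rw [w₂ _ (by norm_num) (by norm_num) (by norm_num) (by norm_num), hw₁ _ rfl]
  have S₂ : IsState n M h₂ V Z := by
    rw [IsState, hval]
    simp only [hlab, hE₃]
    exact H
  have G₂ : HasEdge n h₂ := by
    obtain ⟨e, he, h₁, h₂⟩ := hE₂ hm₀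
    refine ⟨a e, b e, ?_, ?_, (hE₃ _ _).2 ⟨e, he, Or.inl ⟨rfl, rfl⟩⟩⟩
    · rw [← h₁, ha e he]
    · rw [← h₂, hb e he]
  have M₂ : h₂ 1 0 0 + 1 = M := by
    rw [w₂ _ (by norm_num) (by norm_num) (by norm_num) (by norm_num), hw₁ _ rfl, hM]
  obtain ⟨V', S₃, ⟨x, y, hx, hy, hxy⟩, hc'⟩ := run_eliminateRounds w hn M₂ S₂ G₂
  obtain ⟨h₃, e₃⟩ : ∃ h₃, (rep (lit 0) eliminateRound).run w h₂ = h₃ := ⟨_, rfl⟩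
  rw [e₃] at hc S₃ hx hy hxy
  have hw₃ : ∀ f, (rep (lit 0) eliminateRound).Writes f = false → h₃ f = h₂ f := fun f hf => by
    rw [← e₃, run_of_not_writes w h₂ hf]
  have M₃ : h₃ 1 0 0 + 1 = M := by rw [hw₃ 1 rfl, M₂]
  have hT : (totalE.eval w h₃ : ZMod M) = K := by
    rw [← hK, Represents.eq_total S₃ hc' hxy]
    simp [totalE, total, contract, valE, connE, cutE, valOf, labelOf, hx, hy, M₃]
  have hT' : totalE.eval w h₃ = K % M := by
    have h₁ := (ZMod.natCast_eq_natCast_iff _ _ _).1 hT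
    have h₂ : totalE.eval w h₃ < M := by
      rw [totalE, eval_mul, M₃]
      exact Nat.mod_lt _ (by omega)
    rw [← Nat.mod_eq_of_lt h₂]
    exact h₁
  have h4 : h₃ 4 = h 4 := by
    rw [hw₃ 4 rfl, w₂ _ (by norm_num) (by norm_num) (by norm_num) (by norm_num), hw₁ _ rfl]
  rw [hc, run_assign, Store.set_self, eval_div, eval_var, hT', h4]

end

end BoundedLoop

/-! ### Counting the balanced partitions -/

/-- A digit of a sum of few powers of the base counts how often the power with that exponent
occurs. -/
theorem sum_pow_mod_div {ι : Type*} (F : Finset ι) (f : ι → ℕ) {b : ℕ} (W : ℕ) (hF : F.card < b) :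
    (∑ A ∈ F, b ^ f A) % b ^ (W + 1) / b ^ W = (F.filter fun A => f A = W).card := by
  have hb : 0 < b := by omega
  have h₁ : ∑ A ∈ F.filter (fun A => ¬ f A < W), b ^ f A =
      b ^ W * ((F.filter fun A => f A = W).card +
        b * ∑ A ∈ F.filter (fun A => W < f A), b ^ (f A - W - 1)) := by
    rw [mul_add, ← mul_assoc, ← pow_succ, Finset.mul_sum, ← Finset.sum_filter_add_sum_filter_not
      (F.filter fun A => ¬ f A < W) (fun A => f A = W), Finset.filter_filter, Finset.filter_filter]
    congr 1
    · rw [Finset.filter_congr (q := fun A => f A = W) fun A _ => by omega,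
        Finset.sum_congr rfl (g := fun _ => b ^ W), Finset.sum_const, smul_eq_mul, mul_comm]
      intro A hA
      rw [(Finset.mem_filter.1 hA).2]
    · rw [Finset.filter_congr (q := fun A => W < f A) fun A _ => by omega]
      refine Finset.sum_congr rfl fun A hA => ?_
      have := (Finset.mem_filter.1 hA).2
      rw [← pow_add]
      congr 1
      omega
  have h₂ : ∑ A ∈ F.filter (fun A => f A < W), b ^ f A < b ^ W := by
    refine lt_of_mul_lt_mul_left (a := b) ?_ hb.le
    rw [Finset.mul_sum]
    calc ∑ A ∈ F.filter (fun A => f A < W), b * b ^ f A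
        ≤ ∑ A ∈ F.filter (fun A => f A < W), b ^ W := by
          refine Finset.sum_le_sum fun A hA => ?_
          rw [← pow_succ']
          exact Nat.pow_le_pow_right hb (Finset.mem_filter.1 hA).2
      _ ≤ F.card * b ^ W := by
          rw [Finset.sum_const, smul_eq_mul]
          exact Nat.mul_le_mul_right _ (Finset.card_filter_le _ _)
      _ < b * b ^ W := Nat.mul_lt_mul_of_pos_right hF (pow_pos hb W)
  have h₃ : (F.filter fun A => f A = W).card < b := (Finset.card_filter_le _ _).trans_lt hF
  rw [pow_succ, Nat.mod_mul_right_div_self,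
    ← Finset.sum_filter_add_sum_filter_not F (fun A => f A < W), h₁,
    Nat.add_mul_div_left _ _ (pow_pos hb W), Nat.div_eq_of_lt h₂, zero_add,
    Nat.add_mul_mod_self_left, Nat.mod_eq_of_lt h₃]

section Words

variable {n : ℕ}

/-- The indicator word of a vertex set. -/
def indicator (A : Finset (Fin n)) : List ℕ := List.ofFn fun v => if v ∈ A then 1 else 0

theorem indicator_injective : Function.Injective (indicator (n := n)) := by
  intro A B h
  ext v
  have := congrFun (List.ofFn_injective h) v
  by_cases h₁ : v ∈ A <;> by_cases h₂ : v ∈ B <;> simp_all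

/-- The set does not contradict the beginning `o` of an indicator word. -/
def Consistent (o : List ℕ) (A : Finset (Fin n)) : Prop :=
  ∀ u : Fin n, (o[(u : ℕ)]? = some 0 → u ∉ A) ∧ (o[(u : ℕ)]? = some 1 → u ∈ A)

theorem prefix_indicator_iff {o : List ℕ} (ho : ∀ x ∈ o, x = 0 ∨ x = 1) (hl : o.length ≤ n)
    (A : Finset (Fin n)) : o <+: indicator A ↔ Consistent o A := by
  rw [List.prefix_iff_getElem]
  constructor
  · rintro ⟨_, h⟩ u
    constructor <;> intro hu <;> obtain ⟨hu, h'⟩ := List.getElem?_eq_some_iff.1 hu <;>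
    have := h u hu <;> rw [h'] at this <;> simp [indicator] at this
    · exact this
    · exact this
  · intro h
    refine ⟨by simpa [indicator] using hl, fun x hx => ?_⟩
    obtain ⟨h₁, h₂⟩ := h ⟨x, by omega⟩
    simp only [indicator, List.getElem_ofFn]
    rcases ho _ (List.getElem_mem hx) with h0 | h0
    · rw [h0, if_neg (h₁ (List.getElem?_eq_some_iff.2 ⟨hx, h0⟩))]
    · rw [h0, if_pos (h₂ (List.getElem?_eq_some_iff.2 ⟨hx, h0⟩))]

/-- The number of words in `S` that begin with `o`. -/
def prefixCount (S : Finset (List ℕ)) (o : List ℕ) : ℕ := (S.filter fun s => o <+: s).card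

open scoped Classical in
/-- The indicator words of the balanced connected 2-partitions of a graph with the edges `K` and the
vertex weights `wt`. -/
noncomputable def balancedWords (K : Multiset (Sym2 (Fin n))) (wt : Fin n → ℕ) :
    Finset (List ℕ) :=
  (Finset.univ.filter fun A => IsBond K Finset.univ A ∧ 2 * ∑ v ∈ A, wt v = ∑ v, wt v).image
    indicator

/-- The number of balanced partitions as a coefficient of a sum of powers. -/
theorem prefixCount_balancedWords (K : Multiset (Sym2 (Fin n))) (wt : Fin n → ℕ) {o : List ℕ}
    (ho : ∀ x ∈ o, x = 0 ∨ x = 1) (hl : o.length ≤ n) {R : Type} [CommSemiring R]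
    {v : Fin n → Bool → R} (b : ℕ) (hb : 2 ^ n < b)
    (h₁ : ∀ u : Fin n, v u true = if o[(u : ℕ)]? = some 0 then 0 else (b : R) ^ (2 * wt u))
    (h₂ : ∀ u : Fin n, v u false = if o[(u : ℕ)]? = some 1 then 0 else 1) :
    ∃ S : ℕ, classSum v true Finset.univ Finset.univ (IsBond K Finset.univ) = S ∧
      S % b ^ (∑ v, wt v + 1) / b ^ (∑ v, wt v) = prefixCount (balancedWords K wt) o := by
  classical
  refine ⟨∑ A ∈ (subsetsWith Finset.univ (IsBond K Finset.univ)).filter (Consistent o),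
    b ^ (2 * ∑ v ∈ A, wt v), ?_, ?_⟩
  · rw [Finset.sum_filter, Nat.cast_sum, classSum]
    refine Finset.sum_congr rfl fun A _ => ?_
    rw [colourWt]
    split_ifs with hA
    · rw [Nat.cast_pow, Finset.mul_sum, ← Finset.prod_pow_eq_pow_sum,
        ← Finset.prod_filter_mul_prod_filter_not Finset.univ (fun u => u ∈ A)]
      have e₁ : ∏ u ∈ Finset.univ.filter (fun u => ¬ u ∈ A),
          v u (if u ∈ A then true else !true) = 1 := by
        refine Finset.prod_eq_one fun u hu => ?_
        have hu := (Finset.mem_filter.1 hu).2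
        rw [if_neg hu, Bool.not_true, h₂, if_neg fun h => hu ((hA u).2 h)]
      rw [e₁, mul_one, Finset.filter_mem_eq_inter, Finset.univ_inter]
      refine Finset.prod_congr rfl fun u hu => ?_
      rw [if_pos hu, h₁, if_neg fun h => (hA u).1 h hu]
    · rw [Consistent] at hA
      push Not at hA
      obtain ⟨u, hu⟩ := hA
      rw [Nat.cast_zero]
      refine Finset.prod_eq_zero (Finset.mem_univ u) ?_
      by_cases hA : u ∈ A
      · rw [if_pos hA, h₁, if_pos]
        by_contra h
        exact (hu fun h' => absurd h' h).2 hA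
      · rw [if_neg hA, Bool.not_true, h₂, if_pos (hu fun _ => hA).1]
  · rw [sum_pow_mod_div]
    · rw [prefixCount, balancedWords, Finset.filter_image,
        Finset.card_image_of_injective _ indicator_injective]
      congr 1
      ext A
      simp only [Finset.mem_filter, mem_subsetsWith, Finset.subset_univ, Finset.mem_univ, true_and,
        prefix_indicator_iff ho hl]
      tauto
    · refine (Finset.card_le_univ _).trans_lt ?_
      rwa [Fintype.card_finset, Fintype.card_fin]

end Words

/-! ### Unranking words -/

section Unranking

variable {S : Finset (List ℕ)} {n : ℕ}

/-- The first `k` letters of word number `r` of a set of 0-1-words of equal length, and its number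
among the words with this beginning; words with the letter `1` come before those with `0`. -/
def unrank (S : Finset (List ℕ)) : ℕ → ℕ → List ℕ × ℕ
  | 0, r => ([], r)
  | k + 1, r =>
    if (unrank S k r).2 < prefixCount S ((unrank S k r).1 ++ [1]) then
      ((unrank S k r).1 ++ [1], (unrank S k r).2)
    else
      ((unrank S k r).1 ++ [0], (unrank S k r).2 - prefixCount S ((unrank S k r).1 ++ [1]))

theorem unrank_length (k r : ℕ) : (unrank S k r).1.length = k := by
  induction k with
  | zero => rfl
  | succ k ih => rw [unrank]; split_ifs <;> simp [ih]

theorem unrank_mem (k r : ℕ) : ∀ x ∈ (unrank S k r).1, x = 0 ∨ x = 1 := by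
  induction k with
  | zero => simp [unrank]
  | succ k ih =>
    intro x hx
    rw [unrank] at hx
    split_ifs at hx <;> rw [List.mem_append, List.mem_singleton] at hx
    exacts [hx.elim (ih x) Or.inr, hx.elim (ih x) Or.inl]

theorem unrank_injective (k : ℕ) : Function.Injective (unrank S k) := by
  induction k with
  | zero => intro r r' h; exact congrArg Prod.snd h
  | succ k ih =>
    intro r r' h
    rw [unrank, unrank] at h
    split_ifs at h with h₁ h₂ h₂ <;> rw [Prod.mk.injEq] at h
    · exact ih (Prod.ext (by simpa using h.1) h.2)
    · simp at h
    · simp at h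
    · have e : (unrank S k r).1 = (unrank S k r').1 := by simpa using h.1
      rw [e] at h h₁
      exact ih (Prod.ext e (by omega))

/-- The words in `S` are 0-1-words of the length `n`. -/
def IsBinary (S : Finset (List ℕ)) (n : ℕ) : Prop :=
  ∀ s ∈ S, s.length = n ∧ ∀ x ∈ s, x = 0 ∨ x = 1

theorem prefixCount_eq_add (hS : IsBinary S n) {o : List ℕ} (ho : o.length < n) :
    prefixCount S o = prefixCount S (o ++ [1]) + prefixCount S (o ++ [0]) := by
  classical
  rw [prefixCount, prefixCount, prefixCount, ← Finset.card_union_of_disjoint]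
  · congr 1
    ext s
    simp only [Finset.mem_filter, Finset.mem_union, ← and_or_left]
    refine and_congr_right fun hs => ⟨?_, ?_⟩
    · rintro ⟨t, rfl⟩
      obtain ⟨hl, hx⟩ := hS _ hs
      cases t with
      | nil => rw [List.append_nil] at hl; omega
      | cons x t =>
        rcases hx x (by simp) with rfl | rfl
        · exact Or.inr ⟨t, by simp⟩
        · exact Or.inl ⟨t, by simp⟩
    · rintro (h | h) <;> exact (List.prefix_append _ _).trans h
  · rw [Finset.disjoint_left]
    intro s h₁ h₂
    obtain ⟨t, rfl⟩ := (Finset.mem_filter.1 h₁).2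
    obtain ⟨t', h⟩ := (Finset.mem_filter.1 h₂).2
    simp at h

theorem unrank_lt (hS : IsBinary S n) {k r : ℕ} (hk : k ≤ n) (hr : r < S.card) :
    (unrank S k r).2 < prefixCount S (unrank S k r).1 := by
  induction k with
  | zero => simpa [unrank, prefixCount] using hr
  | succ k ih =>
    have h := ih (by omega)
    have h' := prefixCount_eq_add hS (o := (unrank S k r).1) (by rw [unrank_length]; omega)
    rw [unrank]
    split_ifs
    · assumption
    · dsimp only
      omega

theorem unrank_mem_and_eq_zero (hS : IsBinary S n) {r : ℕ} (hr : r < S.card) :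
    (unrank S n r).1 ∈ S ∧ (unrank S n r).2 = 0 := by
  have h := unrank_lt hS le_rfl hr
  have h₁ : ∀ s ∈ S.filter (fun s => (unrank S n r).1 <+: s), s = (unrank S n r).1 := by
    intro s hs
    obtain ⟨hs, hp⟩ := Finset.mem_filter.1 hs
    exact (hp.eq_of_length (by rw [unrank_length, (hS s hs).1])).symm
  obtain ⟨s, hs⟩ := Finset.card_pos.1 (Nat.zero_lt_of_lt h)
  have hc : prefixCount S (unrank S n r).1 ≤ 1 :=
    Finset.card_le_one.2 fun a ha b hb => (h₁ a ha).trans (h₁ b hb).symm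
  exact ⟨h₁ s hs ▸ (Finset.mem_filter.1 hs).1, by omega⟩

/-- Every word has exactly one number. -/
theorem existsUnique_unrank (hS : IsBinary S n) {s : List ℕ} (hs : s ∈ S) :
    ∃! r, r < S.card ∧ (unrank S n r).1 = s := by
  have hinj : ∀ r < S.card, ∀ r' < S.card, (unrank S n r).1 = (unrank S n r').1 → r = r' :=
    fun r hr r' hr' h => unrank_injective n (Prod.ext h (by
      rw [(unrank_mem_and_eq_zero hS hr).2, (unrank_mem_and_eq_zero hS hr').2]))
  obtain ⟨r, hr, h⟩ := Finset.surj_on_of_inj_on_of_card_le (s := Finset.range S.card) (t := S)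
    (fun r _ => (unrank S n r).1)
    (fun r hr => (unrank_mem_and_eq_zero hS (Finset.mem_range.1 hr)).1)
    (fun r r' hr hr' h => hinj r (Finset.mem_range.1 hr) r' (Finset.mem_range.1 hr') h)
    (by rw [Finset.card_range]) s hs
  exact ⟨r, ⟨Finset.mem_range.1 hr, h.symm⟩, fun r' hr' =>
    hinj r' hr'.1 r (Finset.mem_range.1 hr) (hr'.2.trans h)⟩

end Unranking

/-! ### The sampling program -/

/-! The sampling program uses the arrays of the counting program and these scalars.

* `0`: nonzero if the random number is accepted; `2`: the random number.
* `3`: the base, `2 ^ (n + 1)`; `5`: the vertex for which the output is determined.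
* `13`: the number of balanced partitions; `14`: the number `2 ^ n`.
* `15`: the number of the wanted word among those that begin with the output so far. -/

namespace BoundedLoop

open BoundedLoop.Expr BoundedLoop.Stmt

/-- The word `w` encodes a graph with `n` vertices, the vertex weights `wt` and `m` edges, where the
edge number `e` joins `a e` and `b e`. -/
structure IsInput (w : List ℕ) (n m : ℕ) (a b : ℕ → Fin n) (wt : Fin n → ℕ) : Prop where
  n_eq : w.getD 0 0 = n
  m_eq : w.getD 1 0 = m
  m_pos : 0 < m
  a_eq : ∀ e < m, w.getD (2 + (e + e)) 0 = a e
  b_eq : ∀ e < m, w.getD (3 + (e + e)) 0 = b e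
  wt_eq : ∀ i : Fin n, w.getD (2 + (m + m + i)) 0 = wt i

/-- Doubles a scalar. -/
def double (f : ℕ) : Stmt := assign f (add (var f) (var f))

/-- Multiplies a scalar by `2 ^ (n + 1)`. -/
def shift (f : ℕ) : Stmt := seq (double f) (rep (lit 0) (double f))

/-- The position in the input of the weight of the vertex in the scalar `6`. -/
def weightE : Expr := add (lit 2) (add (add (inp (lit 1)) (inp (lit 1))) (var 6))

/-- Computes the base `2 ^ (n + 1)` in the scalar `3`, its power with the sum of all weights as the
exponent in the scalar `4`, and sets the modulus to the next power. -/
def initPowers : Stmt := block [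
  assign 3 (lit 2), rep (lit 0) (double 3),
  assign 4 (lit 1), forLoop 6 (lit 0) (rep weightE (shift 4)),
  assign 1 (var 4), shift 1, assign 1 (sub (var 1) (lit 1))]

/-- Gives the vertices their weights in the sum over the connected 2-partitions: a vertex of weight
`k` has the weight `b ^ (2 * k)` in the first class, where `b` is the base, and `1` in the second
one. -/
def initWeights : Stmt := forLoop 6 (lit 0) (block [
  put 20 (var 6) (lit 0) (lit 1), put 21 (var 6) (lit 0) (lit 1),
  rep weightE (put 20 (var 6) (lit 0)
    (mul (mul (get 20 (var 6) (lit 0)) (var 3)) (var 3)))])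

/-- Determines the next letter of the output. The vertex is forbidden in one of the classes by setting
its weight there to `0`. After the count, `16` holds the number of words that continue the
output with the letter `1`, and `15` holds the number of the wanted word. -/
def nextLetter : Stmt := block [
  put 21 (var 5) (lit 0) (lit 0), count,
  ite (sub (var 16) (var 15)) (write (lit 1)) (block [
    assign 15 (sub (var 15) (var 16)),
    put 20 (var 5) (lit 0) (lit 0), put 21 (var 5) (lit 0) (lit 1), write (lit 0)])]

/-- Determines the number of the wanted word and whether the random number is accepted. -/
def select : Stmt := block [
  count, assign 13 (var 16), assign 14 (lit 1), rep (lit 0) (double 14),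
  assign 0 (sub (mul (div (var 14) (var 13)) (var 13)) (var 2)),
  assign 15 (sub (var 2) (mul (div (var 2) (var 13)) (var 13)))]

/-- The sampling program. -/
def sampler : Stmt :=
  seq initPowers (seq initWeights (seq select (forLoop 5 (lit 0) nextLetter)))

section

variable {n m : ℕ} {a b : ℕ → Fin n} {wt : Fin n → ℕ} {w : List ℕ} {h : Store}

theorem run_double (f : ℕ) : (double f).run w h f 0 0 = 2 * h f 0 0 := by
  rw [double, run_assign, Store.set_self, eval_add, eval_var, two_mul]

theorem run_doubles (f : ℕ) (hn : w.getD 0 0 = n) :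
    (rep (lit 0) (double f)).run w h f 0 0 = 2 ^ n * h f 0 0 :=
  run_rep_induction (w := w) (e := lit 0) (p := double f) (h := h) hn
    (fun j h' => h' f 0 0 = 2 ^ j * h f 0 0) (by simp) fun j _ h' H => by
      rw [run_double, H, pow_succ]; ring

theorem run_shift (f : ℕ) (hn : w.getD 0 0 = n) :
    (shift f).run w h f 0 0 = 2 ^ (n + 1) * h f 0 0 := by
  rw [shift, run_seq, run_doubles f hn, run_double, pow_succ]
  ring

theorem eval_weightE (I : IsInput w n m a b wt) {i : Fin n} (hi : h 6 0 0 = i) :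
    w.getD (weightE.eval w h) 0 = wt i := by
  simp only [weightE, eval_add, eval_lit, eval_inp, eval_var, I.m_eq, hi, I.wt_eq]

/-- The value of the base. -/
theorem run_initPowers (I : IsInput w n m a b wt) : initPowers.run w h 3 0 0 = 2 ^ (n + 1) ∧
    initPowers.run w h 4 0 0 = (2 ^ (n + 1)) ^ (∑ v, wt v) ∧
    initPowers.run w h 1 0 0 + 1 = (2 ^ (n + 1)) ^ (∑ v, wt v + 1) := by
  have hn := I.n_eq
  obtain ⟨h₁, e₁⟩ : ∃ h₁, (rep (lit 0) (double 3)).run w ((assign 3 (lit 2)).run w h) = h₁ :=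
    ⟨_, rfl⟩
  have k₁ : h₁ 3 0 0 = 2 ^ (n + 1) := by
    rw [← e₁, run_doubles 3 hn, run_assign, Store.set_self, eval_lit, pow_succ]
  obtain ⟨h₂, e₂⟩ : ∃ h₂, (forLoop 6 (lit 0) (rep weightE (shift 4))).run w
    ((assign 4 (lit 1)).run w h₁) = h₂ := ⟨_, rfl⟩
  have k₂ : h₂ 4 0 0 = (2 ^ (n + 1)) ^ (∑ v, wt v) := by
    have H := run_forLoop (w := w) (i := 6) (c := 0) (k := n) (p := rep weightE (shift 4))
      (h := (assign 4 (lit 1)).run w h₁) rfl hn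
      (fun j h' => h' 4 0 0 =
        (2 ^ (n + 1)) ^ (∑ v ∈ Finset.univ.filter fun v : Fin n => v < j, wt v))
      (fun j h' x K => ?_) ?_ fun j hj h' hj' K => ?_
    · rw [e₂] at H
      rw [H, Finset.filter_true_of_mem fun v _ => v.2]
    · rwa [Store.set_of_ne _ (by norm_num)]
    · simp [Store.set_self]
    · have hs : (Finset.univ.filter fun v : Fin n => (v : ℕ) < j + 1) =
          insert ⟨j, hj⟩ (Finset.univ.filter fun v : Fin n => (v : ℕ) < j) := by
        ext v
        simp [Fin.ext_iff]
        omega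
      rw [hs, Finset.sum_insert (by simp), pow_add, ← K]
      exact run_rep_induction (w := w) (e := weightE) (p := shift 4) (h := h')
        (eval_weightE I (i := ⟨j, hj⟩) hj')
        (fun i h'' => h'' 4 0 0 = (2 ^ (n + 1)) ^ i * h' 4 0 0) (by simp) fun i _ h'' K' => by
          rw [run_shift 4 hn, K', pow_succ]; ring
  have w₂ : ∀ f, f ≠ 6 → f ≠ 4 → h₂ f = h₁ f := fun f hf₁ hf₂ => by
    rw [← e₂, run_of_not_writes w _ (by
      simp [forLoop, assign, shift, double, Writes]; omega), run_assign, Store.set_of_ne _ hf₂]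
  obtain ⟨h₃, e₃⟩ : ∃ h₃, (shift 1).run w ((assign 1 (var 4)).run w h₂) = h₃ := ⟨_, rfl⟩
  have k₃ : h₃ 1 0 0 = (2 ^ (n + 1)) ^ (∑ v, wt v + 1) := by
    rw [← e₃, run_shift 1 hn, run_assign, Store.set_self, eval_var, k₂]
    exact (pow_succ' _ _).symm
  have w₃ : ∀ f, f ≠ 1 → h₃ f = h₂ f := fun f hf => by
    rw [← e₃, run_of_not_writes w _ (by simp [assign, shift, double, Writes]; omega), run_assign,
      Store.set_of_ne _ hf]
  have e : initPowers.run w h = h₃.set 1 0 0 (h₃ 1 0 0 - 1) := by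
    rw [initPowers, run_block_cons, run_block_cons, e₁, run_block_cons, run_block_cons, e₂,
      run_block_cons, run_block_cons, e₃, run_block_cons, run_block_nil, run_assign]
    rfl
  rw [e, Store.set_of_ne _ (by norm_num), Store.set_of_ne _ (by norm_num), Store.set_self,
    w₃ 3 (by norm_num), w₃ 4 (by norm_num), w₂ 3 (by norm_num) (by norm_num), k₁, k₂, k₃]
  exact ⟨rfl, rfl, Nat.sub_add_cancel (Nat.one_le_iff_ne_zero.2 (by positivity))⟩

/-- The scalars and the vertex weights are those for counting the words that begin with `o`. -/
structure Ready (n : ℕ) (wt : Fin n → ℕ) (o : List ℕ) (h : Store) : Prop where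
  top : h 4 0 0 = (2 ^ (n + 1)) ^ (∑ v, wt v)
  modulus : h 1 0 0 + 1 = (2 ^ (n + 1)) ^ (∑ v, wt v + 1)
  val_true : ∀ u : Fin n, (h 20 u 0 : ZMod ((2 ^ (n + 1)) ^ (∑ v, wt v + 1))) =
    if o[(u : ℕ)]? = some 0 then 0 else ((2 ^ (n + 1) : ℕ) : ZMod _) ^ (2 * wt u)
  val_false : ∀ u : Fin n, (h 21 u 0 : ZMod ((2 ^ (n + 1)) ^ (∑ v, wt v + 1))) =
    if o[(u : ℕ)]? = some 1 then 0 else 1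

theorem Ready.congr {o : List ℕ} {h' : Store} (H : Ready n wt o h)
    (hf : ∀ f ∈ [1, 4, 20, 21], h' f = h f) : Ready n wt o h' := by
  have e₁ := hf 1 (by simp)
  have e₂ := hf 4 (by simp)
  have e₃ := hf 20 (by simp)
  have e₄ := hf 21 (by simp)
  obtain ⟨h₁, h₂, h₃, h₄⟩ := H
  exact ⟨by rwa [e₂], by rwa [e₁], by rwa [e₃], by rwa [e₄]⟩

theorem run_initWeights (I : IsInput w n m a b wt) (h₁ : h 3 0 0 = 2 ^ (n + 1))
    (h₂ : h 4 0 0 = (2 ^ (n + 1)) ^ (∑ v, wt v))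
    (h₃ : h 1 0 0 + 1 = (2 ^ (n + 1)) ^ (∑ v, wt v + 1)) :
    Ready n wt [] (initWeights.run w h) := by
  set M := (2 ^ (n + 1)) ^ (∑ v, wt v + 1) with hM
  have key := run_forLoop (w := w) (i := 6) (c := 0) (k := n) (h := h) (p := block [
      put 20 (var 6) (lit 0) (lit 1), put 21 (var 6) (lit 0) (lit 1),
      rep weightE (put 20 (var 6) (lit 0)
        (mul (mul (get 20 (var 6) (lit 0)) (var 3)) (var 3)))]) rfl I.n_eq
    (fun j h' => h' 3 = h 3 ∧ h' 1 = h 1 ∧ ∀ u : Fin n, u < j →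
      (h' 20 u 0 : ZMod M) = ((2 ^ (n + 1) : ℕ) : ZMod M) ^ (2 * wt u) ∧ h' 21 u 0 = 1)
    (fun j h' x K => ?_) ⟨rfl, rfl, fun u hu => absurd hu (Nat.not_lt_zero _)⟩
    fun j hj h' hj' K => ?_
  · have e₄ : initWeights.run w h 4 = h 4 := run_of_not_writes w h rfl
    have e₁ : initWeights.run w h 1 = h 1 := run_of_not_writes w h rfl
    refine ⟨by rw [e₄, h₂], by rw [e₁, h₃], fun u => ?_, fun u => ?_⟩
    · rw [if_neg (by simp)]
      exact (key.2.2 u u.2).1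
    · rw [if_neg (by simp)]
      exact (congrArg Nat.cast (key.2.2 u u.2).2).trans Nat.cast_one
  · simpa only [Store.set_of_ne _ (show 3 ≠ 6 by norm_num),
      Store.set_of_ne _ (show 1 ≠ 6 by norm_num), Store.set_of_ne _ (show 20 ≠ 6 by norm_num),
      Store.set_of_ne _ (show 21 ≠ 6 by norm_num)] using K
  · obtain ⟨K₁, K₂, K₃⟩ := K
    refine ⟨(run_of_not_writes w h' rfl).trans K₁, (run_of_not_writes w h' rfl).trans K₂, ?_⟩
    rw [run_block_cons, run_block_cons, run_block_cons, run_block_nil, run_put, run_put]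
    simp only [eval_var, eval_lit, Store.set_of_ne _ (show 6 ≠ 20 by norm_num), hj']
    have L := run_rep_induction (w := w) (k := wt ⟨j, hj⟩) (e := weightE)
      (p := put 20 (var 6) (lit 0) (mul (mul (get 20 (var 6) (lit 0)) (var 3)) (var 3)))
      (h := (h'.set 20 j 0 1).set 21 j 0 1) (eval_weightE I (by
        rw [Store.set_of_ne _ (by norm_num), Store.set_of_ne _ (by norm_num), hj']))
      (fun i h'' => h'' 6 0 0 = j ∧ h'' 3 = h 3 ∧ h'' 1 = h 1 ∧ h'' 21 j 0 = 1 ∧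
        (h'' 20 j 0 : ZMod M) = ((2 ^ (n + 1) : ℕ) : ZMod M) ^ (2 * i) ∧
        ∀ u : Fin n, u < j → h'' 20 u 0 = h' 20 u 0 ∧ h'' 21 u 0 = h' 21 u 0)
      ?_ fun i hi h'' K' => ?_
    · obtain ⟨-, -, -, L₁, L₂, L₃⟩ := L
      intro u hu
      rcases Nat.lt_succ_iff_lt_or_eq.1 hu with hu | hu
      · rw [(L₃ u hu).1, (L₃ u hu).2]
        exact K₃ u hu
      · obtain rfl : u = ⟨j, hj⟩ := Fin.ext hu
        exact ⟨L₂, L₁⟩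
    · refine ⟨?_, ?_, ?_, ?_, ?_, fun u hu => ?_⟩
      · simp [Store.set_of_ne, hj']
      · simp [Store.set_of_ne, K₁]
      · simp [Store.set_of_ne, K₂]
      · simp [Store.set_self]
      · simp [Store.set_of_ne, Store.set_self]
      · simp [Store.set, hu.ne]
    · obtain ⟨J₁, J₂, J₃, J₄, J₅, J₆⟩ := K'
      rw [run_put]
      simp only [eval_var, eval_lit, eval_mul, eval_get, J₁, J₂, J₃, h₁, h₃]
      refine ⟨by rw [Store.set_of_ne _ (by norm_num), J₁],
        by rw [Store.set_of_ne _ (by norm_num), J₂], by rw [Store.set_of_ne _ (by norm_num), J₃],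
        by rw [Store.set_of_ne _ (by norm_num), J₄], ?_, fun u hu => ?_⟩
      · rw [Store.set_self, ZMod.natCast_mod, Nat.cast_mul, ZMod.natCast_mod, Nat.cast_mul, J₅]
        ring
      · rw [Store.set_of_ne _ (show 21 ≠ 20 by norm_num)]
        simpa [Store.set, hu.ne] using J₆ u hu

/-- The counting program counts the words of the balanced partitions that begin with `o`. -/
theorem run_count_of_ready (I : IsInput w n m a b wt) {s t : Fin n} {K : Multiset (Sym2 (Fin n))}
    (hK : IsTwoTerminalSP Finset.univ K s t)
    (hK' : ∀ u v, s(u, v) ∈ K ↔ ∃ e < m, (a e = u ∧ b e = v) ∨ (a e = v ∧ b e = u)) {o : List ℕ}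
    (ho : ∀ x ∈ o, x = 0 ∨ x = 1) (hl : o.length ≤ n) (H : Ready n wt o h) :
    count.run w h 16 0 0 = prefixCount (balancedWords K wt) o := by
  obtain ⟨S, hS, hS'⟩ := prefixCount_balancedWords K wt ho hl
    (v := fun u : Fin n => valOf ((2 ^ (n + 1)) ^ (∑ v, wt v + 1)) h u) (2 ^ (n + 1))
    (Nat.pow_lt_pow_right (by norm_num) (Nat.lt_succ_self n)) H.val_true H.val_false
  have R := Represents.of_isTwoTerminalSP hK
    (v := fun u : Fin n => valOf ((2 ^ (n + 1)) ^ (∑ v, wt v + 1)) h u)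
  simp only [hK'] at R
  rw [run_count w I.n_eq I.m_eq I.m_pos I.a_eq I.b_eq H.modulus R hS, H.top, hS']

/-- The products in this part are less than the modulus, so that they are the true products. -/
theorem run_select (I : IsInput w n m a b wt) {N r : ℕ} (hr : r < 2 ^ n)
    (hq : 2 ^ n < h 1 0 0 + 1) (h₂ : h 2 0 0 = r) (hc : count.run w h 16 0 0 = N) :
    select.run w h 0 0 0 = 2 ^ n / N * N - r ∧ select.run w h 15 0 0 = r % N := by
  obtain ⟨h₁, e₁⟩ : ∃ h₁, count.run w h = h₁ := ⟨_, rfl⟩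
  have f₁ : h₁ 1 = h 1 := by rw [← e₁, run_of_not_writes w h rfl]
  have f₂ : h₁ 2 = h 2 := by rw [← e₁, run_of_not_writes w h rfl]
  rw [e₁] at hc
  obtain ⟨h₂', e₂⟩ : ∃ h₂', (rep (lit 0) (double 14)).run w
    ((assign 14 (lit 1)).run w ((assign 13 (var 16)).run w h₁)) = h₂' := ⟨_, rfl⟩
  have g₁ : h₂' 14 0 0 = 2 ^ n := by
    rw [← e₂, run_doubles 14 I.n_eq, run_assign, Store.set_self, eval_lit, mul_one]
  have g₂ : ∀ f, f ≠ 14 → h₂' f = (assign 13 (var 16)).run w h₁ f := fun f hf => by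
    rw [← e₂, run_of_not_writes w _ (by simp [double, assign, Writes]; omega), run_assign,
      Store.set_of_ne _ hf]
  have g₃ : h₂' 13 0 0 = N := by
    rw [g₂ 13 (by norm_num), run_assign, Store.set_self, eval_var, hc]
  have g₄ : h₂' 2 0 0 = r := by
    rw [g₂ 2 (by norm_num), run_assign, Store.set_of_ne _ (by norm_num), f₂, h₂]
  have g₅ : h₂' 1 0 0 = h 1 0 0 := by
    rw [g₂ 1 (by norm_num), run_assign, Store.set_of_ne _ (by norm_num), f₁]
  have e : select.run w h = (h₂'.set 0 0 0 (2 ^ n / N * N - r)).set 15 0 0 (r % N) := by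
    rw [select, run_block_cons, e₁, run_block_cons, run_block_cons, run_block_cons, e₂,
      run_block_cons, run_block_cons, run_block_nil, run_assign, run_assign]
    simp only [eval_sub, eval_mul, eval_div, eval_var, Store.set_of_ne _ (show 2 ≠ 0 by norm_num),
      Store.set_of_ne _ (show 13 ≠ 0 by norm_num), Store.set_of_ne _ (show 1 ≠ 0 by norm_num),
      g₁, g₃, g₄, g₅]
    have k₁ : 2 ^ n / N * N ≤ 2 ^ n := Nat.div_mul_le_self _ _
    have k₂ : r / N * N ≤ r := Nat.div_mul_le_self _ _
    rw [Nat.mod_eq_of_lt (by omega), Nat.mod_eq_of_lt (by omega), Nat.mod_eq_sub_div_mul]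
  rw [e, Store.set_of_ne _ (by norm_num), Store.set_self, Store.set_self]
  exact ⟨rfl, rfl⟩

theorem count_silent : count.Silent = true := by decide

/-- The next letter of the output is that of the wanted word. -/
theorem den_nextLetter (I : IsInput w n m a b wt) {s t : Fin n} {K : Multiset (Sym2 (Fin n))}
    (hK : IsTwoTerminalSP Finset.univ K s t)
    (hK' : ∀ u v, s(u, v) ∈ K ↔ ∃ e < m, (a e = u ∧ b e = v) ∨ (a e = v ∧ b e = u)) {r k : ℕ}
    (hk : k < n) {σ : Config} (h5 : σ.h 5 0 0 = k)
    (hσ : (σ.out, σ.h 15 0 0) = unrank (balancedWords K wt) k r) (H : Ready n wt σ.out σ.h) :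
    ((nextLetter.den w σ).out, (nextLetter.den w σ).h 15 0 0) =
      unrank (balancedWords K wt) (k + 1) r ∧
    Ready n wt (nextLetter.den w σ).out (nextLetter.den w σ).h := by
  set S := balancedWords K wt with hS
  obtain ⟨h, o⟩ := σ
  dsimp only at h5 hσ H
  have ho : o = (unrank S k r).1 := congrArg Prod.fst hσ
  have hi : h 15 0 0 = (unrank S k r).2 := congrArg Prod.snd hσ
  have hlen : o.length = k := by rw [ho, unrank_length]
  have hbin : ∀ x ∈ o, x = 0 ∨ x = 1 := by rw [ho]; exact unrank_mem k r
  -- Extending the output by a letter excludes one of the two sides for the vertex `k`.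
  have hget : ∀ (x y : ℕ) (u : Fin n), (o ++ [x])[(u : ℕ)]? = some y ↔
      (u = k ∧ x = y) ∨ (u ≠ k ∧ o[(u : ℕ)]? = some y) := by
    intro x y u
    rcases lt_trichotomy (u : ℕ) k with hu | hu | hu
    · rw [List.getElem?_append_left (by omega)]
      simp [hu.ne]
    · rw [List.getElem?_append_right (by omega), hlen, hu]
      simp
    · rw [List.getElem?_append_right (by omega), List.getElem?_eq_none (l := o) (by omega),
        List.getElem?_eq_none (by simp; omega)]
      simp [hu.ne']
  have hnone : ∀ (u : Fin n) (y : ℕ), (u : ℕ) = k → o[(u : ℕ)]? ≠ some y := fun u y hu => by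
    rw [List.getElem?_eq_none (by omega)]
    simp
  have R₁ : Ready n wt (o ++ [1]) (h.set 21 k 0 0) := by
    refine ⟨?_, ?_, fun u => ?_, fun u => ?_⟩
    · rw [Store.set_of_ne _ (by norm_num), H.top]
    · rw [Store.set_of_ne _ (by norm_num), H.modulus]
    · rw [Store.set_of_ne _ (by norm_num), H.val_true]
      refine if_congr ?_ rfl rfl
      rw [hget]
      have := hnone u 0
      grind
    · by_cases hu : (u : ℕ) = k
      · rw [if_pos ((hget _ _ _).2 (Or.inl ⟨hu, rfl⟩)), hu, Store.set_self, Nat.cast_zero]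
      · have : h.set 21 k 0 0 21 u 0 = h 21 u 0 := by simp [Store.set, hu]
        rw [this, H.val_false]
        refine if_congr ?_ rfl rfl
        rw [hget]
        grind
  obtain ⟨h₁, e₁⟩ : ∃ h₁, count.run w (h.set 21 k 0 0) = h₁ := ⟨_, rfl⟩
  have hc : h₁ 16 0 0 = prefixCount S (o ++ [1]) := by
    rw [← e₁, run_count_of_ready I hK hK' (fun x hx => ?_) (by simp; omega) R₁]
    rcases List.mem_append.1 hx with hx | hx
    · exact hbin x hx
    · exact Or.inr (List.mem_singleton.1 hx)
  have hw : ∀ f, count.Writes f = false → h₁ f = h.set 21 k 0 0 f := fun f hf => by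
    rw [← e₁, run_of_not_writes w _ hf]
  have f₅ : h₁ 5 0 0 = k := by rw [hw 5 rfl, Store.set_of_ne _ (by norm_num), h5]
  have f₁₅ : h₁ 15 0 0 = (unrank S k r).2 := by
    rw [hw 15 rfl, Store.set_of_ne _ (by norm_num), hi]
  have R₂ : Ready n wt (o ++ [1]) h₁ := R₁.congr fun f hf => by
    simp only [List.mem_cons, List.not_mem_nil, or_false] at hf
    rcases hf with rfl | rfl | rfl | rfl <;> exact hw _ rfl
  have hden : nextLetter.den w ⟨h, o⟩ = (ite (sub (var 16) (var 15)) (write (lit 1)) (block [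
    assign 15 (sub (var 15) (var 16)),
    put 20 (var 5) (lit 0) (lit 0), put 21 (var 5) (lit 0) (lit 1), write (lit 0)])).den w
      ⟨h₁, o⟩ := by
    simp only [nextLetter, block, Stmt.den, eval_var, eval_lit, h5]
    rw [den_of_silent w count_silent]
    simp only [e₁]
  rw [hden, Stmt.den]
  simp only [eval_sub, eval_var, hc, f₁₅]
  rw [unrank]
  by_cases hlt : (unrank S k r).2 < prefixCount S (o ++ [1])
  · rw [if_neg (by omega), if_pos (by rwa [← ho])]
    simp only [Stmt.den, eval_lit]
    rw [f₁₅, ho]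
    exact ⟨rfl, ho ▸ R₂⟩
  · rw [if_pos (by omega), if_neg (by rwa [← ho])]
    simp only [block, assign, Stmt.den, eval_lit, eval_sub, eval_var]
    refine ⟨?_, ?_, ?_, fun u => ?_, fun u => ?_⟩
    · simp only [Store.set_of_ne _ (show 15 ≠ 21 by norm_num), Store.set_self,
        Store.set_of_ne _ (show 15 ≠ 20 by norm_num), hc, f₁₅, ho]
    · simp only [Store.set_of_ne _ (show 4 ≠ 21 by norm_num),
        Store.set_of_ne _ (show 4 ≠ 20 by norm_num), Store.set_of_ne _ (show 4 ≠ 15 by norm_num),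
        R₂.top]
    · simp only [Store.set_of_ne _ (show 1 ≠ 21 by norm_num),
        Store.set_of_ne _ (show 1 ≠ 20 by norm_num), Store.set_of_ne _ (show 1 ≠ 15 by norm_num),
        R₂.modulus]
    · simp only [Store.set_of_ne _ (show 20 ≠ 21 by norm_num),
        Store.set_of_ne _ (show 5 ≠ 15 by norm_num), f₅]
      by_cases hu : (u : ℕ) = k
      · rw [if_pos ((hget _ _ _).2 (Or.inl ⟨hu, rfl⟩)), hu, Store.set_self, Nat.cast_zero]
      · have : ∀ x y z, (h₁.set 15 0 0 x).set 20 k y z 20 u 0 = h₁ 20 u 0 := by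
          simp [Store.set, hu]
        rw [this, R₂.val_true]
        refine if_congr ?_ rfl rfl
        rw [hget, hget]
        grind
    · simp only [Store.set_of_ne _ (show 5 ≠ 20 by norm_num),
        Store.set_of_ne _ (show 5 ≠ 15 by norm_num), f₅]
      by_cases hu : (u : ℕ) = k
      · rw [if_neg (by rw [hget]; grind), hu, Store.set_self, Nat.cast_one]
      · have : ∀ x y z z', ((h₁.set 15 0 0 x).set 20 k y z).set 21 k y z' 21 u 0 = h₁ 21 u 0 := by
          simp [Store.set, hu]
        rw [this, R₂.val_false]
        refine if_congr ?_ rfl rfl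
        rw [hget, hget]
        grind

/-- The result of the sampling program. -/
theorem final_sampler (I : IsInput w n m a b wt) {s t : Fin n} {K : Multiset (Sym2 (Fin n))}
    (hK : IsTwoTerminalSP Finset.univ K s t)
    (hK' : ∀ u v, s(u, v) ∈ K ↔ ∃ e < m, (a e = u ∧ b e = v) ∨ (a e = v ∧ b e = u)) {r : ℕ}
    (hr : r < 2 ^ n) :
    (sampler.final w r).h 0 0 0 =
      2 ^ n / (balancedWords K wt).card * (balancedWords K wt).card - r ∧
    (sampler.final w r).out =
      (unrank (balancedWords K wt) n (r % (balancedWords K wt).card)).1 := by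
  set S := balancedWords K wt with hS
  obtain ⟨i₁, i₂, i₃⟩ := run_initPowers I (h := randomStore r)
  obtain ⟨h₁, e₁⟩ : ∃ h₁, initPowers.run w (randomStore r) = h₁ := ⟨_, rfl⟩
  rw [e₁] at i₁ i₂ i₃
  obtain ⟨h₂, e₂⟩ : ∃ h₂, initWeights.run w h₁ = h₂ := ⟨_, rfl⟩
  have R₂ := run_initWeights I i₁ i₂ i₃
  rw [e₂] at R₂
  have f₂ : h₂ 2 0 0 = r := by
    rw [← e₂, run_of_not_writes w h₁ rfl, ← e₁, run_of_not_writes w _ rfl, randomStore,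
      Store.set_self]
  have hc : count.run w h₂ 16 0 0 = S.card := by
    rw [run_count_of_ready I hK hK' (by simp) (by simp) R₂, prefixCount,
      Finset.filter_true_of_mem fun s _ => List.nil_prefix]
  have hq : 2 ^ n < h₂ 1 0 0 + 1 := by
    rw [R₂.modulus, ← pow_mul]
    refine Nat.pow_lt_pow_right (by norm_num) ?_
    nlinarith [Nat.zero_le (∑ v, wt v)]
  obtain ⟨j₁, j₂⟩ := run_select I hr hq f₂ hc
  obtain ⟨h₃, e₃⟩ : ∃ h₃, select.run w h₂ = h₃ := ⟨_, rfl⟩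
  rw [e₃] at j₁ j₂
  have R₃ : Ready n wt [] h₃ := R₂.congr fun f hf => by
    simp only [List.mem_cons, List.not_mem_nil, or_false] at hf
    rw [← e₃]
    rcases hf with rfl | rfl | rfl | rfl <;> exact run_of_not_writes w _ rfl
  have hden : sampler.final w r = (forLoop 5 (lit 0) nextLetter).den w ⟨h₃, []⟩ := by
    rw [Stmt.final, sampler, Stmt.den, Stmt.den, Stmt.den,
      den_of_silent w (show initPowers.Silent = true by decide),
      den_of_silent w (show initWeights.Silent = true by decide),
      den_of_silent w (show select.Silent = true by decide)]
    simp only [e₁, e₂, e₃]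
  rw [hden]
  refine ⟨?_, ?_⟩
  · rw [den_h, run_of_not_writes w _ (by decide)]
    exact j₁
  · rw [forLoop, Stmt.den, Stmt.den, eval_lit, I.n_eq]
    have key : ∀ k ≤ n, ∀ σ, (((seq nextLetter (assign 5 (add (var 5) (lit 1)))).den w)^[k]
        ((assign 5 (lit 0)).den w ⟨h₃, []⟩)) = σ →
        σ.h 5 0 0 = k ∧ (σ.out, σ.h 15 0 0) = unrank S k (r % S.card) ∧
          Ready n wt σ.out σ.h := by
      intro k
      induction k with
      | zero =>
        rintro - σ rfl
        change (h₃.set 5 0 0 0) 5 0 0 = 0 ∧ ([], (h₃.set 5 0 0 0) 15 0 0) = _ ∧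
          Ready n wt [] (h₃.set 5 0 0 0)
        refine ⟨Store.set_self _ _ _ _ _, ?_, R₃.congr fun f hf => ?_⟩
        · rw [unrank, ← j₂, Store.set_of_ne _ (by norm_num)]
        · simp only [List.mem_cons, List.not_mem_nil, or_false] at hf
          exact Store.set_of_ne _ (by omega) _ _ _
      | succ k ih =>
        rintro hk σ rfl
        rw [Function.iterate_succ_apply']
        obtain ⟨l₁, l₂, l₃⟩ := ih (by omega) _ rfl
        obtain ⟨l₄, l₅⟩ := den_nextLetter I hK hK' (by omega) l₁ l₂ l₃
        rw [Stmt.den]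
        refine ⟨?_, ?_, ?_⟩
        · rw [den_h, run_assign, Store.set_self, eval_add, eval_var, eval_lit, den_h,
            run_of_not_writes w _ (by decide), l₁]
        · rw [← l₄, den_of_silent w rfl, run_assign]
          dsimp only
          rw [Store.set_of_ne _ (by norm_num)]
        · rw [den_of_silent w rfl, run_assign]
          refine l₅.congr fun f hf => ?_
          simp only [List.mem_cons, List.not_mem_nil, or_false] at hf
          exact Store.set_of_ne _ (by omega) _ _ _
    exact congrArg Prod.fst (key n le_rfl _ rfl).2.1

end

end BoundedLoop

/-! ### Balanced partitions and the input word -/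

theorem IsTwoTerminalSP.edges_ne_zero {α : Type} [DecidableEq α] {V : Finset α}
    {E : Multiset (Sym2 α)} {s t : α} (h : IsTwoTerminalSP V E s t) : E ≠ 0 := by
  induction h with
  | edge s t h => exact Multiset.singleton_ne_zero _
  | series V₁ V₂ E₁ E₂ s m t h₁ h₂ h ih₁ ih₂ => exact fun h => ih₁ (by simp_all)
  | parallel V₁ V₂ E₁ E₂ s t h₁ h₂ h ih₁ ih₂ => exact fun h => ih₁ (by simp_all)

/-- The entries of a list of pairs that is written as a list of numbers, followed by `r`. -/
theorem getElem?_flatMap_pair_append {α : Type*} (f g : α → ℕ) (l : List α) (r : List ℕ) :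
    (∀ e, (he : e < l.length) →
      (l.flatMap (fun x => [f x, g x]) ++ r)[e + e]? = some (f l[e]) ∧
      (l.flatMap (fun x => [f x, g x]) ++ r)[e + e + 1]? = some (g l[e])) ∧
    ∀ i, (l.flatMap (fun x => [f x, g x]) ++ r)[l.length + l.length + i]? = r[i]? := by
  induction l with
  | nil => simp
  | cons x l ih =>
    refine ⟨fun e he => ?_, fun i => ?_⟩
    · cases e with
      | zero => simp
      | succ e =>
        have := ih.1 e (by simpa using he)
        rw [show e + 1 + (e + 1) = e + e + 1 + 1 by ring]
        simpa using this
    · have := ih.2 i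
      rw [List.length_cons,
        show l.length + 1 + (l.length + 1) + i = l.length + l.length + i + 1 + 1 by ring]
      simpa using this

namespace NodeWeightedGraph

variable (G : NodeWeightedGraph)

/-- The edges as a multiset of unordered pairs. -/
def edgeMultiset : Multiset (Sym2 (Fin G.n)) :=
  ((G.edges.map fun e => s(e.1, e.2) : List (Sym2 (Fin G.n))) : Multiset (Sym2 (Fin G.n)))

theorem adj_iff {u v : Fin G.n} : G.graph.Adj u v ↔ u ≠ v ∧ s(u, v) ∈ G.edgeMultiset := by
  simp only [graph, SimpleGraph.fromRel_adj, edgeMultiset, Multiset.mem_coe, List.mem_map,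
    Sym2.eq_iff, Prod.exists]
  grind

theorem conn_iff_connected (A : Finset (Fin G.n)) :
    Conn G.edgeMultiset A ↔ (G.graph.induce (A : Set (Fin G.n))).Connected := by
  constructor
  · rintro ⟨r, hr, h⟩
    have key : ∀ w, Linked G.edgeMultiset A r w → ∀ hw : w ∈ A,
        (G.graph.induce (A : Set (Fin G.n))).Reachable ⟨r, hr⟩ ⟨w, hw⟩ := by
      intro w hrw
      induction hrw with
      | refl => exact fun _ => .rfl
      | @tail b c _ hbc ih =>
        intro hc
        by_cases e : b = c
        · subst e
          exact ih hc
        · exact (ih hbc.2.1).trans (SimpleGraph.Adj.reachable (G.adj_iff.2 ⟨e, hbc.1⟩))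
    have : Nonempty (A : Set (Fin G.n)) := ⟨⟨r, hr⟩⟩
    exact ⟨fun u w => (key u (h u u.2) u.2).symm.trans (key w (h w w.2) w.2)⟩
  · intro h
    obtain ⟨⟨r, hr⟩⟩ := h.nonempty
    refine ⟨r, hr, fun u hu => ?_⟩
    have := (SimpleGraph.reachable_iff_reflTransGen _ _).1 (h.preconnected ⟨r, hr⟩ ⟨u, hu⟩)
    exact Relation.ReflTransGen.lift Subtype.val
      (fun a b hab => ⟨(G.adj_iff.1 hab).2, a.2, b.2⟩) _ _ this

theorem mem_balancedPartitions_iff (A B : Finset (Fin G.n)) : (A, B) ∈ G.balancedPartitions ↔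
    B = Aᶜ ∧ IsBond G.edgeMultiset Finset.univ A ∧ 2 * ∑ v ∈ A, G.w v = ∑ v, G.w v := by
  simp only [balancedPartitions, Set.mem_ofPred_eq, IsBond, conn_iff_connected,
    ← Finset.compl_eq_univ_sdiff]
  have hsum := Finset.sum_add_sum_compl A G.w
  constructor
  · rintro ⟨h₁, h₂, h₃, h₄, h₅⟩
    obtain rfl : B = Aᶜ := (IsCompl.compl_eq ⟨h₁, codisjoint_iff.2 h₂⟩).symm
    exact ⟨rfl, ⟨h₃, h₄⟩, by omega⟩
  · rintro ⟨rfl, ⟨h₃, h₄⟩, h₅⟩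
    exact ⟨disjoint_compl_right, Finset.union_compl A, h₃, h₄, by omega⟩

/-- The output words of the balanced partitions. -/
theorem image_encodePartition :
    G.encodePartition '' G.balancedPartitions = balancedWords G.edgeMultiset G.w := by
  classical
  ext s
  simp only [Set.mem_image, balancedWords, Finset.coe_image, Finset.coe_filter, Finset.mem_univ,
    true_and, Set.mem_ofPred_eq]
  constructor
  · rintro ⟨⟨A, B⟩, h, rfl⟩
    exact ⟨A, ((G.mem_balancedPartitions_iff A B).1 h).2, rfl⟩
  · rintro ⟨A, h, rfl⟩
    exact ⟨(A, Aᶜ), (G.mem_balancedPartitions_iff _ _).2 ⟨rfl, h⟩, rfl⟩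

theorem ncard_balancedPartitions :
    G.balancedPartitions.ncard = (balancedWords G.edgeMultiset G.w).card := by
  rw [← Set.ncard_coe_finset, ← image_encodePartition,
    G.encodePartition_injOn.ncard_image]

theorem le_of_mem_encode : ∀ x ∈ G.encode, x ≤ G.size + G.totalWeight := by
  intro x hx
  simp only [encode, List.mem_cons, List.mem_append, List.mem_flatMap, List.not_mem_nil, or_false,
    List.mem_ofFn] at hx
  rw [size, totalWeight]
  rcases hx with rfl | rfl | ⟨e, -, rfl | rfl⟩ | ⟨v, rfl⟩
  · omega
  · omega
  · have := e.1.2; omega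
  · have := e.2.2; omega
  · have := Finset.single_le_sum (f := G.w) (fun _ _ => Nat.zero_le _) (Finset.mem_univ v)
    omega

/-- The input word in terms of the ends of the edges. -/
theorem exists_isInput (hE : G.edgeMultiset ≠ 0) (s : Fin G.n) :
    ∃ (m : ℕ) (a b : ℕ → Fin G.n), BoundedLoop.IsInput G.encode G.n m a b G.w ∧
      ∀ u v, s(u, v) ∈ G.edgeMultiset ↔
        ∃ e < m, (a e = u ∧ b e = v) ∨ (a e = v ∧ b e = u) := by
  have key := getElem?_flatMap_pair_append (fun e : Fin G.n × Fin G.n => (e.1 : ℕ))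
    (fun e => (e.2 : ℕ)) G.edges (List.ofFn G.w)
  have h₂ : ∀ i, G.encode.getD (2 + i) 0 = (G.edges.flatMap (fun e => [(e.1 : ℕ), (e.2 : ℕ)]) ++
      List.ofFn G.w)[i]?.getD 0 := fun i => by
    rw [add_comm, List.getD_eq_getElem?_getD]
    rfl
  refine ⟨G.edges.length, fun e => ((G.edges[e]?).getD (s, s)).1,
    fun e => ((G.edges[e]?).getD (s, s)).2, ⟨rfl, rfl, ?_, fun e he => ?_, fun e he => ?_,
    fun i => ?_⟩, fun u v => ?_⟩
  · rw [List.length_pos_iff]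
    intro h
    exact hE (by rw [edgeMultiset, h]; rfl)
  · rw [h₂, (key.1 e he).1, List.getElem?_eq_getElem he]
    rfl
  · rw [show 3 + (e + e) = 2 + (e + e + 1) by ring, h₂, (key.1 e he).2,
      List.getElem?_eq_getElem he]
    rfl
  · rw [h₂, key.2, List.getElem?_eq_getElem (by simp)]
    simp
  · simp only [edgeMultiset, Multiset.mem_coe, List.mem_map, Sym2.eq_iff]
    constructor
    · rintro ⟨e, he, h⟩
      obtain ⟨i, hi, rfl⟩ := List.getElem_of_mem he
      refine ⟨i, hi, ?_⟩
      rw [List.getElem?_eq_getElem hi]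
      exact h
    · rintro ⟨i, hi, h⟩
      rw [List.getElem?_eq_getElem hi] at h
      exact ⟨_, List.getElem_mem hi, h⟩

end NodeWeightedGraph

/-! ### The distribution of the result -/

namespace BoundedLoop

open scoped Classical in
theorem map_coins_apply {β : Type} (j : ℕ) (f : ℕ → β) (x : β) :
    (coins j).map f x = (((Finset.range (2 ^ j)).filter fun r => f r = x).card : ℝ≥0∞) *
      ((2 : ℝ≥0∞) ^ j)⁻¹ := by
  rw [PMF.map_apply, tsum_eq_sum (s := (Finset.range (2 ^ j)).filter fun r => f r = x),
    Finset.sum_congr rfl (g := fun _ => ((2 : ℝ≥0∞) ^ j)⁻¹), Finset.sum_const, nsmul_eq_mul]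
  · intro r hr
    rw [Finset.mem_filter, Finset.mem_range] at hr
    rw [if_pos hr.2.symm, coins_apply, if_pos hr.1]
  · intro r hr
    rw [Finset.mem_filter, Finset.mem_range, not_and] at hr
    by_cases h : r < 2 ^ j
    · rw [if_neg fun e => hr h e.symm]
    · rw [coins_apply, if_neg h, ite_self]

theorem card_filter_mod_eq {N K r : ℕ} (hr : r < N) :
    ((Finset.range (K * N)).filter fun i => i % N = r).card = K := by
  have h : (Finset.range (K * N)).filter (fun i => i % N = r) =
      (Finset.range K).image fun j => j * N + r := by
    ext i
    simp only [Finset.mem_filter, Finset.mem_range, Finset.mem_image]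
    constructor
    · rintro ⟨h₁, h₂⟩
      exact ⟨i / N, Nat.div_lt_of_lt_mul (by rwa [mul_comm]), by
        rw [← h₂, mul_comm]; exact Nat.div_add_mod i N⟩
    · rintro ⟨j, hj, rfl⟩
      refine ⟨by nlinarith, ?_⟩
      rw [Nat.mul_add_mod_self_right, Nat.mod_eq_of_lt hr]
  rw [h, Finset.card_image_of_injective, Finset.card_range]
  intro i j hij
  exact Nat.eq_of_mul_eq_mul_right (by omega) (Nat.add_right_cancel hij)

/-- A uniform random number below `2 ^ n` gives a uniform sampler from a set of `N ≤ 2 ^ n`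
elements: numbers from the largest multiple of `N` on are rejected, and the other ones are reduced
modulo `N`. -/
theorem samplesUniformly_map_coins {α β : Type} {n N : ℕ} (hN : N ≤ 2 ^ n) {enc : α → β} {S : Set α}
    (hS : S.ncard = N) (hS' : S.Finite) {dec : ℕ → β}
    (hdec : ∀ a ∈ S, ∃! r, r < N ∧ dec r = enc a)
    {f : ℕ → Option β} (hf : ∀ r < 2 ^ n, f r =
      if 2 ^ n / N * N - r = 0 then none else some (dec (r % N))) :
    SamplesUniformly ((coins n).map f) enc S := by
  classical
  set K := 2 ^ n / N with hK
  have hKN : K * N ≤ 2 ^ n := Nat.div_mul_le_self _ _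
  set c : ℝ≥0∞ := ((2 : ℝ≥0∞) ^ n)⁻¹ with hc
  have hc₀ : ((2 ^ n : ℕ) : ℝ≥0∞) * c = 1 := by
    rw [Nat.cast_pow, Nat.cast_ofNat, hc]
    exact ENNReal.mul_inv_cancel (by simp) (by simp)
  have hc₁ : c ≠ 0 := by simp [hc]
  have hc₂ : c ≠ ⊤ := by simp [hc]
  have hnone : (coins n).map f none = ((2 ^ n - K * N : ℕ) : ℝ≥0∞) * c := by
    rw [map_coins_apply]
    congr 2
    rw [← Nat.card_Ico]
    congr 1
    ext r
    simp only [Finset.mem_filter, Finset.mem_range, Finset.mem_Ico]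
    constructor
    · rintro ⟨h₁, h₂⟩
      rw [hf r h₁] at h₂
      split_ifs at h₂ with h₃
      exact ⟨by omega, h₁⟩
    · rintro ⟨h₁, h₂⟩
      exact ⟨h₂, by rw [hf r h₂, if_pos (by omega)]⟩
  refine ⟨fun hne => ?_, fun he => ?_⟩
  · have hN₀ : 0 < N := by rw [← hS]; exact (Set.ncard_pos hS').2 hne
    have hK₀ : 0 < K := Nat.div_pos hN hN₀
    have hlt : 2 ^ n < (K + 1) * N := by
      rw [hK, mul_comm]
      exact Nat.lt_mul_div_succ _ hN₀
    have hle : N ≤ K * N := Nat.le_mul_of_pos_left N hK₀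
    have hsub : 1 - (coins n).map f none = ((K * N : ℕ) : ℝ≥0∞) * c := by
      rw [hnone]
      refine (ENNReal.eq_sub_of_add_eq ?_ ?_).symm
      · exact ENNReal.mul_ne_top (ENNReal.natCast_ne_top _) hc₂
      · rw [← add_mul, ← Nat.cast_add, Nat.add_sub_of_le hKN, hc₀]
    refine ⟨?_, fun a ha => ?_⟩
    · rw [hnone, ENNReal.le_div_iff_mul_le (by simp) (by simp), mul_right_comm]
      rw [← hc₀]
      gcongr
      rw [add_mul, one_mul] at hlt
      have : ((((2 ^ n - K * N) * 2 : ℕ)) : ℝ≥0∞) ≤ ((2 ^ n : ℕ) : ℝ≥0∞) := Nat.cast_le.2 (by omega)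
      rwa [Nat.cast_mul, Nat.cast_ofNat] at this
    · have hsome : (coins n).map f (some (enc a)) = (K : ℝ≥0∞) * c := by
        obtain ⟨r₀, ⟨h₁, h₂⟩, h₃⟩ := hdec a ha
        rw [map_coins_apply]
        congr 2
        rw [← card_filter_mod_eq (K := K) h₁]
        congr 1
        ext r
        simp only [Finset.mem_filter, Finset.mem_range]
        constructor
        · rintro ⟨h₄, h₅⟩
          rw [hf r h₄] at h₅
          split_ifs at h₅ with h₆
          exact ⟨by omega, h₃ _ ⟨Nat.mod_lt _ hN₀, Option.some_injective _ h₅⟩⟩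
        · rintro ⟨h₄, rfl⟩
          refine ⟨by omega, ?_⟩
          rw [hf r (by omega), if_neg (by omega), h₂]
      rw [hsub, hsome, hS, Nat.cast_mul, mul_right_comm]
      have := ENNReal.mul_div_mul_left 1 (N : ℝ≥0∞) (c := (K : ℝ≥0∞) * c)
        (mul_ne_zero (by exact_mod_cast hK₀.ne') hc₁)
        (ENNReal.mul_ne_top (ENNReal.natCast_ne_top _) hc₂)
      rwa [mul_one] at this
  · rw [he, Set.ncard_empty] at hS
    rw [hnone, ← hS, mul_zero, Nat.sub_zero, hc₀]

end BoundedLoop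

theorem mainTheorem7 :
    ∃ (M : List RAM.Cmd) (p : MvPolynomial (Fin 2) ℕ),
      ∀ G : NodeWeightedGraph, G.IsSeriesParallel →
        RAM.HaltsInTime M G.encode (MvPolynomial.eval ![G.size, G.totalWeight] p) ∧
        SamplesUniformly
          (RAM.resultDist M G.encode (MvPolynomial.eval ![G.size, G.totalWeight] p))
          G.encodePartition G.balancedPartitions := by
  obtain ⟨T, hT⟩ := BoundedLoop.machine_spec BoundedLoop.sampler
  refine ⟨BoundedLoop.machine BoundedLoop.sampler,
    T.eval₂ MvPolynomial.C (MvPolynomial.X 0 + MvPolynomial.X 1), fun G ⟨s, t, hG⟩ => ?_⟩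
  have hp : MvPolynomial.eval ![G.size, G.totalWeight]
      (T.eval₂ MvPolynomial.C (MvPolynomial.X 0 + MvPolynomial.X 1)) =
      T.eval (G.size + G.totalWeight) := by
    rw [Polynomial.hom_eval₂, show (MvPolynomial.eval ![G.size, G.totalWeight]).comp
      MvPolynomial.C = RingHom.id ℕ from RingHom.ext fun x => by simp]
    simp
  rw [hp]
  change IsTwoTerminalSP Finset.univ G.edgeMultiset s t at hG
  obtain ⟨h₁, h₂⟩ := hT G.encode _ G.le_of_mem_encode
  refine ⟨h₁, ?_⟩
  rw [h₂]
  obtain ⟨m, a, b, I, hK⟩ := G.exists_isInput hG.edges_ne_zero s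
  have hcard : (balancedWords G.edgeMultiset G.w).card ≤ 2 ^ G.n := by
    classical
    refine Finset.card_image_le.trans ((Finset.card_le_univ _).trans ?_)
    rw [Fintype.card_finset, Fintype.card_fin]
  have hbin : IsBinary (balancedWords G.edgeMultiset G.w) G.n := by
    classical
    intro o ho
    obtain ⟨A, -, rfl⟩ := Finset.mem_image.1 ho
    refine ⟨List.length_ofFn, fun x hx => ?_⟩
    obtain ⟨v, rfl⟩ := List.mem_ofFn.1 hx
    split_ifs <;> simp
  refine BoundedLoop.samplesUniformly_map_coins hcard G.ncard_balancedPartitions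
    (Set.toFinite _) (dec := fun r => (unrank (balancedWords G.edgeMultiset G.w) G.n r).1)
    (fun P hP => existsUnique_unrank hbin ?_) fun r hr => ?_
  · rw [← Finset.mem_coe, ← G.image_encodePartition]
    exact Set.mem_image_of_mem _ hP
  · obtain ⟨e₁, e₂⟩ := BoundedLoop.final_sampler I hG hK hr
    rw [e₁, e₂]
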